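/- **Corollary 2.1.** *Setting.* Let $\Gamma\subset\mathbb R^n\times\mathbb R^n\times\mathbb R$ be a domain (a nonempty connected open set) whose fibres $I(x,y)=\{z:(x,y,z)\in\Gamma\}$ are open intervals, and let $g\in C^2(\Gamma)$ with $g_z<0$. Put $\mathcal U=\{(x,g(x,y,z),g_x(x,y,z)):(x,y,z)\in\Gamma\}$ and suppose that $\mathcal U$ is open and that for each $(x,u,p)\in\mathcal U$ there are unique $Y=Y(x,u,p)\in\mathbb R^n$ and $Z=Z(x,u,p)\in\mathbb R$ with $(x,Y,Z)\in\Gamma$, $g(x,Y,Z)=u$, $g_x(x,Y,Z)=p$, where $Y,Z\in C^1(\mathcal U)$. Let $A(x,u,p)=g_{xx}(x,Y(x,u,p),Z(x,u,p))$ and let $B:\mathcal U\to\mathbb R$. Assume that $A,B\in C^2(\mathcal U)$, that $B>0$, that $\mathcal U$ is convex in $p$ for fixed $(x,u)$, and that in $\mathcal U$ $$(D_{p_kp_l}A_{ij})\,\xi_i\xi_j\eta_k\eta_l\ge 0\qquad\text{whenever } \xi,\eta\in\mathbb R^n,\ \xi\cdot\eta=0 .$$ For a function $u$ write $J_1[u]=(\cdot,u,Du)$.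 An elliptic solution of the generated Jacobian equation in a bounded domain $\Omega\subset\mathbb R^n$ is a function $u$ with $J_1[u](\Omega)\subset\mathcal U$ such that, in $\Omega$, the matrix $D^2u-A(\cdot,u,Du)$ is positive definite and $$\det[D^2u-A(\cdot,u,Du)]=B(\cdot,u,Du).$$ *Strict $g$-convexity.* For such a $u$ and $x_0\in\Omega$ let $y_0=Y(x_0,u(x_0),Du(x_0))$ and $z_0=Z(x_0,u(x_0),Du(x_0))$. For $h>0$ let $S_h(x_0)$ be the connected component containing $x_0$ of $$\{x\in\Omega:\ (x,y_0,z_0-h)\in\Gamma,\ u(x)<g(x,y_0,z_0-h)\}.$$ For $R>0$ let $\omega[u](x_0,R)$ be the supremum of the $h>0$ such that $(x_0,y_0,z_0-h)\in\Gamma$ and $S_{h'}(x_0)\subset B_R(x_0)$ for all $0<h'\le h$ (with $\sup\emptyset=0$). For $\Omega'\subset\Omega$ let $\omega[u](\Omega',\Omega)(R)=\inf_{x_0\in\Omega'}\omega[u](x_0,R)$. *Barrier.* For a domain $\Omega'\subset\subset\Omega$, the open set $\mathcal N'=\Omega\setminus\overline{\Omega'}$ is $A$-bounded with respect to $u$,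 with barrier $\phi\in C^2(\overline{\mathcal N'})$, if $$\big[D_{ij}\phi-D_{p_k}A_{ij}(\cdot,u,Du)\,D_k\phi\big]\xi_i\xi_j\ge|\xi|^2\quad\text{in }\mathcal N',\ \text{for all }\xi\in\mathbb R^n .$$ *Statement.* Let $n,g,B$ be as above, and let $\mathcal U_0\subset\subset\mathcal U$, $R_0\in\mathbb R$, a positive function $\omega_0$ on $(0,R_0)$, and $K\ge0$ be given. Then there is a constant $C$, depending only on $n,\mathcal U,\mathcal U_0,g,B,R_0,\omega_0$ and $K$, such that the following holds. Let $\Omega\subset\mathbb R^n$ be a bounded domain, let $\Omega'\subset\subset\Omega$ be a subdomain with $\operatorname{dist}(\Omega',\partial\Omega)=R_0$, and let $u\in C^4(\Omega)\cap C^2(\overline\Omega)$ be an elliptic solution in $\Omega$ with $J_1[u](\Omega)\subset\mathcal U_0$ and $\omega[u](\Omega',\Omega)(R)\ge\omega_0(R)$ for $0<R<R_0$. Suppose that $\mathcal N'=\Omega\setminus\overline{\Omega'}$ is $A$-bounded with respect to $u$, with a barrier $\phi$ such that $\sup_{\mathcal N'}|\phi|+\sup_{\mathcal N'}|D\phi|\le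 K$. Then $$\sup_\Omega|D^2u|\le C\Big(1+\sup_{\partial\Omega}|D^2u|\Big).$$ -/

import Mathlib

open Set Topology
open scoped NNReal ENNReal Gradient

noncomputable section

namespace GJE

/-- The Euclidean space `ℝⁿ`. -/
abbrev Eu (n : ℕ) : Type := EuclideanSpace ℝ (Fin n)

/-- Bilinear forms on `ℝⁿ`; a symmetric matrix is treated as the form `(ξ, η) ↦ a_{ij} ξ_i η_j`. -/
abbrev Bil (n : ℕ) : Type := Eu n →L[ℝ] Eu n →L[ℝ] ℝ

variable {n : ℕ}

/-- A domain: a nonempty connected open set. -/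
def IsDom {X : Type*} [TopologicalSpace X] (S : Set X) : Prop :=
  IsOpen S ∧ IsConnected S

/-- `S ⊂⊂ T`: the closure of `S` is a compact subset of `T`. -/
def CompactlyIn {X : Type*} [TopologicalSpace X] (S T : Set X) : Prop :=
  IsCompact (closure S) ∧ closure S ⊆ T

/-- The Hessian `D²f(x)` as a bilinear form. -/
def hess (f : Eu n → ℝ) (x : Eu n) : Bil n := fderiv ℝ (fderiv ℝ f) x

/-- The matrix of a bilinear form in the standard basis. -/
def toMat (b : Bil n) : Matrix (Fin n) (Fin n) ℝ :=
  Matrix.of fun i j => b (EuclideanSpace.single i 1) (EuclideanSpace.single j 1)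

/-- `f ∈ C^k(Ω̄)` for an open set `Ω`: `f ∈ C^k(Ω)` and every derivative of order at most `k`
has a continuous extension from `Ω` to the closure of `Ω`. -/
def IsCkClosure (k : ℕ) (f : Eu n → ℝ) (Ω : Set (Eu n)) : Prop :=
  ContDiffOn ℝ k f Ω ∧
    ∀ m ≤ k, ∃ F : Eu n → ContinuousMultilinearMap ℝ (fun _ : Fin m => Eu n) ℝ,
      ContinuousOn F (closure Ω) ∧ EqOn F (iteratedFDeriv ℝ m f) Ω

/-- The Hessian of `f ∈ C²(Ω̄)` on the closure of `Ω`, extended from `Ω` by continuity. -/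
def hessExt (Ω : Set (Eu n)) (f : Eu n → ℝ) : Eu n → Bil n := extendFrom Ω (hess f)

/-- The norm `|f|_{1;S} = sup_S |f| + sup_S |Df|`, with values in `[0, ∞]`. -/
def c1Norm (f : Eu n → ℝ) (S : Set (Eu n)) : ℝ≥0∞ :=
  (⨆ x ∈ S, ‖f x‖ₑ) + ⨆ x ∈ S, ‖∇ f x‖ₑ

/-- The distance `inf {|x - y| : x ∈ S, y ∈ ∂Ω}` of `S` from the boundary of `Ω`. -/
def bdryDist (S Ω : Set (Eu n)) : ℝ :=
  sInf ((fun x => Metric.infDist x (frontier Ω)) '' S)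

/-- The one-jet `J₁[u](x) = (x, u(x), Du(x))`. -/
def jet (u : Eu n → ℝ) (x : Eu n) : Eu n × ℝ × Eu n := (x, u x, ∇ u x)

/-- The map `(x, y, z) ↦ (x, g(x,y,z), g_x(x,y,z))`. -/
def jetMap (g : Eu n × Eu n × ℝ → ℝ) (q : Eu n × Eu n × ℝ) : Eu n × ℝ × Eu n :=
  (q.1, g q, ∇ (fun x => g (x, q.2.1, q.2.2)) q.1)

/-- The set `𝒰 = {(x, g(x,y,z), g_x(x,y,z)) : (x,y,z) ∈ Γ}`. -/
def jetDom (Γ : Set (Eu n × Eu n × ℝ)) (g : Eu n × Eu n × ℝ → ℝ) : Set (Eu n × ℝ × Eu n) :=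
  jetMap g '' Γ

/-- `g` is a generating function on `Γ`, with associated mappings `Y` and `Z` on `𝒰`. -/
structure IsGenerating (Γ : Set (Eu n × Eu n × ℝ)) (g : Eu n × Eu n × ℝ → ℝ)
    (Y : Eu n × ℝ × Eu n → Eu n) (Z : Eu n × ℝ × Eu n → ℝ) : Prop where
  dom : IsDom Γ
  /-- the fibres `I(x,y)` are (open) intervals -/
  fibre : ∀ x y : Eu n, OrdConnected {z : ℝ | (x, y, z) ∈ Γ}
  smooth : ContDiffOn ℝ 2 g Γ
  /-- `g_z < 0` -/
  neg : ∀ q ∈ Γ, deriv (fun t => g (q.1, q.2.1, t)) q.2.2 < 0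
  /-- `𝒰` is a domain; its connectedness follows from that of `Γ` -/
  jet_open : IsOpen (jetDom Γ g)
  smoothY : ContDiffOn ℝ 1 Y (jetDom Γ g)
  smoothZ : ContDiffOn ℝ 1 Z (jetDom Γ g)
  /-- `(x, Y, Z) ∈ Γ`, `g(x, Y, Z) = u` and `g_x(x, Y, Z) = p` at every `(x, u, p) ∈ 𝒰` -/
  solves : ∀ q ∈ jetDom Γ g, (q.1, Y q, Z q) ∈ Γ ∧ jetMap g (q.1, Y q, Z q) = q
  /-- the values `Y` and `Z` are uniquely determined by these equations -/
  unique : InjOn (jetMap g) Γ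

/-- The matrix function `A(x,u,p) = g_{xx}(x, Y(x,u,p), Z(x,u,p))`. -/
def genA (g : Eu n × Eu n × ℝ → ℝ) (Y : Eu n × ℝ × Eu n → Eu n) (Z : Eu n × ℝ × Eu n → ℝ)
    (q : Eu n × ℝ × Eu n) : Bil n :=
  hess (fun x => g (x, Y q, Z q)) q.1

/-- The standing assumptions on `A`, `B` and `𝒰`: smoothness, positivity of `B`, regularity
`(D_{p_k p_l} A_{ij}) ξ_i ξ_j η_k η_l ≥ 0` for `ξ · η = 0`, and convexity of `𝒰` in `p`. -/
structure IsRegularData (U : Set (Eu n × ℝ × Eu n)) (A : Eu n × ℝ × Eu n → Bil n)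
    (B : Eu n × ℝ × Eu n → ℝ) : Prop where
  smoothA : ContDiffOn ℝ 2 A U
  smoothB : ContDiffOn ℝ 2 B U
  posB : ∀ q ∈ U, 0 < B q
  regular : ∀ q ∈ U, ∀ ξ η : Eu n, inner ℝ ξ η = 0 →
    0 ≤ hess (fun p => A (q.1, q.2.1, p) ξ ξ) q.2.2 η η
  convex : ∀ (x : Eu n) (z : ℝ), Convex ℝ {p : Eu n | (x, z, p) ∈ U}

/-- The augmented Hessian `w = D²u - A(·,u,Du)`. -/
def augHess (A : Eu n × ℝ × Eu n → Bil n) (u : Eu n → ℝ) (x : Eu n) : Bil n :=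
  hess u x - A (jet u x)

/-- `u` is an elliptic solution of `det [D²u - A(·,u,Du)] = B(·,u,Du)` in `Ω`. -/
def IsEllipticSolution (A : Eu n × ℝ × Eu n → Bil n) (B : Eu n × ℝ × Eu n → ℝ)
    (Ω : Set (Eu n)) (u : Eu n → ℝ) : Prop :=
  ∀ x ∈ Ω, (∀ ξ : Eu n, ξ ≠ 0 → 0 < augHess A u x ξ ξ) ∧
    (toMat (augHess A u x)).det = B (jet u x)

/-- `φ` is a barrier showing that the open set `N` is `A`-bounded with respect to `u`:
`φ ∈ C²(N̄)` and `[D_{ij}φ - D_{p_k}A_{ij}(·,u,Du) D_kφ] ξ_i ξ_j ≥ |ξ|²` in `N`. -/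
def IsABarrier (A : Eu n × ℝ × Eu n → Bil n) (u : Eu n → ℝ) (N : Set (Eu n))
    (φ : Eu n → ℝ) : Prop :=
  IsCkClosure 2 φ N ∧
    ∀ x ∈ N, ∀ ξ : Eu n,
      ‖ξ‖ ^ 2 ≤ hess φ x ξ ξ - fderiv ℝ (fun p => A (x, u x, p) ξ ξ) (∇ u x) (∇ φ x)

/-- The section `{x ∈ Ω : (x, y₀, z₀ - h) ∈ Γ, u(x) < g(x, y₀, z₀ - h)}`. -/
def gSection (Γ : Set (Eu n × Eu n × ℝ)) (g : Eu n × Eu n × ℝ → ℝ) (Ω : Set (Eu n))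
    (u : Eu n → ℝ) (y₀ : Eu n) (z₀ h : ℝ) : Set (Eu n) :=
  {x | x ∈ Ω ∧ (x, y₀, z₀ - h) ∈ Γ ∧ u x < g (x, y₀, z₀ - h)}

/-- The component containing `x₀` of the section of height `h` over the `g`-affine function
supporting `u` at `x₀`, that is `y₀ = Y(x₀,u(x₀),Du(x₀))` and `z₀ = Z(x₀,u(x₀),Du(x₀))`. -/
def sectionAt (Γ : Set (Eu n × Eu n × ℝ)) (g : Eu n × Eu n × ℝ → ℝ)
    (Y : Eu n × ℝ × Eu n → Eu n) (Z : Eu n × ℝ × Eu n → ℝ) (Ω : Set (Eu n)) (u : Eu n → ℝ)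
    (x₀ : Eu n) (h : ℝ) : Set (Eu n) :=
  connectedComponentIn (gSection Γ g Ω u (Y (jet u x₀)) (Z (jet u x₀)) h) x₀

/-- The modulus of strict `g`-convexity `ω[u](x₀, R)`: the supremum of the heights `h > 0` such
that the sections at `x₀` exist and lie in `B_R(x₀)` up to the height `h`. Where the sections
increase with the height, it is enough to look at the height `h` itself. -/
def modulus (Γ : Set (Eu n × Eu n × ℝ)) (g : Eu n × Eu n × ℝ → ℝ)
    (Y : Eu n × ℝ × Eu n → Eu n) (Z : Eu n × ℝ × Eu n → ℝ) (Ω : Set (Eu n)) (u : Eu n → ℝ)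
    (x₀ : Eu n) (R : ℝ) : ℝ≥0∞ :=
  ⨆ h ∈ {h : ℝ | 0 < h ∧ (x₀, Y (jet u x₀), Z (jet u x₀) - h) ∈ Γ ∧
      ∀ h' ∈ Ioc 0 h, sectionAt Γ g Y Z Ω u x₀ h' ⊆ Metric.ball x₀ R},
    ENNReal.ofReal h

/-- The modulus of strict `g`-convexity of `u` over `Ω'`, as a function of the radius `R`. -/
def modulusOn (Γ : Set (Eu n × Eu n × ℝ)) (g : Eu n × Eu n × ℝ → ℝ)
    (Y : Eu n × ℝ × Eu n → Eu n) (Z : Eu n × ℝ × Eu n → ℝ) (Ω' Ω : Set (Eu n)) (u : Eu n → ℝ)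
    (R : ℝ) : ℝ≥0∞ :=
  ⨅ x₀ ∈ Ω', modulus Γ g Y Z Ω u x₀ R

end GJE

end

/-!
The estimate is a maximum principle for `w = D²u - A(·,u,Du)`, used twice. Write the equation as
`log det w = b(·,u,Du)` with `b = log B`, and let `linOp` be its linearization, of the form
`w^{ij} D_{ij}` plus drift. At a maximum point of `ψ + log w(ξ,ξ) + a |Du|²/2` over points and unit
vectors, `ξ` may be frozen as the top vector of an eigenbasis of `w`. Applying `linOp` there
(`EigenPoint.max_inequality`) brings in

* the equation differentiated twice, in `linOp_augHess`. The terms quadratic in `D²u` that come from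
  `D_{p_k p_l} A_{ii}` would be too large, but for directions `e_i` orthogonal to the top one their
  leading part is nonnegative by the regularity condition (`second_derivative_term`);
* the concavity of `log det`, whose quadratic third order terms dominate the squares of the logarithmic
  derivatives of `w(ξ,ξ)`, with something to spare (`third_order_terms`);
* a multiple of the trace of `w` from `|Du|²/2` (`linOp_half_sq_grad`), which absorbs the errors of
  the size of the largest eigenvalue.

What remains are errors of the size of the trace of `w⁻¹`, and a barrier in `ψ` absorbs these
(`linOp_barrier`).

In `Ω \ closure Ω'` the given barrier is available, and `exists_bound_of_barrier` bounds `w` by the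
values of `D²u` near the boundary of that set. At `∂Ω` these are the values in the conclusion; at the
boundary of `Ω'` they are controlled by an interior estimate at the points `x₀` of `Ω'`.

The interior estimate is Pogorelov's (`exists_bound_of_cutoff`), on the component of a section of
height `h` at `x₀`. The strict `g`-convexity modulus places such a section, with `h` bounded below,
in a ball so small that `|y - x₀|²` is a barrier with small gradient. The cut-off function is
`η = g(·, y₀, z₀ - h) - u`, positive in the section and zero on its boundary. As `g(·, y₀, z₀ - h)`
solves `D²f = A(·,f,Df)`, the regularity condition and Taylor's formula along segments in `p` bound
`linOp η` from below (`linOp_cutoff`); these segments stay in `𝒰` by its convexity in `p`, and in a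
compact part of it by `exists_uniform_support`. Since `g_z < 0`, `η(x₀)` is at least a multiple of
`h`, so a bound for `η^τ w` bounds `w` at `x₀` (`exists_interior_bound`).
-/


noncomputable section

namespace GJE

set_option maxSynthPendingDepth 3

variable {n : ℕ}

/-! ### Eigenbases and the logarithm of the determinant -/

/-- Jacobi's formula. -/
theorem hasDerivAt_det {m : ℝ → Matrix (Fin n) (Fin n) ℝ} {m' : Matrix (Fin n) (Fin n) ℝ} {t : ℝ}
    (h : ∀ i j, HasDerivAt (fun s => m s i j) (m' i j) t) :
    HasDerivAt (fun s => (m s).det) (∑ i, ∑ j, (m t).adjugate i j * m' j i) t := by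
  have h1 : HasDerivAt (fun s => (m s).det)
      (∑ σ : Equiv.Perm (Fin n), (Equiv.Perm.sign σ : ℝ) *
        ∑ i, (∏ j ∈ Finset.univ.erase i, m t (σ j) j) * m' (σ i) i) t := by
    simp only [Matrix.det_apply']
    refine HasDerivAt.fun_sum fun σ _ => HasDerivAt.const_mul _ ?_
    simpa [smul_eq_mul] using HasDerivAt.fun_finsetProd (u := Finset.univ)
      (f := fun i s => m s (σ i) i) (f' := fun i => m' (σ i) i) (x := t)
      (fun i _ => h (σ i) i)
  convert h1 using 1
  have h2 : ∀ i, ∑ j, (m t).adjugate i j * m' j i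
      = ((m t).updateCol i (fun j => m' j i)).det := by
    intro i
    rw [← Matrix.cramer_apply, Matrix.cramer_eq_adjugate_mulVec]
    rfl
  simp only [h2, Matrix.det_apply', Finset.mul_sum]
  rw [Finset.sum_comm]
  refine Finset.sum_congr rfl fun σ _ => Finset.sum_congr rfl fun i _ => ?_
  rw [← Finset.mul_prod_erase _ _ (Finset.mem_univ i), Matrix.updateCol_self, mul_comm (m' _ _)]
  congr 2
  refine Finset.prod_congr rfl fun j hj => ?_
  rw [Matrix.updateCol_ne (Finset.ne_of_mem_erase hj)]

theorem differentiableAt_det {m : ℝ → Matrix (Fin n) (Fin n) ℝ} {t : ℝ}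
    (h : ∀ i j, DifferentiableAt ℝ (fun s => m s i j) t) :
    DifferentiableAt ℝ (fun s => (m s).det) t :=
  (hasDerivAt_det (m' := Matrix.of fun i j => deriv (fun s => m s i j) t)
    fun i j => (h i j).hasDerivAt).differentiableAt

theorem differentiableAt_inv_entry {m : ℝ → Matrix (Fin n) (Fin n) ℝ} {t : ℝ}
    (h : ∀ i j, DifferentiableAt ℝ (fun s => m s i j) t) (hd : (m t).det ≠ 0) (i j : Fin n) :
    DifferentiableAt ℝ (fun s => (m s)⁻¹ i j) t := by
  simp only [Matrix.inv_def, Matrix.smul_apply, Ring.inverse_eq_inv', smul_eq_mul]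
  refine ((differentiableAt_det h).inv hd).mul ?_
  simp only [Matrix.adjugate_apply]
  refine differentiableAt_det fun k l => ?_
  by_cases hk : k = j
  · subst hk
    simp only [Matrix.updateRow_self]
    exact differentiableAt_const _
  · simp only [Matrix.updateRow_ne hk]
    exact h k l

/-- First derivative of `log det` along a curve of invertible matrices. -/
theorem hasDerivAt_log_det {m : ℝ → Matrix (Fin n) (Fin n) ℝ} {m' : Matrix (Fin n) (Fin n) ℝ}
    {t : ℝ} (h : ∀ i j, HasDerivAt (fun s => m s i j) (m' i j) t) (hd : (m t).det ≠ 0) :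
    HasDerivAt (fun s => Real.log (m s).det) (∑ i, ∑ j, (m t)⁻¹ i j * m' j i) t := by
  convert (hasDerivAt_det h).log hd using 1
  simp only [Matrix.inv_def, Matrix.smul_apply, Ring.inverse_eq_inv', smul_eq_mul]
  rw [Finset.sum_div]
  refine Finset.sum_congr rfl fun i _ => ?_
  rw [Finset.sum_div]
  refine Finset.sum_congr rfl fun j _ => ?_
  ring

theorem log_det_deriv_diagonal {m m' : ℝ → Matrix (Fin n) (Fin n) ℝ}
    {m'' : Matrix (Fin n) (Fin n) ℝ} {lam : Fin n → ℝ} (hlam : ∀ i, 0 < lam i)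
    (h0 : m 0 = Matrix.diagonal lam)
    (h1 : ∀ i j, ∀ᶠ t in 𝓝 0, HasDerivAt (fun s => m s i j) (m' t i j) t)
    (h2 : ∀ i j, HasDerivAt (fun s => m' s i j) (m'' i j) 0) :
    deriv (fun s => Real.log (m s).det) 0 = ∑ i, (lam i)⁻¹ * m' 0 i i ∧
    deriv (deriv fun s => Real.log (m s).det) 0 =
      ∑ i, (lam i)⁻¹ * m'' i i -
        ∑ i, ∑ j, m' 0 i j * m' 0 j i * ((lam i)⁻¹ * (lam j)⁻¹) := by
  have hd0 : (m 0).det ≠ 0 := by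
    rw [h0, Matrix.det_diagonal]
    exact Finset.prod_ne_zero_iff.2 fun i _ => (hlam i).ne'
  have hinv0 : (m 0)⁻¹ = Matrix.diagonal fun i => (lam i)⁻¹ := by
    apply Matrix.inv_eq_right_inv
    rw [h0, Matrix.diagonal_mul_diagonal, ← Matrix.diagonal_one]
    congr 1; funext i; exact mul_inv_cancel₀ (hlam i).ne'
  have h1' : ∀ᶠ t in 𝓝 (0 : ℝ), ∀ i j, HasDerivAt (fun s => m s i j) (m' t i j) t := by
    simpa [Filter.eventually_all] using h1
  have h10 := h1'.self_of_nhds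
  have hcont : ContinuousAt (fun s => (m s).det) 0 :=
    (differentiableAt_det fun i j => (h10 i j).differentiableAt).continuousAt
  have hd : ∀ᶠ t in 𝓝 (0 : ℝ), (m t).det ≠ 0 := hcont.eventually_ne hd0
  have hD : ∀ᶠ t in 𝓝 (0 : ℝ), deriv (fun s => Real.log (m s).det) t =
      ∑ i, ∑ j, (m t)⁻¹ i j * m' t j i := by
    filter_upwards [h1', hd] with t ht hdt using (hasDerivAt_log_det ht hdt).deriv
  have hsum : ∀ c : Matrix (Fin n) (Fin n) ℝ,
      ∑ i, ∑ j, (m 0)⁻¹ i j * c j i = ∑ i, (lam i)⁻¹ * c i i := by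
    intro c
    refine Finset.sum_congr rfl fun i _ => ?_
    rw [hinv0, Finset.sum_eq_single i]
    · simp
    · intro j _ hj
      simp [Matrix.diagonal_apply_ne _ hj.symm]
    · simp
  refine ⟨by rw [hD.self_of_nhds]; exact hsum (m' 0), ?_⟩
  rw [Filter.EventuallyEq.deriv_eq hD]
  -- differentiate `m⁻¹ * m = 1` to find the derivative of the inverse
  have hinv : ∀ i j, HasDerivAt (fun s => (m s)⁻¹ i j)
      (-((lam i)⁻¹ * (lam j)⁻¹ * m' 0 i j)) 0 := by
    intro i j
    have hdi : ∀ k, HasDerivAt (fun s => (m s)⁻¹ i k) (deriv (fun s => (m s)⁻¹ i k) 0) 0 := fun k =>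
      (differentiableAt_inv_entry (fun i j => (h10 i j).differentiableAt) hd0 i k).hasDerivAt
    have hs : HasDerivAt (fun s => ∑ k, (m s)⁻¹ i k * m s k j)
        (∑ k, (deriv (fun s => (m s)⁻¹ i k) 0 * m 0 k j + (m 0)⁻¹ i k * m' 0 k j)) 0 :=
      HasDerivAt.fun_sum fun k _ => (hdi k).mul (h10 k j)
    have hc : (fun s => ∑ k, (m s)⁻¹ i k * m s k j) =ᶠ[𝓝 0]
        fun _ => (1 : Matrix (Fin n) (Fin n) ℝ) i j := by
      filter_upwards [hd] with t ht
      rw [← Matrix.mul_apply, Matrix.nonsing_inv_mul _ (isUnit_iff_ne_zero.2 ht)]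
    have he := (hs.congr_of_eventuallyEq hc.symm).unique (hasDerivAt_const _ _)
    rw [Finset.sum_add_distrib] at he
    have e1 : ∑ k, deriv (fun s => (m s)⁻¹ i k) 0 * m 0 k j
        = deriv (fun s => (m s)⁻¹ i j) 0 * lam j := by
      rw [h0, Finset.sum_eq_single j]
      · simp
      · intro k _ hk; simp [Matrix.diagonal_apply_ne _ hk]
      · simp
    have e2 : ∑ k, (m 0)⁻¹ i k * m' 0 k j = (lam i)⁻¹ * m' 0 i j := by
      rw [hinv0, Finset.sum_eq_single i]
      · simp
      · intro k _ hk; simp [Matrix.diagonal_apply_ne _ hk.symm]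
      · simp
    rw [e1, e2] at he
    have hj := (hlam j).ne'
    have : deriv (fun s => (m s)⁻¹ i j) 0 = -((lam i)⁻¹ * (lam j)⁻¹ * m' 0 i j) := by
      have : deriv (fun s => (m s)⁻¹ i j) 0 * lam j * (lam j)⁻¹
          = -((lam i)⁻¹ * m' 0 i j) * (lam j)⁻¹ := by
        rw [eq_neg_of_add_eq_zero_left he]
      rw [mul_assoc, mul_inv_cancel₀ hj, mul_one] at this
      rw [this]; ring
    rw [← this]; exact hdi j
  have hs : HasDerivAt (fun t => ∑ i, ∑ j, (m t)⁻¹ i j * m' t j i)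
      (∑ i, ∑ j, (-((lam i)⁻¹ * (lam j)⁻¹ * m' 0 i j) * m' 0 j i + (m 0)⁻¹ i j * m'' j i)) 0 :=
    HasDerivAt.fun_sum fun i _ => HasDerivAt.fun_sum fun j _ => (hinv i j).mul (h2 j i)
  rw [hs.deriv]
  simp only [Finset.sum_add_distrib]
  rw [show (∑ i, ∑ j, (m 0)⁻¹ i j * m'' j i) = _ from hsum m'', add_comm, sub_eq_add_neg,
    ← Finset.sum_neg_distrib]
  congr 1
  refine Finset.sum_congr rfl fun i _ => ?_
  rw [← Finset.sum_neg_distrib]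
  refine Finset.sum_congr rfl fun j _ => ?_
  ring

/-- The operator `S` with `⟪S ξ, η⟫ = b ξ η`. -/
def formOp (b : Bil n) : Eu n →ₗ[ℝ] Eu n :=
  ((InnerProductSpace.toDual ℝ (Eu n)).symm.toLinearEquiv.toLinearMap).comp b.toLinearMap

theorem inner_formOp (b : Bil n) (ξ η : Eu n) : inner ℝ (formOp b ξ) η = b ξ η := by
  simp [formOp]

theorem det_orthonormalBasis (b : Bil n) (e : OrthonormalBasis (Fin n) ℝ (Eu n)) :
    (Matrix.of fun i j => b (e i) (e j)).det = LinearMap.det (formOp b) := by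
  rw [← LinearMap.det_toMatrix e.toBasis, ← Matrix.det_transpose]
  congr 1
  ext i j
  simp only [Matrix.of_apply, Matrix.transpose_apply, LinearMap.toMatrix_apply,
    OrthonormalBasis.coe_toBasis, OrthonormalBasis.coe_toBasis_repr_apply,
    OrthonormalBasis.repr_apply_apply]
  rw [real_inner_comm, inner_formOp]

theorem det_toMat (b : Bil n) (e : OrthonormalBasis (Fin n) ℝ (Eu n)) :
    (Matrix.of fun i j => b (e i) (e j)).det = (toMat b).det := by
  rw [det_orthonormalBasis, ← det_orthonormalBasis b (EuclideanSpace.basisFun (Fin n) ℝ)]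
  simp [toMat]

/-- A symmetric bilinear form is diagonal in some orthonormal basis. -/
theorem exists_eigenbasis (b : Bil n) (hb : ∀ ξ η, b ξ η = b η ξ) :
    ∃ (e : OrthonormalBasis (Fin n) ℝ (Eu n)) (lam : Fin n → ℝ),
      ∀ i ξ, b (e i) ξ = lam i * inner ℝ (e i) ξ := by
  have hS : (formOp b).IsSymmetric := by
    intro x y
    rw [inner_formOp, real_inner_comm, inner_formOp, hb]
  have hn : Module.finrank ℝ (Eu n) = n := by simp
  refine ⟨hS.eigenvectorBasis hn, hS.eigenvalues hn, fun i ξ => ?_⟩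
  rw [← inner_formOp, hS.apply_eigenvectorBasis hn i, inner_smul_left]
  simp

/-! ### Second derivatives -/

section Calculus

variable {E F V : Type*} [NormedAddCommGroup E] [NormedSpace ℝ E] [NormedAddCommGroup F]
  [NormedSpace ℝ F] [NormedAddCommGroup V] [NormedSpace ℝ V]

theorem contDiffAt_fderiv {f : E → V} {x : E} {k m : ℕ∞} (hf : ContDiffAt ℝ m f x)
    (h : k + 1 ≤ m) : ContDiffAt ℝ k (fderiv ℝ f) x :=
  hf.fderiv_right (by exact_mod_cast h)

theorem _root_.ContDiffAt.differentiableAt_fderiv {f : E → V} {x : E} (hf : ContDiffAt ℝ 2 f x) :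
    DifferentiableAt ℝ (fderiv ℝ f) x :=
  (hf.fderiv_right (m := 1) (by norm_num)).differentiableAt (by norm_num)

theorem _root_.ContDiffAt.eventually_differentiableAt {f : E → V} {x : E} {m : ℕ}
    (hf : ContDiffAt ℝ m f x) (hm : 1 ≤ m) : ∀ᶠ y in 𝓝 x, DifferentiableAt ℝ f y := by
  filter_upwards [hf.eventually (by simp)] with y hy
  exact hy.differentiableAt (by exact_mod_cast (by omega : m ≠ 0))

theorem hasFDerivAt_fderiv_apply {f : E → V} {x : E} (hf : ContDiffAt ℝ 2 f x) (e : E) :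
    HasFDerivAt (fun y => fderiv ℝ f y e) ((fderiv ℝ (fderiv ℝ f) x).flip e) x := by
  simpa using hf.differentiableAt_fderiv.hasFDerivAt.clm_apply (hasFDerivAt_const e x)

theorem fderiv_fderiv_apply {f : E → V} {x : E} (hf : ContDiffAt ℝ 2 f x) (d e : E) :
    fderiv ℝ (fun y => fderiv ℝ f y e) x d = fderiv ℝ (fderiv ℝ f) x d e := by
  rw [(hasFDerivAt_fderiv_apply hf e).fderiv]; rfl

theorem fderiv_fderiv_symm {f : E → V} {x : E} (hf : ContDiffAt ℝ 2 f x) (d e : E) :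
    fderiv ℝ (fderiv ℝ f) x d e = fderiv ℝ (fderiv ℝ f) x e d :=
  (hf.isSymmSndFDerivAt (by simp)).eq d e

/-- The derivatives of `f` along a line. -/
theorem line_derivatives {f : E → V} {x : E} (hf : ContDiffAt ℝ 2 f x) (e : E) :
    (∀ᶠ t in 𝓝 (0 : ℝ), HasDerivAt (fun s : ℝ => f (x + s • e)) (fderiv ℝ f (x + t • e) e) t) ∧
    HasDerivAt (fun s : ℝ => fderiv ℝ f (x + s • e) e) (fderiv ℝ (fderiv ℝ f) x e e) 0 := by
  have hl : ∀ t : ℝ, HasDerivAt (fun s : ℝ => x + s • e) e t := by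
    intro t
    simpa using ((hasDerivAt_id t).smul_const e).const_add x
  have hc : Filter.Tendsto (fun s : ℝ => x + s • e) (𝓝 0) (𝓝 x) := by
    simpa using (hl 0).continuousAt.tendsto
  constructor
  · filter_upwards [hc.eventually (hf.eventually_differentiableAt (by norm_num))] with t ht
    exact ht.hasFDerivAt.comp_hasDerivAt t (hl t)
  · have h := hasFDerivAt_fderiv_apply hf e
    have h0 : x = x + (0 : ℝ) • e := by simp
    rw [h0] at h
    have := h.comp_hasDerivAt (0 : ℝ) (hl 0)
    rw [← h0] at this
    exact this

/-- The second order chain rule. -/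
theorem fderiv_fderiv_comp {f : E → F} {p : F → V} {x : E} (hp : ContDiffAt ℝ 2 p (f x))
    (hf : ContDiffAt ℝ 2 f x) (d e : E) :
    fderiv ℝ (fderiv ℝ fun y => p (f y)) x d e =
      fderiv ℝ (fderiv ℝ p) (f x) (fderiv ℝ f x d) (fderiv ℝ f x e) +
        fderiv ℝ p (f x) (fderiv ℝ (fderiv ℝ f) x d e) := by
  have hev : (fderiv ℝ fun y => p (f y)) =ᶠ[𝓝 x]
      fun y => (fderiv ℝ p (f y)).comp (fderiv ℝ f y) := by
    filter_upwards [hf.continuousAt.eventually (hp.eventually_differentiableAt (by norm_num)),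
      hf.eventually_differentiableAt (by norm_num)] with y h1 h2
    exact fderiv_comp y h1 h2
  rw [hev.fderiv_eq]
  have h1 : HasFDerivAt (fun y => fderiv ℝ p (f y))
      ((fderiv ℝ (fderiv ℝ p) (f x)).comp (fderiv ℝ f x)) x :=
    hp.differentiableAt_fderiv.hasFDerivAt.comp x (hf.differentiableAt (by norm_num)).hasFDerivAt
  rw [(h1.clm_comp hf.differentiableAt_fderiv.hasFDerivAt).fderiv]
  simp [add_comm]

/-- Necessary conditions of first and second order at a local maximum. -/
theorem isLocalMax_fderiv {f : E → ℝ} {x : E} (hf : ContDiffAt ℝ 2 f x) (h : IsLocalMax f x) :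
    fderiv ℝ f x = 0 ∧ ∀ e, fderiv ℝ (fderiv ℝ f) x e e ≤ 0 := by
  refine ⟨h.fderiv_eq_zero, fun e => ?_⟩
  by_contra! hpos
  obtain ⟨h1, h2⟩ := line_derivatives hf e
  set p : ℝ → ℝ := fun s => f (x + s • e) with hp
  have hd : deriv p =ᶠ[𝓝 0] fun s => fderiv ℝ f (x + s • e) e := by
    filter_upwards [h1] with t ht using ht.deriv
  have hdd : deriv (deriv p) 0 = fderiv ℝ (fderiv ℝ f) x e e := by
    rw [hd.deriv_eq, h2.deriv]
  have hc : Filter.Tendsto (fun s : ℝ => x + s • e) (𝓝 0) (𝓝 x) := by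
    have : Continuous fun s : ℝ => x + s • e := by fun_prop
    simpa using this.tendsto 0
  have hmax : ∀ᶠ t in 𝓝 (0 : ℝ), p t ≤ p 0 := by
    simpa [hp] using hc.eventually h
  have hmin : ∀ᶠ t in 𝓝 (0 : ℝ), p 0 ≤ p t := by
    refine isLocalMin_of_deriv_deriv_pos (by rw [hdd]; exact hpos) ?_ h1.self_of_nhds.continuousAt
    rw [hd.self_of_nhds]
    simp [h.fderiv_eq_zero]
  have hconst : p =ᶠ[𝓝 0] fun _ => p 0 := by
    filter_upwards [hmax, hmin] with t h1 h2 using le_antisymm h1 h2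
  have : deriv (deriv p) 0 = 0 := by
    rw [hconst.deriv.deriv_eq]; simp
  linarith

theorem fderiv_log {f : E → ℝ} {x : E} (hf : ContDiffAt ℝ 2 f x) (hx : f x ≠ 0) (d : E) :
    fderiv ℝ (fun y => Real.log (f y)) x d = fderiv ℝ f x d / f x ∧
    fderiv ℝ (fderiv ℝ fun y => Real.log (f y)) x d d =
      fderiv ℝ (fderiv ℝ f) x d d / f x - (fderiv ℝ f x d / f x) ^ 2 := by
  have hf1 := hf.differentiableAt (by norm_num)
  constructor
  · rw [fderiv.log hf1 hx]; simp; ring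
  · have hlog : ContDiffAt ℝ 2 Real.log (f x) := Real.contDiffAt_log.2 hx
    rw [fderiv_fderiv_comp hlog hf]
    have e1 : fderiv ℝ Real.log (f x) = (f x)⁻¹ • ContinuousLinearMap.id ℝ ℝ := by
      ext; simp
    have e2 : fderiv ℝ (fderiv ℝ Real.log) (f x) (fderiv ℝ f x d) (fderiv ℝ f x d) =
        - (fderiv ℝ f x d / f x) ^ 2 := by
      rw [← fderiv_fderiv_apply hlog]
      have : (fun y => fderiv ℝ Real.log y (fderiv ℝ f x d)) = fun y => fderiv ℝ f x d * y⁻¹ := by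
        funext y; simp [mul_comm]
      rw [this, fderiv_const_mul (differentiableAt_inv hx)]
      simp
      field_simp
    rw [e2, e1]
    simp
    ring

end Calculus

/-! ### Jets of a function -/

/-- The inverse of the Riesz isomorphism, as a linear map over `ℝ`. -/
def sharp : (Eu n →L[ℝ] ℝ) →L[ℝ] Eu n :=
  (InnerProductSpace.toDual ℝ (Eu n)).symm.toContinuousLinearEquiv.toContinuousLinearMap

theorem inner_sharp (l : Eu n →L[ℝ] ℝ) (v : Eu n) : inner ℝ (sharp l) v = l v :=
  InnerProductSpace.toDual_symm_apply

theorem gradient_eq_sharp (u : Eu n → ℝ) (x : Eu n) : ∇ u x = sharp (fderiv ℝ u x) := rfl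

theorem inner_grad (u : Eu n → ℝ) (x v : Eu n) : inner ℝ (∇ u x) v = fderiv ℝ u x v :=
  inner_sharp _ _

theorem hess_symm {u : Eu n → ℝ} {x : Eu n} (hu : ContDiffAt ℝ 2 u x) (d e : Eu n) :
    hess u x d e = hess u x e d := fderiv_fderiv_symm hu d e

theorem contDiffAt_jet {u : Eu n → ℝ} {x : Eu n} {k m : ℕ∞} (hu : ContDiffAt ℝ m u x)
    (h : k + 1 ≤ m) : ContDiffAt ℝ k (jet u) x := by
  refine contDiffAt_id.prodMk ((hu.of_le ?_).prodMk ?_)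
  · exact_mod_cast le_trans le_self_add h
  · exact sharp.contDiff.contDiffAt.comp x (contDiffAt_fderiv hu h)

theorem hasFDerivAt_jet {u : Eu n → ℝ} {x : Eu n} (hu : ContDiffAt ℝ 2 u x) :
    HasFDerivAt (jet u) ((ContinuousLinearMap.id ℝ (Eu n)).prod
      ((fderiv ℝ u x).prod (sharp.comp (fderiv ℝ (fderiv ℝ u) x)))) x :=
  (hasFDerivAt_id x).prodMk ((hu.differentiableAt (by norm_num)).hasFDerivAt.prodMk
    (sharp.hasFDerivAt.comp x hu.differentiableAt_fderiv.hasFDerivAt))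

theorem fderiv_jet {u : Eu n → ℝ} {x : Eu n} (hu : ContDiffAt ℝ 2 u x) (d : Eu n) :
    fderiv ℝ (jet u) x d = (d, fderiv ℝ u x d, sharp (hess u x d)) := by
  rw [(hasFDerivAt_jet hu).fderiv]; rfl

theorem fderiv_fderiv_jet {u : Eu n → ℝ} {x : Eu n} (hu : ContDiffAt ℝ 3 u x) (d : Eu n) :
    fderiv ℝ (fderiv ℝ (jet u)) x d d =
      (0, hess u x d d, sharp (fderiv ℝ (hess u) x d d)) := by
  have hu2 : ContDiffAt ℝ 2 u x := hu.of_le (by norm_num)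
  rw [← fderiv_fderiv_apply (contDiffAt_jet (k := 2) (m := 3) hu (by norm_num))]
  have hev : (fun y => fderiv ℝ (jet u) y d) =ᶠ[𝓝 x]
      fun y => (d, fderiv ℝ u y d, sharp (hess u y d)) := by
    filter_upwards [hu2.eventually (by simp)] with y hy using fderiv_jet hy d
  have hH : ContDiffAt ℝ 1 (hess u) x :=
    contDiffAt_fderiv (k := 1) (m := 2) (contDiffAt_fderiv (k := 2) (m := 3) hu (by norm_num))
      (by norm_num)
  have h3 : HasFDerivAt (fun y => sharp (hess u y d))
      (sharp.comp ((fderiv ℝ (hess u) x).flip d)) x := by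
    have := (hH.differentiableAt (by norm_num)).hasFDerivAt.clm_apply (hasFDerivAt_const d x)
    rw [ContinuousLinearMap.comp_zero, zero_add] at this
    exact sharp.hasFDerivAt.comp x this
  rw [hev.fderiv_eq, ((hasFDerivAt_const d x).prodMk
    ((hasFDerivAt_fderiv_apply hu2 d).prodMk h3)).fderiv]
  rfl

theorem contDiffAt_hess {u : Eu n → ℝ} {x : Eu n} (hu : ContDiffAt ℝ 4 u x) :
    ContDiffAt ℝ 2 (hess u) x :=
  contDiffAt_fderiv (k := 2) (m := 3) (contDiffAt_fderiv (k := 3) (m := 4) hu (by norm_num))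
      (by norm_num)

theorem fderiv_hess_swap₁₂ {u : Eu n → ℝ} {x : Eu n} (hu : ContDiffAt ℝ 3 u x) (c d : Eu n) :
    fderiv ℝ (hess u) x c d = fderiv ℝ (hess u) x d c :=
  fderiv_fderiv_symm (contDiffAt_fderiv (k := 2) (m := 3) hu (by norm_num)) c d

theorem fderiv_bil_apply {H : Eu n → Bil n} {x : Eu n} (hH : DifferentiableAt ℝ H x)
    (c d e : Eu n) : fderiv ℝ (fun y => H y d e) x c = fderiv ℝ H x c d e := by
  have := ((hH.hasFDerivAt.clm_apply (hasFDerivAt_const d x)).clm_apply (hasFDerivAt_const e x))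
  rw [this.fderiv]; simp

theorem fderiv_fderiv_bil_apply {H : Eu n → Bil n} {x : Eu n} (hH : ContDiffAt ℝ 2 H x)
    (b c d e : Eu n) :
    fderiv ℝ (fderiv ℝ fun y => H y d e) x b c = fderiv ℝ (fderiv ℝ H) x b c d e := by
  have hc : ContDiffAt ℝ 2 (fun y => H y d e) x :=
    (hH.clm_apply contDiffAt_const).clm_apply contDiffAt_const
  rw [← fderiv_fderiv_apply hc]
  have hev : (fun y => fderiv ℝ (fun y => H y d e) y c) =ᶠ[𝓝 x] fun y => fderiv ℝ H y c d e := by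
    filter_upwards [hH.eventually_differentiableAt (by norm_num)] with y hy
    exact fderiv_bil_apply hy c d e
  rw [hev.fderiv_eq]
  have := (((hH.differentiableAt_fderiv.hasFDerivAt.clm_apply (hasFDerivAt_const c x)).clm_apply
    (hasFDerivAt_const d x)).clm_apply (hasFDerivAt_const e x))
  rw [this.fderiv]; simp

theorem fderiv_hess_swap₂₃ {u : Eu n → ℝ} {x : Eu n} (hu : ContDiffAt ℝ 3 u x) (c d e : Eu n) :
    fderiv ℝ (hess u) x c d e = fderiv ℝ (hess u) x c e d := by
  have hH : DifferentiableAt ℝ (hess u) x :=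
    (contDiffAt_fderiv (k := 2) (m := 3) hu (by norm_num)).differentiableAt_fderiv
  rw [← fderiv_bil_apply hH, ← fderiv_bil_apply hH]
  have hev : (fun y => hess u y d e) =ᶠ[𝓝 x] fun y => hess u y e d := by
    filter_upwards [hu.eventually (by simp)] with y hy using hess_symm (hy.of_le (by norm_num)) d e
  rw [hev.fderiv_eq]

/-- Fourth derivatives commute. -/
theorem fderiv_fderiv_hess_comm {u : Eu n → ℝ} {x : Eu n} (hu : ContDiffAt ℝ 4 u x)
    (c d : Eu n) :
    fderiv ℝ (fderiv ℝ (hess u)) x c c d d = fderiv ℝ (fderiv ℝ (hess u)) x d d c c := by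
  have hH := contDiffAt_hess hu
  have hev3 : ∀ᶠ y in 𝓝 x, ContDiffAt ℝ 4 u y := hu.eventually (by simp)
  have s12 : ∀ a b, fderiv ℝ (fderiv ℝ (hess u)) x a b = fderiv ℝ (fderiv ℝ (hess u)) x b a :=
    fun a b => fderiv_fderiv_symm hH a b
  have key : ∀ a b, HasFDerivAt (fun y => fderiv ℝ (hess u) y a b)
      ((((fderiv ℝ (fderiv ℝ (hess u)) x).flip a)).flip b) x := by
    intro a b
    simpa using (hasFDerivAt_fderiv_apply hH a).clm_apply (hasFDerivAt_const b x)
  have s23 : ∀ a b e, fderiv ℝ (fderiv ℝ (hess u)) x a b e =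
      fderiv ℝ (fderiv ℝ (hess u)) x a e b := by
    intro a b e
    have hev : (fun y => fderiv ℝ (hess u) y b e) =ᶠ[𝓝 x] fun y => fderiv ℝ (hess u) y e b := by
      filter_upwards [hev3] with y hy using fderiv_hess_swap₁₂ (hy.of_le (by norm_num)) b e
    have := (key b e).fderiv.symm.trans (hev.fderiv_eq.trans (key e b).fderiv)
    exact DFunLike.congr_fun this a
  have s34 : ∀ a b e f, fderiv ℝ (fderiv ℝ (hess u)) x a b e f =
      fderiv ℝ (fderiv ℝ (hess u)) x a b f e := by
    intro a b e f
    have hk : ∀ e f, fderiv ℝ (fun y => fderiv ℝ (hess u) y b e f) x a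
        = fderiv ℝ (fderiv ℝ (hess u)) x a b e f := by
      intro e f
      rw [((key b e).clm_apply (hasFDerivAt_const f x)).fderiv]; simp
    have hev : (fun y => fderiv ℝ (hess u) y b e f) =ᶠ[𝓝 x]
        fun y => fderiv ℝ (hess u) y b f e := by
      filter_upwards [hev3] with y hy using fderiv_hess_swap₂₃ (hy.of_le (by norm_num)) b e f
    rw [← hk, ← hk, hev.fderiv_eq]
  rw [s23, s12, s34, s23]

/-- The derivatives of `|Du|² / 2`. -/
theorem fderiv_half_sq_grad {u : Eu n → ℝ} {x : Eu n} (hu : ContDiffAt ℝ 3 u x) (d : Eu n) :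
    ContDiffAt ℝ 2 (fun y => ‖∇ u y‖ ^ 2 / 2) x ∧
    fderiv ℝ (fun y => ‖∇ u y‖ ^ 2 / 2) x d = hess u x d (∇ u x) ∧
    hess (fun y => ‖∇ u y‖ ^ 2 / 2) x d d =
      ‖sharp (hess u x d)‖ ^ 2 + fderiv ℝ (hess u) x d d (∇ u x) := by
  have hG : ContDiffAt ℝ 2 (fun y => ∇ u y) x :=
    sharp.contDiff.contDiffAt.comp x (contDiffAt_fderiv (k := 2) (m := 3) hu (by norm_num))
  have hu2 : ContDiffAt ℝ 2 u x := hu.of_le (by norm_num)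
  have h2 : ContDiffAt ℝ 2 (fun y => ‖∇ u y‖ ^ 2 / 2) x := (hG.norm_sq ℝ).div_const 2
  have hd1 : ∀ {y : Eu n}, ContDiffAt ℝ 2 u y →
      HasFDerivAt (fun y => ∇ u y) (sharp.comp (hess u y)) y := fun hy =>
    sharp.hasFDerivAt.comp _ hy.differentiableAt_fderiv.hasFDerivAt
  have hd : ∀ {y : Eu n}, ContDiffAt ℝ 2 u y →
      fderiv ℝ (fun y => ‖∇ u y‖ ^ 2 / 2) y d = hess u y d (∇ u y) := by
    intro y hy
    have h := ((hd1 hy).norm_sq).mul_const (2⁻¹ : ℝ)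
    simp only [← div_eq_mul_inv] at h
    rw [h.fderiv]
    simp only [smul_apply, ContinuousLinearMap.comp_apply,
      innerSL_apply_apply, smul_eq_mul, nsmul_eq_mul]
    rw [real_inner_comm, inner_sharp]
    norm_num
    ring
  refine ⟨h2, hd hu2, ?_⟩
  unfold hess at *
  rw [← fderiv_fderiv_apply h2]
  have hev : (fun y => fderiv ℝ (fun y => ‖∇ u y‖ ^ 2 / 2) y d) =ᶠ[𝓝 x]
      fun y => hess u y d (∇ u y) := by
    filter_upwards [hu2.eventually (by simp)] with y hy using hd hy
  have hH : DifferentiableAt ℝ (hess u) x :=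
    (contDiffAt_fderiv (k := 2) (m := 3) hu (by norm_num)).differentiableAt_fderiv
  have := (hH.hasFDerivAt.clm_apply (hasFDerivAt_const d x)).clm_apply (hd1 hu2)
  rw [hev.fderiv_eq, this.fderiv]
  have e : ‖sharp (fderiv ℝ (fderiv ℝ u) x d)‖ ^ 2 =
      fderiv ℝ (fderiv ℝ u) x d (sharp (fderiv ℝ (fderiv ℝ u) x d)) := by
    rw [← inner_sharp, real_inner_self_eq_norm_sq]
  simp [e, hess]
  rfl

/-! ### The differentiated equation at a point -/

/-- Bounds by `M` for the coefficients `A` and `b`, with two derivatives, at a jet `q`. -/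
structure CoeffBound (A : Eu n × ℝ × Eu n → Bil n) (b : Eu n × ℝ × Eu n → ℝ) (M : ℝ)
    (q : Eu n × ℝ × Eu n) : Prop where
  val : |q.2.1| ≤ M
  grad : ‖q.2.2‖ ≤ M
  A0 : ‖A q‖ ≤ M
  A1 : ‖fderiv ℝ A q‖ ≤ M
  A2 : ‖fderiv ℝ (fderiv ℝ A) q‖ ≤ M
  b1 : ‖fderiv ℝ b q‖ ≤ M
  b2 : ‖fderiv ℝ (fderiv ℝ b) q‖ ≤ M

/-- The situation at a point `x` where `u` solves `log det [D²u - A(·,u,Du)] = b(·,u,Du)`: `e` is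
an eigenbasis of the augmented Hessian, `lam` are its eigenvalues, and `lam o` is the largest. -/
structure EigenPoint (A : Eu n × ℝ × Eu n → Bil n) (b : Eu n × ℝ × Eu n → ℝ) (u : Eu n → ℝ)
    (M : ℝ) (x : Eu n) (e : OrthonormalBasis (Fin n) ℝ (Eu n)) (lam : Fin n → ℝ) (o : Fin n) :
    Prop where
  u4 : ContDiffAt ℝ 4 u x
  A2 : ContDiffAt ℝ 2 A (jet u x)
  b2 : ContDiffAt ℝ 2 b (jet u x)
  symm : ∀ᶠ q in 𝓝 (jet u x), ∀ ξ η, A q ξ η = A q η ξ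
  eqn : ∀ᶠ y in 𝓝 x, Real.log (toMat (augHess A u y)).det = b (jet u y)
  diag : ∀ i ξ, augHess A u x (e i) ξ = lam i * inner ℝ (e i) ξ
  pos : ∀ i, 0 < lam i
  top : ∀ i, lam i ≤ lam o
  one_le : 1 ≤ lam o
  regular : ∀ ξ η : Eu n, inner ℝ ξ η = 0 →
    0 ≤ fderiv ℝ (fderiv ℝ A) (jet u x) (0, 0, η) (0, 0, η) ξ ξ
  one_le_M : 1 ≤ M
  bound : CoeffBound A b M (jet u x)

/-- The first order part of the linearized operator. -/
def driftForm (A : Eu n × ℝ × Eu n → Bil n) (b : Eu n × ℝ × Eu n → ℝ) (q : Eu n × ℝ × Eu n)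
    (e : OrthonormalBasis (Fin n) ℝ (Eu n)) (lam : Fin n → ℝ) (v : Eu n) : ℝ :=
  ∑ i, (lam i)⁻¹ * fderiv ℝ A q (0, 0, v) (e i) (e i) + fderiv ℝ b q (0, 0, v)

/-- The linearized operator
`w^{ij} (D_{ij} f - D_{p_k}A_{ij} D_k f) - D_{p_k}b D_k f`, in an eigenbasis of `w`. -/
def linOp (A : Eu n × ℝ × Eu n → Bil n) (b : Eu n × ℝ × Eu n → ℝ) (u : Eu n → ℝ) (x : Eu n)
    (e : OrthonormalBasis (Fin n) ℝ (Eu n)) (lam : Fin n → ℝ) (f : Eu n → ℝ) : ℝ :=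
  ∑ i, (lam i)⁻¹ * hess f x (e i) (e i) - driftForm A b (jet u x) e lam (∇ f x)

theorem norm_sharp (l : Eu n →L[ℝ] ℝ) : ‖sharp l‖ = ‖l‖ :=
  (InnerProductSpace.toDual ℝ (Eu n)).symm.norm_map l

theorem abs_bil_le (c : Bil n) (ξ η : Eu n) (hξ : ‖ξ‖ = 1) (hη : ‖η‖ = 1) : |c ξ η| ≤ ‖c‖ := by
  simpa [hξ, hη] using c.le_opNorm₂ ξ η

theorem map_smul_sum_sharp (c : Fin n → ℝ) (l : Fin n → Eu n →L[ℝ] ℝ) :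
    sharp (∑ i, c i • l i) = ∑ i, c i • sharp (l i) := by
  simp only [map_sum, map_smul]

theorem norm_zero_zero (v : Eu n) : ‖((0, 0, v) : Eu n × ℝ × Eu n)‖ = ‖v‖ := by
  simp [Prod.norm_def]

theorem norm_zero_mid (t : ℝ) : ‖((0, t, 0) : Eu n × ℝ × Eu n)‖ = |t| := by
  simp [Prod.norm_def]

theorem sharp_sub_grad_split (t : ℝ) (v : Eu n) :
    ((0, t, v) : Eu n × ℝ × Eu n) = (0, t, 0) + (0, 0, v) := by simp

namespace CoeffBound

variable {A : Eu n × ℝ × Eu n → Bil n} {b : Eu n × ℝ × Eu n → ℝ} {M : ℝ} {q : Eu n × ℝ × Eu n}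

theorem abs_A1 (h : CoeffBound A b M q) (v : Eu n × ℝ × Eu n) {ξ η : Eu n}
    (hξ : ‖ξ‖ = 1) (hη : ‖η‖ = 1) : |fderiv ℝ A q v ξ η| ≤ M * ‖v‖ :=
  (abs_bil_le _ _ _ hξ hη).trans (((fderiv ℝ A q).le_opNorm v).trans
    (mul_le_mul_of_nonneg_right h.A1 (norm_nonneg _)))

theorem abs_A2 (h : CoeffBound A b M q) (v v' : Eu n × ℝ × Eu n) {ξ η : Eu n}
    (hξ : ‖ξ‖ = 1) (hη : ‖η‖ = 1) :
    |fderiv ℝ (fderiv ℝ A) q v v' ξ η| ≤ M * ‖v‖ * ‖v'‖ := by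
  refine (abs_bil_le _ _ _ hξ hη).trans (((fderiv ℝ (fderiv ℝ A) q v).le_opNorm v').trans
    (mul_le_mul_of_nonneg_right ?_ (norm_nonneg _)))
  exact ((fderiv ℝ (fderiv ℝ A) q).le_opNorm v).trans
    (mul_le_mul_of_nonneg_right h.A2 (norm_nonneg _))

theorem abs_b1 (h : CoeffBound A b M q) (v : Eu n × ℝ × Eu n) :
    |fderiv ℝ b q v| ≤ M * ‖v‖ :=
  ((fderiv ℝ b q).le_opNorm v).trans (mul_le_mul_of_nonneg_right h.b1 (norm_nonneg _))

theorem abs_b2 (h : CoeffBound A b M q) (v v' : Eu n × ℝ × Eu n) :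
    |fderiv ℝ (fderiv ℝ b) q v v'| ≤ M * ‖v‖ * ‖v'‖ :=
  ((fderiv ℝ (fderiv ℝ b) q v).le_opNorm v').trans (mul_le_mul_of_nonneg_right
    (((fderiv ℝ (fderiv ℝ b) q).le_opNorm v).trans
      (mul_le_mul_of_nonneg_right h.b2 (norm_nonneg _))) (norm_nonneg _))

end CoeffBound

namespace EigenPoint

variable {A : Eu n × ℝ × Eu n → Bil n} {b : Eu n × ℝ × Eu n → ℝ} {u : Eu n → ℝ} {M : ℝ} {x : Eu n}
  {e : OrthonormalBasis (Fin n) ℝ (Eu n)} {lam : Fin n → ℝ} {o : Fin n}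

theorem norm_augHess_eigen (h : EigenPoint A b u M x e lam o) (i : Fin n) :
    ‖augHess A u x (e i)‖ ≤ lam i := by
  refine ContinuousLinearMap.opNorm_le_bound _ (h.pos i).le fun ξ => ?_
  rw [h.diag, norm_mul, Real.norm_of_nonneg (h.pos i).le]
  refine mul_le_mul_of_nonneg_left ?_ (h.pos i).le
  simpa using norm_inner_le_norm (𝕜 := ℝ) (e i) ξ

theorem norm_augHess (h : EigenPoint A b u M x e lam o) (d : Eu n) :
    ‖augHess A u x d‖ ≤ lam o * ‖d‖ := by
  have ho := (h.pos o).le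
  refine ContinuousLinearMap.opNorm_le_bound _ (mul_nonneg ho (norm_nonneg _)) fun ξ => ?_
  have h1 : augHess A u x d ξ = ∑ i, inner ℝ (e i) d * (lam i * inner ℝ (e i) ξ) := by
    conv_lhs => rw [← e.sum_repr' d]
    simp only [map_sum, map_smul, sum_apply, smul_apply,
      smul_eq_mul, h.diag]
  have h2 : |∑ i, inner ℝ (e i) d * (lam i * inner ℝ (e i) ξ)| ≤
      lam o * ∑ i, |inner ℝ (e i) d| * |inner ℝ (e i) ξ| := by
    rw [Finset.mul_sum]
    refine (Finset.abs_sum_le_sum_abs _ _).trans (Finset.sum_le_sum fun i _ => ?_)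
    rw [abs_mul, abs_mul, abs_of_pos (h.pos i)]
    have := mul_le_mul_of_nonneg_right (h.top i)
      (mul_nonneg (abs_nonneg (inner ℝ (e i) d)) (abs_nonneg (inner ℝ (e i) ξ)))
    linarith
  have h3 : ∑ i, |inner ℝ (e i) d| * |inner ℝ (e i) ξ| ≤ ‖d‖ * ‖ξ‖ := by
    refine abs_le_of_sq_le_sq' ?_ (by positivity) |>.2
    refine (Finset.sum_mul_sq_le_sq_mul_sq _ _ _).trans (le_of_eq ?_)
    have := e.sum_sq_norm_inner_right d
    have := e.sum_sq_norm_inner_right ξ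
    simp only [Real.norm_eq_abs] at *
    simp only [*, mul_pow]
  rw [h1, Real.norm_eq_abs, mul_assoc]
  exact h2.trans (mul_le_mul_of_nonneg_left h3 ho)

theorem hess_eq (A : Eu n × ℝ × Eu n → Bil n) (u : Eu n → ℝ) (x : Eu n) :
    hess u x = augHess A u x + A (jet u x) := by simp [augHess]

theorem norm_fderiv_jet (h : EigenPoint A b u M x e lam o) {d : Eu n} {L : ℝ} (hL : 0 ≤ L)
    (hd : ‖d‖ ≤ 1) (hw : ‖augHess A u x d‖ ≤ L) : ‖fderiv ℝ (jet u) x d‖ ≤ 2 * M + L := by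
  have hM := h.one_le_M
  rw [fderiv_jet (h.u4.of_le (by norm_num)), Prod.norm_def, Prod.norm_def]
  refine max_le (by simp only; linarith) (max_le ?_ ?_)
  · have : |fderiv ℝ u x d| ≤ M * 1 := by
      rw [← inner_grad]
      refine (abs_real_inner_le_norm _ _).trans ?_
      exact mul_le_mul h.bound.grad hd (norm_nonneg _) (by linarith)
    simp only [Real.norm_eq_abs]
    linarith
  · simp only [norm_sharp]
    rw [hess_eq A]
    have h1 : ‖(augHess A u x + A (jet u x)) d‖ ≤ L + M * 1 := by
      refine (norm_add_le _ _).trans (add_le_add hw ?_)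
      refine ((A (jet u x)).le_opNorm d).trans ?_
      exact mul_le_mul h.bound.A0 hd (norm_nonneg _) (by linarith)
    linarith

theorem norm_fderiv_jet_le (h : EigenPoint A b u M x e lam o) (d : Eu n) :
    ‖fderiv ℝ (jet u) x d‖ ≤ 3 * M * lam o * ‖d‖ := by
  have hM := h.one_le_M
  have hl := h.one_le
  rcases eq_or_ne d 0 with rfl | hd
  · simp
  have hd' : 0 < ‖d‖ := norm_pos_iff.2 hd
  have h1 : ‖(‖d‖⁻¹ • d)‖ = 1 := by
    rw [norm_smul, norm_inv, norm_norm, inv_mul_cancel₀ hd'.ne']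
  have h2 := h.norm_fderiv_jet (L := lam o) (by linarith) h1.le
    ((h.norm_augHess _).trans (by rw [h1, mul_one]))
  rw [map_smul, norm_smul, norm_inv, norm_norm, inv_mul_le_iff₀ hd'] at h2
  have : 2 * M + lam o ≤ 3 * M * lam o := by nlinarith
  nlinarith

theorem contDiffAt_comp_jet (h : EigenPoint A b u M x e lam o) :
    ContDiffAt ℝ 2 (fun y => A (jet u y)) x :=
  h.A2.comp x ((contDiffAt_jet (k := 3) (m := 4) h.u4 (by norm_num)).of_le (by norm_num))

theorem contDiffAt_augHess (h : EigenPoint A b u M x e lam o) : ContDiffAt ℝ 2 (augHess A u) x :=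
  (contDiffAt_hess h.u4).sub h.contDiffAt_comp_jet

theorem jet2 (h : EigenPoint A b u M x e lam o) : ContDiffAt ℝ 2 (jet u) x :=
  (contDiffAt_jet (k := 3) (m := 4) h.u4 (by norm_num)).of_le (by norm_num)

theorem fderiv_augHess (h : EigenPoint A b u M x e lam o) (d : Eu n) :
    fderiv ℝ (augHess A u) x d =
      fderiv ℝ (hess u) x d - fderiv ℝ A (jet u x) (fderiv ℝ (jet u) x d) := by
  have h1 : augHess A u = fun y => hess u y - A (jet u y) := rfl
  have h2 : fderiv ℝ (fun y => A (jet u y)) x = (fderiv ℝ A (jet u x)).comp (fderiv ℝ (jet u) x) :=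
    fderiv_comp x (h.A2.differentiableAt (by norm_num)) (h.jet2.differentiableAt (by norm_num))
  rw [h1, fderiv_fun_sub ((contDiffAt_hess h.u4).differentiableAt (by norm_num))
    (h.contDiffAt_comp_jet.differentiableAt (by norm_num)), h2]
  rfl

theorem fderiv_fderiv_augHess (h : EigenPoint A b u M x e lam o) (d : Eu n) :
    fderiv ℝ (fderiv ℝ (augHess A u)) x d d =
      fderiv ℝ (fderiv ℝ (hess u)) x d d -
        (fderiv ℝ (fderiv ℝ A) (jet u x) (fderiv ℝ (jet u) x d) (fderiv ℝ (jet u) x d) +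
          fderiv ℝ A (jet u x) (0, hess u x d d, sharp (fderiv ℝ (hess u) x d d))) := by
  have h1 : augHess A u = fun y => hess u y - A (jet u y) := rfl
  have hH := contDiffAt_hess h.u4
  have hA := h.contDiffAt_comp_jet
  have hev : fderiv ℝ (augHess A u) =ᶠ[𝓝 x]
      fun y => fderiv ℝ (hess u) y - fderiv ℝ (fun z => A (jet u z)) y := by
    filter_upwards [hH.eventually_differentiableAt (by norm_num),
      hA.eventually_differentiableAt (by norm_num)] with y h2 h3
    rw [h1, fderiv_fun_sub h2 h3]
  rw [hev.fderiv_eq, fderiv_fun_sub hH.differentiableAt_fderiv hA.differentiableAt_fderiv,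
    ← fderiv_fderiv_jet (h.u4.of_le (by norm_num)), ← fderiv_fderiv_comp h.A2 h.jet2]
  rfl

theorem augHess_symm (h : EigenPoint A b u M x e lam o) (ξ η : Eu n) :
    ∀ᶠ y in 𝓝 x, augHess A u y ξ η = augHess A u y η ξ := by
  filter_upwards [h.u4.eventually (by simp), h.jet2.continuousAt.eventually h.symm] with y h1 h2
  simp only [augHess, sub_apply]
  rw [hess_symm (h1.of_le (by norm_num)), h2]

theorem fderiv_augHess_symm (h : EigenPoint A b u M x e lam o) (d ξ η : Eu n) :
    fderiv ℝ (augHess A u) x d ξ η = fderiv ℝ (augHess A u) x d η ξ := by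
  have hd := h.contDiffAt_augHess.differentiableAt (by norm_num)
  rw [← fderiv_bil_apply hd, ← fderiv_bil_apply hd,
    Filter.EventuallyEq.fderiv_eq (h.augHess_symm ξ η)]

/-- The equation `log det w = b`, differentiated once and twice. -/
theorem differentiated (h : EigenPoint A b u M x e lam o) (d : Eu n) :
    fderiv ℝ b (jet u x) (fderiv ℝ (jet u) x d) =
      ∑ i, (lam i)⁻¹ * fderiv ℝ (augHess A u) x d (e i) (e i) ∧
    fderiv ℝ (fderiv ℝ b) (jet u x) (fderiv ℝ (jet u) x d) (fderiv ℝ (jet u) x d) +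
      fderiv ℝ b (jet u x) (0, hess u x d d, sharp (fderiv ℝ (hess u) x d d)) =
      ∑ i, (lam i)⁻¹ * fderiv ℝ (fderiv ℝ (augHess A u)) x d d (e i) (e i) -
        ∑ i, ∑ j, fderiv ℝ (augHess A u) x d (e i) (e j) ^ 2 * ((lam i)⁻¹ * (lam j)⁻¹) := by
  set W := augHess A u with hW
  have hW2 : ContDiffAt ℝ 2 W x := h.contDiffAt_augHess
  set m : ℝ → Matrix (Fin n) (Fin n) ℝ := fun t => Matrix.of fun i j => W (x + t • d) (e i) (e j)
  set m' : ℝ → Matrix (Fin n) (Fin n) ℝ :=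
    fun t => Matrix.of fun i j => fderiv ℝ W (x + t • d) d (e i) (e j)
  obtain ⟨l1, l2⟩ := line_derivatives hW2 d
  have hm0 : m 0 = Matrix.diagonal lam := by
    ext i j
    have h1 : m 0 i j = lam i * inner ℝ (e i) (e j) := by
      simp only [m, zero_smul, add_zero, Matrix.of_apply]
      exact h.diag i (e j)
    rw [h1, OrthonormalBasis.inner_eq_ite, Matrix.diagonal_apply]
    split_ifs <;> simp
  have key := log_det_deriv_diagonal (m := m) (m' := m')
    (m'' := Matrix.of fun i j => fderiv ℝ (fderiv ℝ W) x d d (e i) (e j)) h.pos hm0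
    (fun i j => by
      filter_upwards [l1] with t ht
      have := (ht.clm_apply (hasDerivAt_const t (e i))).clm_apply (hasDerivAt_const t (e j))
      simpa [m, m'] using this)
    (fun i j => by
      have := (l2.clm_apply (hasDerivAt_const _ (e i))).clm_apply (hasDerivAt_const _ (e j))
      simpa [m, m'] using this)
  have hbj : ContDiffAt ℝ 2 (fun y => b (jet u y)) x := h.b2.comp x h.jet2
  obtain ⟨k1, k2⟩ := line_derivatives hbj d
  have hc : Filter.Tendsto (fun s : ℝ => x + s • d) (𝓝 0) (𝓝 x) := by
    have : Continuous fun s : ℝ => x + s • d := by fun_prop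
    simpa using this.tendsto 0
  have hev : (fun s => Real.log (m s).det) =ᶠ[𝓝 0] fun s => b (jet u (x + s • d)) := by
    filter_upwards [hc.eventually h.eqn] with s hs
    rw [← hs, ← det_toMat _ e]
  have hd1 : deriv (fun s : ℝ => b (jet u (x + s • d))) =ᶠ[𝓝 0]
      fun s => fderiv ℝ (fun y => b (jet u y)) (x + s • d) d := by
    filter_upwards [k1] with t ht using ht.deriv
  have hfd : fderiv ℝ (fun y => b (jet u y)) x =
      (fderiv ℝ b (jet u x)).comp (fderiv ℝ (jet u) x) :=
    fderiv_comp x (h.b2.differentiableAt (by norm_num)) (h.jet2.differentiableAt (by norm_num))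
  constructor
  · have := key.1
    rw [hev.deriv_eq, hd1.self_of_nhds] at this
    simpa [hfd, m'] using this
  · have := key.2
    rw [hev.deriv.deriv_eq, hd1.deriv_eq, k2.deriv, fderiv_fderiv_comp h.b2 h.jet2,
      fderiv_fderiv_jet (h.u4.of_le (by norm_num))] at this
    rw [this]
    simp only [m', Matrix.of_apply, zero_smul, add_zero]
    congr 1
    refine Finset.sum_congr rfl fun i _ => Finset.sum_congr rfl fun j _ => ?_
    rw [hW, h.fderiv_augHess_symm d (e j) (e i)]
    ring

end EigenPoint

/-! ### The linearized operator applied to the augmented Hessian and to `|Du|²` -/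

namespace EigenPoint

variable {A : Eu n × ℝ × Eu n → Bil n} {b : Eu n × ℝ × Eu n → ℝ} {u : Eu n → ℝ} {M : ℝ} {x : Eu n}
  {e : OrthonormalBasis (Fin n) ℝ (Eu n)} {lam : Fin n → ℝ} {o : Fin n}

theorem norm_fderiv_jet_eigen (h : EigenPoint A b u M x e lam o) (i : Fin n) :
    ‖fderiv ℝ (jet u) x (e i)‖ ≤ 2 * M + lam i :=
  h.norm_fderiv_jet (h.pos i).le (by simp) (h.norm_augHess_eigen i)

theorem abs_hess_eigen (h : EigenPoint A b u M x e lam o) (i : Fin n) :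
    |hess u x (e i) (e i)| ≤ lam i + M := by
  rw [hess_eq A]
  have h1 : ‖(e i : Eu n)‖ = 1 := by simp
  refine (abs_add_le _ _).trans (add_le_add ?_ ?_)
  · change |augHess A u x (e i) (e i)| ≤ lam i
    rw [h.diag]; simp [abs_of_pos (h.pos i)]
  · exact (abs_bil_le _ _ _ h1 h1).trans h.bound.A0

theorem fderiv_hess_rotate (h : EigenPoint A b u M x e lam o) (d f : Eu n) :
    fderiv ℝ (hess u) x d d f = fderiv ℝ (hess u) x f d d := by
  have h3 : ContDiffAt ℝ 3 u x := h.u4.of_le (by norm_num)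
  rw [fderiv_hess_swap₂₃ h3, fderiv_hess_swap₁₂ h3]

/-- The trace of the third derivatives against the inverse of `w`, from the equation
differentiated once. -/
theorem sum_third (h : EigenPoint A b u M x e lam o) (f : Eu n) :
    ∑ i, (lam i)⁻¹ * fderiv ℝ (hess u) x (e i) (e i) f =
      fderiv ℝ b (jet u x) (fderiv ℝ (jet u) x f) +
        ∑ i, (lam i)⁻¹ * fderiv ℝ A (jet u x) (fderiv ℝ (jet u) x f) (e i) (e i) := by
  rw [(h.differentiated f).1, ← Finset.sum_add_distrib]
  refine Finset.sum_congr rfl fun i _ => ?_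
  rw [h.fderiv_hess_rotate, h.fderiv_augHess]
  simp only [sub_apply]
  ring

theorem norm_sum_third (h : EigenPoint A b u M x e lam o) :
    ‖∑ i, (lam i)⁻¹ • sharp (fderiv ℝ (hess u) x (e i) (e i))‖ ≤
      3 * M ^ 2 * lam o * (1 + ∑ i, (lam i)⁻¹) := by
  have hM := h.one_le_M
  have hl := h.one_le
  have hT : 0 ≤ ∑ i, (lam i)⁻¹ := Finset.sum_nonneg fun i _ => (inv_pos.2 (h.pos i)).le
  rw [← map_smul_sum_sharp, norm_sharp]
  refine ContinuousLinearMap.opNorm_le_bound _ (by positivity) fun f => ?_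
  simp only [sum_apply, smul_apply, smul_eq_mul]
  rw [h.sum_third, Real.norm_eq_abs]
  have hJ := h.norm_fderiv_jet_le f
  set v := fderiv ℝ (jet u) x f
  have h1 : |fderiv ℝ b (jet u x) v| ≤ M * ‖v‖ := h.bound.abs_b1 v
  have h2 : |∑ i, (lam i)⁻¹ * fderiv ℝ A (jet u x) v (e i) (e i)| ≤
      (∑ i, (lam i)⁻¹) * (M * ‖v‖) := by
    rw [Finset.sum_mul]
    refine (Finset.abs_sum_le_sum_abs _ _).trans (Finset.sum_le_sum fun i _ => ?_)
    rw [abs_mul, abs_of_pos (inv_pos.2 (h.pos i))]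
    exact mul_le_mul_of_nonneg_left (h.bound.abs_A1 v (by simp) (by simp))
      (inv_pos.2 (h.pos i)).le
  calc _ ≤ M * ‖v‖ + (∑ i, (lam i)⁻¹) * (M * ‖v‖) := (abs_add_le _ _).trans (add_le_add h1 h2)
    _ = (M * (1 + ∑ i, (lam i)⁻¹)) * ‖v‖ := by ring
    _ ≤ (M * (1 + ∑ i, (lam i)⁻¹)) * (3 * M * lam o * ‖f‖) := by gcongr
    _ = _ := by ring

/-- The derivative of the jet in the top eigendirection, up to a bounded vector. -/
theorem norm_jet_top_sub (h : EigenPoint A b u M x e lam o) :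
    ‖fderiv ℝ (jet u) x (e o) - lam o • ((0, 0, e o) : Eu n × ℝ × Eu n)‖ ≤ M := by
  have hn : ‖(e o : Eu n)‖ = 1 := by simp
  have h1 : fderiv ℝ (jet u) x (e o) - lam o • ((0, 0, e o) : Eu n × ℝ × Eu n) =
      (e o, fderiv ℝ u x (e o), sharp (A (jet u x) (e o))) := by
    have b1 : sharp (augHess A u x (e o)) = lam o • (e o : Eu n) := by
      apply ext_inner_right ℝ
      intro v
      rw [inner_sharp, h.diag, inner_smul_left]; simp
    rw [fderiv_jet (h.u4.of_le (by norm_num)), hess_eq A, add_apply, map_add, b1]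
    simp
  rw [h1, Prod.norm_def, Prod.norm_def]
  refine max_le (by simpa using h.one_le_M) (max_le ?_ ?_)
  · simp only
    rw [← inner_grad, Real.norm_eq_abs]
    refine (abs_real_inner_le_norm _ _).trans ?_
    rw [hn, mul_one]; exact h.bound.grad
  · simp only [norm_sharp]
    refine ((A (jet u x)).le_opNorm _).trans ?_
    rw [hn, mul_one]; exact h.bound.A0

/-- The quadratic term `D_{p_k p_l}A_{ii} u_{ko} u_{lo}`: for `i ≠ o` its leading part has a sign
by regularity, for `i = o` it is absorbed by the factor `lam o`. -/
theorem second_derivative_term (h : EigenPoint A b u M x e lam o) (i : Fin n) :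
    -(3 * M ^ 3 * lam o) - M * lam o * lam i ≤
      fderiv ℝ (fderiv ℝ A) (jet u x) (fderiv ℝ (jet u) x (e o)) (fderiv ℝ (jet u) x (e o))
        (e i) (e i) := by
  have hM := h.one_le_M
  have hl := h.one_le
  have hM0 : 0 < M := by linarith
  have hl0 : 0 < lam o := by linarith
  have hli := h.pos i
  have hn : ∀ i, ‖(e i : Eu n)‖ = 1 := fun i => by simp
  -- along `e o` the jet moves by `lam o` in the direction `p`, up to the bounded vector `P`
  set p : Eu n × ℝ × Eu n := (0, 0, e o) with hp
  set P : Eu n × ℝ × Eu n := fderiv ℝ (jet u) x (e o) - lam o • p with hP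
  have hPn : ‖P‖ ≤ M := h.norm_jet_top_sub
  have hJP : fderiv ℝ (jet u) x (e o) = P + lam o • p := by rw [hP]; abel
  have hpn : ‖p‖ = 1 := by rw [hp, norm_zero_zero, hn]
  have d1 := h.bound.abs_A2 P P (hn i) (hn i)
  have d2 := h.bound.abs_A2 P p (hn i) (hn i)
  have d3 := h.bound.abs_A2 p P (hn i) (hn i)
  have d4 : - (M * lam o * lam i) ≤
      lam o ^ 2 * fderiv ℝ (fderiv ℝ A) (jet u x) p p (e i) (e i) := by
    by_cases hio : i = o
    · have := h.bound.abs_A2 p p (hn i) (hn i)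
      rw [hpn] at this
      have := neg_le_of_abs_le this
      rw [hio] at this ⊢
      nlinarith [sq_nonneg (lam o)]
    · have h1 : 0 ≤ fderiv ℝ (fderiv ℝ A) (jet u x) p p (e i) (e i) :=
        h.regular _ _ (by rw [OrthonormalBasis.inner_eq_ite]; simp [hio])
      have h2 := mul_nonneg (sq_nonneg (lam o)) h1
      have h3 : 0 < M * lam o * lam i := by positivity
      linarith
  rw [hJP]
  simp only [map_add, map_smul, add_apply, smul_apply, smul_eq_mul]
  rw [hpn] at d2 d3
  have d1' : M * ‖P‖ * ‖P‖ ≤ M ^ 3 := by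
    calc M * ‖P‖ * ‖P‖ ≤ M * M * M := by gcongr
      _ = M ^ 3 := by ring
  have d2' : M * ‖P‖ ≤ M ^ 2 := by nlinarith
  have d5 := neg_le_of_abs_le (d1.trans d1')
  have d6 := neg_le_of_abs_le (d2.trans (by linarith : M * ‖P‖ * 1 ≤ M ^ 2))
  have d7 := neg_le_of_abs_le (d3.trans (by linarith : M * 1 * ‖P‖ ≤ M ^ 2))
  have pM2 : M ^ 2 ≤ M ^ 3 := pow_le_pow_right₀ hM (by norm_num)
  generalize fderiv ℝ (fderiv ℝ A) (jet u x) P P (e i) (e i) = x1 at *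
  generalize fderiv ℝ (fderiv ℝ A) (jet u x) P p (e i) (e i) = x2 at *
  generalize fderiv ℝ (fderiv ℝ A) (jet u x) p P (e i) (e i) = x3 at *
  generalize fderiv ℝ (fderiv ℝ A) (jet u x) p p (e i) (e i) = x4 at *
  have f1 := mul_le_mul_of_nonneg_left d6 hl0.le
  have f2 := mul_le_mul_of_nonneg_left d7 hl0.le
  have f3 := mul_le_mul_of_nonneg_left pM2 hl0.le
  have f4 := mul_le_mul_of_nonneg_left hl (by positivity : 0 ≤ M ^ 3)
  nlinarith

/-- The gradient of the second derivative `u_{oo}` differs from that of `w(e_o, e_o)` by first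
order terms in `D²u` only. -/
theorem norm_sharp_third_sub (h : EigenPoint A b u M x e lam o) :
    ‖sharp (fderiv ℝ (hess u) x (e o) (e o)) - ∇ (fun y => augHess A u y (e o) (e o)) x‖ ≤
      3 * M ^ 2 * lam o := by
  have hM0 : 0 < M := by linarith [h.one_le_M]
  have hl0 : 0 < lam o := by linarith [h.one_le]
  have hn : ‖(e o : Eu n)‖ = 1 := by simp
  rw [gradient_eq_sharp, ← map_sub, norm_sharp]
  refine ContinuousLinearMap.opNorm_le_bound _ (by positivity) fun f => ?_
  have e2 : (fderiv ℝ (hess u) x (e o) (e o) -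
      fderiv ℝ (fun y => augHess A u y (e o) (e o)) x) f =
      fderiv ℝ A (jet u x) (fderiv ℝ (jet u) x f) (e o) (e o) := by
    rw [sub_apply, fderiv_bil_apply (h.contDiffAt_augHess.differentiableAt (by norm_num)),
      h.fderiv_hess_rotate, h.fderiv_augHess]
    simp only [sub_apply]
    ring
  rw [e2, Real.norm_eq_abs]
  calc _ ≤ M * ‖fderiv ℝ (jet u) x f‖ := h.bound.abs_A1 _ hn hn
    _ ≤ M * (3 * M * lam o * ‖f‖) := by gcongr; exact h.norm_fderiv_jet_le f
    _ = _ := by ring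

theorem zero_add_split (t : ℝ) (s v : Eu n) :
    ((0, t, s) : Eu n × ℝ × Eu n) = (0, t, 0) + (0, 0, v) + (0, 0, s - v) := by simp

/-- The part of `Op w(e_o, e_o)` belonging to one eigendirection. -/
theorem hess_augHess_eigen (h : EigenPoint A b u M x e lam o) (i : Fin n) :
    (lam i)⁻¹ * fderiv ℝ (fderiv ℝ (augHess A u)) x (e o) (e o) (e i) (e i) +
      (lam i)⁻¹ * fderiv ℝ A (jet u x) (0, 0, ∇ (fun y => augHess A u y (e o) (e o)) x)
        (e i) (e i) -
      (lam i)⁻¹ * fderiv ℝ A (jet u x) (0, 0, sharp (fderiv ℝ (hess u) x (e i) (e i)))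
        (e o) (e o)
      - (13 * M ^ 3 * lam o * (lam i)⁻¹ + 7 * M ^ 3 * lam o) ≤
      (lam i)⁻¹ * hess (fun y => augHess A u y (e o) (e o)) x (e i) (e i) := by
  have hM := h.one_le_M
  have hl := h.one_le
  have hM0 : 0 < M := by linarith
  have hl0 : 0 < lam o := by linarith
  have hli := h.pos i
  have hlo := h.top i
  have hn : ∀ i, ‖(e i : Eu n)‖ = 1 := fun i => by simp
  set q := jet u x with hq
  set J := fun i => fderiv ℝ (jet u) x (e i) with hJ
  set s := fun i => sharp (fderiv ℝ (hess u) x (e i) (e i)) with hs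
  set H := fun i => hess u x (e i) (e i) with hH
  set g := ∇ (fun y => augHess A u y (e o) (e o)) x
  have hHo : |H o| ≤ 2 * M * lam o := (h.abs_hess_eigen o).trans (by nlinarith)
  have pM1 : M ≤ M ^ 3 := le_self_pow₀ hM (by norm_num)
  have pM2 : M ^ 2 ≤ M ^ 3 := pow_le_pow_right₀ hM (by norm_num)
  -- the fourth derivatives of `u` in the two orders agree; only derivatives of `A` remain
  have e1 : hess (fun y => augHess A u y (e o) (e o)) x (e i) (e i) =
      fderiv ℝ (fderiv ℝ (augHess A u)) x (e o) (e o) (e i) (e i) +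
      (fderiv ℝ (fderiv ℝ A) q (J o) (J o) (e i) (e i) +
        fderiv ℝ A q (0, H o, s o) (e i) (e i)) -
      (fderiv ℝ (fderiv ℝ A) q (J i) (J i) (e o) (e o) +
        fderiv ℝ A q (0, H i, s i) (e o) (e o)) := by
    have a1 : hess (fun y => augHess A u y (e o) (e o)) x (e i) (e i) =
        fderiv ℝ (fderiv ℝ (augHess A u)) x (e i) (e i) (e o) (e o) :=
      fderiv_fderiv_bil_apply h.contDiffAt_augHess _ _ _ _
    rw [a1, h.fderiv_fderiv_augHess, h.fderiv_fderiv_augHess]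
    simp only [sub_apply, add_apply]
    rw [fderiv_fderiv_hess_comm h.u4 (e i) (e o)]
    ring
  have c1 : -(3 * M ^ 3 * lam o) - M * lam o * lam i ≤
      fderiv ℝ (fderiv ℝ A) q (J o) (J o) (e i) (e i) := h.second_derivative_term i
  have c2 : fderiv ℝ A q (0, 0, g) (e i) (e i) - 5 * M ^ 3 * lam o ≤
      fderiv ℝ A q (0, H o, s o) (e i) (e i) := by
    have d1 := h.bound.abs_A1 (0, H o, 0) (hn i) (hn i)
    have d2 := h.bound.abs_A1 (0, 0, s o - g) (hn i) (hn i)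
    rw [norm_zero_mid] at d1
    rw [norm_zero_zero] at d2
    have d3 := neg_le_of_abs_le (d1.trans (mul_le_mul_of_nonneg_left hHo hM0.le))
    have d4 := neg_le_of_abs_le (d2.trans (mul_le_mul_of_nonneg_left h.norm_sharp_third_sub hM0.le))
    rw [zero_add_split (H o) (s o) g]
    simp only [map_add, add_apply]
    nlinarith [mul_nonneg hl0.le (by linarith : (0:ℝ) ≤ M ^ 3 - M ^ 2)]
  have c3 : fderiv ℝ (fderiv ℝ A) q (J i) (J i) (e o) (e o) ≤ M * (2 * M + lam i) ^ 2 := by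
    have d1 := h.bound.abs_A2 (J i) (J i) (hn o) (hn o)
    have d2 : ‖J i‖ ≤ 2 * M + lam i := h.norm_fderiv_jet_eigen i
    refine (le_of_abs_le d1).trans ?_
    calc M * ‖J i‖ * ‖J i‖ ≤ M * (2 * M + lam i) * (2 * M + lam i) := by gcongr
      _ = _ := by ring
  have c4 : fderiv ℝ A q (0, H i, s i) (e o) (e o) ≤
      M * (lam i + M) + fderiv ℝ A q (0, 0, s i) (e o) (e o) := by
    have d1 := h.bound.abs_A1 (0, H i, 0) (hn o) (hn o)
    rw [norm_zero_mid] at d1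
    have d2 := le_of_abs_le (d1.trans (mul_le_mul_of_nonneg_left (h.abs_hess_eigen i) hM0.le))
    rw [sharp_sub_grad_split (H i) (s i)]
    simp only [map_add, add_apply]
    linarith
  rw [e1]
  generalize fderiv ℝ (fderiv ℝ (augHess A u)) x (e o) (e o) (e i) (e i) = x1 at *
  generalize fderiv ℝ (fderiv ℝ A) q (J o) (J o) (e i) (e i) = x2 at *
  generalize fderiv ℝ A q (0, H o, s o) (e i) (e i) = x3 at *
  generalize fderiv ℝ (fderiv ℝ A) q (J i) (J i) (e o) (e o) = x4 at *
  generalize fderiv ℝ A q (0, H i, s i) (e o) (e o) = x5 at *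
  generalize fderiv ℝ A q (0, 0, s i) (e o) (e o) = x6 at *
  generalize fderiv ℝ A q (0, 0, g) (e i) (e i) = x7 at *
  -- the quadratic term `M * lam i ^ 2` of `c3` is linear in `lam i` after division by `lam i`
  have hinv : (lam i)⁻¹ * lam i = 1 := inv_mul_cancel₀ hli.ne'
  have ht0 : 0 < (lam i)⁻¹ := inv_pos.2 hli
  clear_value q J s H g
  generalize (lam i)⁻¹ = t at *
  have f1 : t * (x1 + x7 - x6 - (3 * M ^ 3 * lam o + M * lam o * lam i + 5 * M ^ 3 * lam o +
      M * (2 * M + lam i) ^ 2 + M * (lam i + M))) ≤ t * (x1 + (x2 + x3) - (x4 + x5)) :=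
    mul_le_mul_of_nonneg_left (by linarith) ht0.le
  have f2 : t * (3 * M ^ 3 * lam o + M * lam o * lam i + 5 * M ^ 3 * lam o +
      M * (2 * M + lam i) ^ 2 + M * (lam i + M)) =
      8 * M ^ 3 * lam o * t + 4 * M ^ 3 * t + M ^ 2 * t + M * lam o + 4 * M ^ 2 + M * lam i + M
      + (t * lam i - 1) * (M * lam o + 4 * M ^ 2 + M * lam i + M) := by ring
  have f3 : M ^ 3 * t ≤ M ^ 3 * lam o * t := by
    have : M ^ 3 * 1 ≤ M ^ 3 * lam o := by gcongr
    nlinarith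
  have f4 : M ^ 2 * t ≤ M ^ 3 * t := by gcongr
  have f5 : M * lam i ≤ M * lam o := by gcongr
  have f6 : M * lam o ≤ M ^ 3 * lam o := by gcongr
  have f9 : M ^ 3 * 1 ≤ M ^ 3 * lam o := by gcongr
  rw [hinv] at f2
  linarith

theorem sum_snd_snd (c : Fin n → ℝ) (s : Fin n → Eu n) :
    ((0, 0, ∑ i, c i • s i) : Eu n × ℝ × Eu n) = ∑ i, c i • ((0, 0, s i) : Eu n × ℝ × Eu n) := by
  ext1
  · simp [Prod.fst_sum]
  · ext1
    · simp [Prod.fst_sum, Prod.snd_sum]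
    · simp [Prod.snd_sum]

/-- The operator applied to the largest eigenvalue, frozen as `w(e_o, e_o)`. The fourth derivatives
are eliminated by the equation differentiated twice, which leaves the quadratic third order terms;
the linear third order terms go into the drift or, by `norm_sum_third`, into the error. -/
theorem linOp_augHess (h : EigenPoint A b u M x e lam o) :
    ∑ i, ∑ j, fderiv ℝ (augHess A u) x (e o) (e i) (e j) ^ 2 * ((lam i)⁻¹ * (lam j)⁻¹)
      - 16 * (n + 1) * M ^ 3 * lam o * (1 + ∑ i, (lam i)⁻¹ + lam o) ≤
      linOp A b u x e lam (fun y => augHess A u y (e o) (e o)) := by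
  have hM := h.one_le_M
  have hl := h.one_le
  have hM0 : 0 < M := by linarith
  have hl0 : 0 < lam o := by linarith
  have hn : ∀ i, ‖(e i : Eu n)‖ = 1 := fun i => by simp
  have hsum := Finset.sum_le_sum fun i (_ : i ∈ Finset.univ) => h.hess_augHess_eigen i
  have hb := (h.differentiated (e o)).2
  have h3 := h.norm_sum_third
  have hr := h.norm_sharp_third_sub
  have hHo : |hess u x (e o) (e o)| ≤ 2 * M * lam o := (h.abs_hess_eigen o).trans (by nlinarith)
  have hJo : ‖fderiv ℝ (jet u) x (e o)‖ ≤ 3 * M * lam o := by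
    simpa using h.norm_fderiv_jet_le (e o)
  rw [linOp, driftForm]
  have hbd := h.bound
  set q := jet u x
  set Jo := fderiv ℝ (jet u) x (e o)
  set s := fun i => sharp (fderiv ℝ (hess u) x (e i) (e i)) with hs
  set H := hess u x (e o) (e o)
  set g := ∇ (fun y => augHess A u y (e o) (e o)) x
  set S := ∑ i, ∑ j, fderiv ℝ (augHess A u) x (e o) (e i) (e j) ^ 2 * ((lam i)⁻¹ * (lam j)⁻¹)
  set T := ∑ i, (lam i)⁻¹ with hT
  have hT0 : 0 ≤ T := Finset.sum_nonneg fun i _ => (inv_pos.2 (h.pos i)).le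
  have hV2 : ∑ i, (lam i)⁻¹ * fderiv ℝ A q (0, 0, s i) (e o) (e o) ≤
      3 * M ^ 3 * lam o * (1 + T) := by
    have hV : ∑ i, (lam i)⁻¹ * fderiv ℝ A q (0, 0, s i) (e o) (e o) =
        fderiv ℝ A q (0, 0, ∑ i, (lam i)⁻¹ • s i) (e o) (e o) := by
      rw [sum_snd_snd]
      simp only [map_sum, map_smul, sum_apply, smul_apply, smul_eq_mul]
    rw [hV]
    refine (le_of_abs_le (hbd.abs_A1 _ (hn o) (hn o))).trans ?_
    rw [norm_zero_zero]
    calc _ ≤ M * (3 * M ^ 2 * lam o * (1 + T)) := mul_le_mul_of_nonneg_left h3 hM0.le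
      _ = _ := by ring
  have hb2 : -(9 * M ^ 3 * lam o ^ 2) ≤ fderiv ℝ (fderiv ℝ b) q Jo Jo := by
    refine neg_le_of_abs_le ((hbd.abs_b2 _ _).trans ?_)
    calc _ ≤ M * (3 * M * lam o) * (3 * M * lam o) := by gcongr
      _ = _ := by ring
  have hb1 : fderiv ℝ b q (0, 0, g) - 5 * M ^ 3 * lam o ≤ fderiv ℝ b q (0, H, s o) := by
    have d1 := hbd.abs_b1 (0, H, 0)
    have d2 := hbd.abs_b1 (0, 0, s o - g)
    rw [norm_zero_mid] at d1
    rw [norm_zero_zero] at d2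
    have d3 := neg_le_of_abs_le (d1.trans (mul_le_mul_of_nonneg_left hHo hM0.le))
    have d4 := neg_le_of_abs_le (d2.trans (mul_le_mul_of_nonneg_left hr hM0.le))
    rw [zero_add_split H (s o) g]
    simp only [map_add]
    have pM2 : M ^ 2 ≤ M ^ 3 := pow_le_pow_right₀ hM (by norm_num)
    nlinarith [mul_nonneg hl0.le (by linarith : (0:ℝ) ≤ M ^ 3 - M ^ 2)]
  rw [Finset.sum_sub_distrib, Finset.sum_sub_distrib, Finset.sum_add_distrib,
    Finset.sum_add_distrib, ← Finset.mul_sum, ← hT, Finset.sum_const, Finset.card_univ,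
    Fintype.card_fin, nsmul_eq_mul] at hsum
  have hfin : 13 * M ^ 3 * lam o * T + n * (7 * M ^ 3 * lam o) + 3 * M ^ 3 * lam o * (1 + T) +
      9 * M ^ 3 * lam o ^ 2 + 5 * M ^ 3 * lam o ≤
      16 * (n + 1) * M ^ 3 * lam o * (1 + T + lam o) := by
    have hX : 0 < M ^ 3 * lam o := by positivity
    have hn0 : (0 : ℝ) ≤ n := Nat.cast_nonneg n
    have : 13 * T + 7 * n + 3 * (1 + T) + 9 * lam o + 5 ≤ 16 * (n + 1) * (1 + T + lam o) := by
      nlinarith [mul_nonneg hn0 hT0, mul_nonneg hn0 hl0.le]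
    have := mul_le_mul_of_nonneg_left this hX.le
    linarith
  linarith

end EigenPoint

section LinOp

variable {A : Eu n × ℝ × Eu n → Bil n} {b : Eu n × ℝ × Eu n → ℝ} {u : Eu n → ℝ} {x : Eu n}
  {e : OrthonormalBasis (Fin n) ℝ (Eu n)} {lam : Fin n → ℝ}

theorem driftForm_add (q : Eu n × ℝ × Eu n) (v w : Eu n) :
    driftForm A b q e lam (v + w) = driftForm A b q e lam v + driftForm A b q e lam w := by
  have : ((0, 0, v + w) : Eu n × ℝ × Eu n) = (0, 0, v) + (0, 0, w) := by simp
  simp only [driftForm, this, map_add, add_apply, mul_add, Finset.sum_add_distrib]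
  ring

theorem driftForm_smul (q : Eu n × ℝ × Eu n) (c : ℝ) (v : Eu n) :
    driftForm A b q e lam (c • v) = c * driftForm A b q e lam v := by
  have : ((0, 0, c • v) : Eu n × ℝ × Eu n) = c • (0, 0, v) := by simp
  simp only [driftForm, this, map_smul, smul_apply, smul_eq_mul, mul_add, Finset.mul_sum]
  congr 1
  exact Finset.sum_congr rfl fun i _ => by ring

theorem fderiv_fderiv_add {f g : Eu n → ℝ} (hf : ContDiffAt ℝ 2 f x) (hg : ContDiffAt ℝ 2 g x) :
    fderiv ℝ (fderiv ℝ fun y => f y + g y) x =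
      fderiv ℝ (fderiv ℝ f) x + fderiv ℝ (fderiv ℝ g) x := by
  have hev : fderiv ℝ (fun y => f y + g y) =ᶠ[𝓝 x] fun y => fderiv ℝ f y + fderiv ℝ g y := by
    filter_upwards [hf.eventually_differentiableAt (by norm_num),
      hg.eventually_differentiableAt (by norm_num)] with y h1 h2
    exact fderiv_fun_add h1 h2
  rw [hev.fderiv_eq, fderiv_fun_add hf.differentiableAt_fderiv hg.differentiableAt_fderiv]

theorem fderiv_fderiv_const_mul {f : Eu n → ℝ} (hf : ContDiffAt ℝ 2 f x) (c : ℝ) :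
    fderiv ℝ (fderiv ℝ fun y => c * f y) x = c • fderiv ℝ (fderiv ℝ f) x := by
  have hev : fderiv ℝ (fun y => c * f y) =ᶠ[𝓝 x] fun y => c • fderiv ℝ f y := by
    filter_upwards [hf.eventually_differentiableAt (by norm_num)] with y h1
    exact fderiv_const_mul h1 c
  rw [hev.fderiv_eq, fderiv_fun_const_smul hf.differentiableAt_fderiv]

theorem linOp_add {f g : Eu n → ℝ} (hf : ContDiffAt ℝ 2 f x) (hg : ContDiffAt ℝ 2 g x) :
    linOp A b u x e lam (fun y => f y + g y) =
      linOp A b u x e lam f + linOp A b u x e lam g := by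
  have h1 : ∇ (fun y => f y + g y) x = ∇ f x + ∇ g x := by
    simp only [gradient_eq_sharp]
    rw [fderiv_fun_add (hf.differentiableAt (by norm_num)) (hg.differentiableAt (by norm_num)),
      map_add]
  simp only [linOp, h1, driftForm_add, hess, fderiv_fderiv_add hf hg, add_apply, mul_add,
    Finset.sum_add_distrib]
  ring

theorem linOp_const_mul {f : Eu n → ℝ} (hf : ContDiffAt ℝ 2 f x) (c : ℝ) :
    linOp A b u x e lam (fun y => c * f y) = c * linOp A b u x e lam f := by
  have h1 : ∇ (fun y => c * f y) x = c • ∇ f x := by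
    simp only [gradient_eq_sharp]
    rw [fderiv_const_mul (hf.differentiableAt (by norm_num)), map_smul]
  simp only [linOp, h1, driftForm_smul, hess, fderiv_fderiv_const_mul hf, smul_apply, smul_eq_mul,
    mul_sub, Finset.mul_sum]
  congr 1
  exact Finset.sum_congr rfl fun i _ => by ring

theorem linOp_log {f : Eu n → ℝ} (hf : ContDiffAt ℝ 2 f x) (h0 : f x ≠ 0) :
    linOp A b u x e lam (fun y => Real.log (f y)) =
      linOp A b u x e lam f / f x - ∑ i, (lam i)⁻¹ * (fderiv ℝ f x (e i) / f x) ^ 2 := by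
  have h1 : ∇ (fun y => Real.log (f y)) x = (f x)⁻¹ • ∇ f x := by
    simp only [gradient_eq_sharp]
    rw [← map_smul]
    congr 1
    ext d
    rw [(fderiv_log hf h0 d).1, smul_apply, smul_eq_mul]; ring
  simp only [linOp, h1, driftForm_smul, hess, (fderiv_log hf h0 _).2, mul_sub,
    Finset.sum_sub_distrib, sub_div, Finset.sum_div]
  have : ∀ i, (lam i)⁻¹ * (fderiv ℝ (fderiv ℝ f) x (e i) (e i) / f x) =
      (lam i)⁻¹ * fderiv ℝ (fderiv ℝ f) x (e i) (e i) / f x := fun i => by ring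
  simp only [this]
  ring

end LinOp

namespace EigenPoint

variable {A : Eu n × ℝ × Eu n → Bil n} {b : Eu n × ℝ × Eu n → ℝ} {u : Eu n → ℝ} {M : ℝ} {x : Eu n}
  {e : OrthonormalBasis (Fin n) ℝ (Eu n)} {lam : Fin n → ℝ} {o : Fin n}

theorem sum_inv_nonneg (h : EigenPoint A b u M x e lam o) : 0 ≤ ∑ i, (lam i)⁻¹ :=
  Finset.sum_nonneg fun i _ => (inv_pos.2 (h.pos i)).le

/-- `|Du|² / 2` supplies a multiple of the trace of `w`. The terms of first order in `D²u` cancel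
against the first order part of the operator. -/
theorem linOp_half_sq_grad (h : EigenPoint A b u M x e lam o) :
    (∑ i, lam i) / 2 - 2 * M ^ 3 * (1 + ∑ i, (lam i)⁻¹) ≤
      linOp A b u x e lam (fun y => ‖∇ u y‖ ^ 2 / 2) := by
  have hM := h.one_le_M
  have hM0 : 0 < M := by linarith
  have hn : ∀ i, ‖(e i : Eu n)‖ = 1 := fun i => by simp
  have hu3 : ContDiffAt ℝ 3 u x := h.u4.of_le (by norm_num)
  have hT0 := h.sum_inv_nonneg
  have hbd := h.bound
  have hg : ∇ (fun y => ‖∇ u y‖ ^ 2 / 2) x = sharp (hess u x (∇ u x)) := by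
    rw [gradient_eq_sharp]
    congr 1
    ext d
    rw [(fderiv_half_sq_grad hu3 d).2.1, hess_symm (hu3.of_le (by norm_num))]
  have h3 := h.sum_third (∇ u x)
  set G := ∇ u x with hG
  have hGM : ‖G‖ ≤ M := hbd.grad
  set P : Eu n × ℝ × Eu n := (G, ‖G‖ ^ 2, 0) with hP
  set g := sharp (hess u x G) with hgdef
  have hJ : fderiv ℝ (jet u) x G = P + (0, 0, g) := by
    rw [fderiv_jet (hu3.of_le (by norm_num)), ← inner_grad, ← hG, real_inner_self_eq_norm_sq]
    simp [hP, hgdef]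
  have hPn : ‖P‖ ≤ M ^ 2 := by
    rw [hP, Prod.norm_def, Prod.norm_def]
    refine max_le (by simp only; nlinarith [norm_nonneg G]) (max_le ?_ ?_)
    · simp only [norm_pow, norm_norm]
      gcongr
    · simp only [norm_zero]; positivity
  rw [linOp, driftForm, hg]
  simp only [(fderiv_half_sq_grad hu3 _).2.2, mul_add, Finset.sum_add_distrib]
  rw [h3, hJ]
  simp only [map_add, add_apply, mul_add, Finset.sum_add_distrib]
  have k1 : -(M ^ 3) ≤ fderiv ℝ b (jet u x) P := by
    refine neg_le_of_abs_le ((hbd.abs_b1 P).trans ?_)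
    calc M * ‖P‖ ≤ M * M ^ 2 := by gcongr
      _ = M ^ 3 := by ring
  have k2 : -(M ^ 3 * ∑ i, (lam i)⁻¹) ≤
      ∑ i, (lam i)⁻¹ * fderiv ℝ A (jet u x) P (e i) (e i) := by
    rw [Finset.mul_sum, ← Finset.sum_neg_distrib]
    refine Finset.sum_le_sum fun i _ => ?_
    have := hbd.abs_A1 P (hn i) (hn i)
    have : -(M ^ 3) ≤ fderiv ℝ A (jet u x) P (e i) (e i) := by
      refine neg_le_of_abs_le (this.trans ?_)
      calc M * ‖P‖ ≤ M * M ^ 2 := by gcongr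
        _ = M ^ 3 := by ring
    have := mul_le_mul_of_nonneg_left this (inv_pos.2 (h.pos i)).le
    linarith
  have k3 : (∑ i, lam i) / 2 - M ^ 3 * ∑ i, (lam i)⁻¹ ≤
      ∑ i, (lam i)⁻¹ * ‖sharp (hess u x (e i))‖ ^ 2 := by
    rw [Finset.sum_div, Finset.mul_sum, ← Finset.sum_sub_distrib]
    refine Finset.sum_le_sum fun i _ => ?_
    have hli := h.pos i
    have e1 : sharp (hess u x (e i)) = lam i • (e i : Eu n) + sharp (A (jet u x) (e i)) := by
      have b1 : sharp (augHess A u x (e i)) = lam i • (e i : Eu n) := by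
        apply ext_inner_right ℝ
        intro v
        rw [inner_sharp, h.diag, inner_smul_left]; simp
      rw [hess_eq A, add_apply, map_add, b1]
    have e2 : ‖sharp (A (jet u x) (e i))‖ ≤ M := by
      rw [norm_sharp]
      refine ((A (jet u x)).le_opNorm _).trans ?_
      rw [hn, mul_one]; exact hbd.A0
    have e3 : lam i ≤ ‖sharp (hess u x (e i))‖ + M := by
      have := norm_sub_le (lam i • (e i : Eu n) + sharp (A (jet u x) (e i)))
        (sharp (A (jet u x) (e i)))
      rw [add_sub_cancel_right, norm_smul, hn, mul_one, Real.norm_of_nonneg hli.le, ← e1] at this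
      linarith
    have e4 : lam i ^ 2 / 2 - M ^ 2 ≤ ‖sharp (hess u x (e i))‖ ^ 2 := by
      have : lam i ^ 2 ≤ (‖sharp (hess u x (e i))‖ + M) ^ 2 := by gcongr
      nlinarith [sq_nonneg (‖sharp (hess u x (e i))‖ - M)]
    have e5 := mul_le_mul_of_nonneg_left e4 (inv_pos.2 hli).le
    have e6 : (lam i)⁻¹ * (lam i ^ 2 / 2 - M ^ 2) = lam i / 2 - M ^ 2 * (lam i)⁻¹ := by
      field_simp
    have pM2 : M ^ 2 ≤ M ^ 3 := pow_le_pow_right₀ hM (by norm_num)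
    have := mul_le_mul_of_nonneg_right pM2 (inv_pos.2 hli).le
    linarith
  have := pow_pos hM0 3
  linarith

/-- The quadratic third order terms dominate the squares of the logarithmic derivatives of the
largest eigenvalue, with half of these squares left over in the directions `i ≠ o`. -/
theorem third_order_terms (h : EigenPoint A b u M x e lam o) :
    ∑ i ∈ Finset.univ.erase o,
        (lam i)⁻¹ * (fderiv ℝ (augHess A u) x (e i) (e o) (e o) / lam o) ^ 2 / 2 -
      216 * M ^ 4 * ∑ i, (lam i)⁻¹ ≤
    (∑ i, ∑ j, fderiv ℝ (augHess A u) x (e o) (e i) (e j) ^ 2 * ((lam i)⁻¹ * (lam j)⁻¹)) / lam o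
      - ∑ i, (lam i)⁻¹ * (fderiv ℝ (augHess A u) x (e i) (e o) (e o) / lam o) ^ 2 := by
  have hM := h.one_le_M
  have hl := h.one_le
  have hM0 : 0 < M := by linarith
  have hl0 : 0 < lam o := by linarith
  have hn : ∀ i, ‖(e i : Eu n)‖ = 1 := fun i => by simp
  have hu3 : ContDiffAt ℝ 3 u x := h.u4.of_le (by norm_num)
  set s : Fin n → Fin n → ℝ := fun i j => fderiv ℝ (augHess A u) x (e o) (e i) (e j) with hs
  set d : Fin n → ℝ := fun i => fderiv ℝ (augHess A u) x (e i) (e o) (e o) with hd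
  have hsym : ∀ i j, s i j = s j i := fun i j => h.fderiv_augHess_symm _ _ _
  -- third derivatives of `u` are symmetric, so exchanging indices costs derivatives of `A` only
  have hdiff : ∀ i, |s o i - d i| ≤ 6 * M ^ 2 * lam o := by
    intro i
    have e1 : s o i - d i = fderiv ℝ A (jet u x) (fderiv ℝ (jet u) x (e i)) (e o) (e o) -
        fderiv ℝ A (jet u x) (fderiv ℝ (jet u) x (e o)) (e o) (e i) := by
      simp only [hs, hd, h.fderiv_augHess, sub_apply]
      rw [h.fderiv_hess_rotate]
      ring
    have hJ : ∀ k, M * ‖fderiv ℝ (jet u) x (e k)‖ ≤ 3 * M ^ 2 * lam o := fun k => by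
      have := h.norm_fderiv_jet_le (e k)
      rw [hn, mul_one] at this
      calc _ ≤ M * (3 * M * lam o) := by gcongr
        _ = _ := by ring
    rw [e1]
    refine (abs_sub _ _).trans ?_
    have := (h.bound.abs_A1 (fderiv ℝ (jet u) x (e i)) (hn o) (hn o)).trans (hJ i)
    have := (h.bound.abs_A1 (fderiv ℝ (jet u) x (e o)) (hn o) (hn i)).trans (hJ o)
    linarith
  -- the entries of the double sum with an index `o`; those off the diagonal occur twice
  have hS : s o o ^ 2 * (lam o)⁻¹ * (lam o)⁻¹ +
      ∑ i ∈ Finset.univ.erase o, 2 * (s o i ^ 2 * (lam i)⁻¹) * (lam o)⁻¹ ≤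
      ∑ i, ∑ j, s i j ^ 2 * ((lam i)⁻¹ * (lam j)⁻¹) := by
    have hnn : ∀ i j, 0 ≤ s i j ^ 2 * ((lam i)⁻¹ * (lam j)⁻¹) := fun i j =>
      mul_nonneg (sq_nonneg _) (mul_nonneg (inv_pos.2 (h.pos i)).le (inv_pos.2 (h.pos j)).le)
    rw [← Finset.add_sum_erase _ _ (Finset.mem_univ o),
      ← Finset.add_sum_erase _ (fun j => s o j ^ 2 * ((lam o)⁻¹ * (lam j)⁻¹)) (Finset.mem_univ o)]
    have h1 : ∑ i ∈ Finset.univ.erase o, s i o ^ 2 * ((lam i)⁻¹ * (lam o)⁻¹) ≤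
        ∑ i ∈ Finset.univ.erase o, ∑ j, s i j ^ 2 * ((lam i)⁻¹ * (lam j)⁻¹) :=
      Finset.sum_le_sum fun i _ =>
        Finset.single_le_sum (f := fun j => s i j ^ 2 * ((lam i)⁻¹ * (lam j)⁻¹))
          (fun j _ => hnn i j) (Finset.mem_univ o)
    have h2 : ∑ i ∈ Finset.univ.erase o, 2 * (s o i ^ 2 * (lam i)⁻¹) * (lam o)⁻¹ =
        ∑ j ∈ Finset.univ.erase o, s o j ^ 2 * ((lam o)⁻¹ * (lam j)⁻¹) +
        ∑ i ∈ Finset.univ.erase o, s i o ^ 2 * ((lam i)⁻¹ * (lam o)⁻¹) := by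
      rw [← Finset.sum_add_distrib]
      refine Finset.sum_congr rfl fun i _ => ?_
      rw [hsym i o]; ring
    linarith
  have hS' := div_le_div_of_nonneg_right hS hl0.le
  rw [← Finset.add_sum_erase _ (fun i => (lam i)⁻¹ * (d i / lam o) ^ 2) (Finset.mem_univ o)]
  have hdo : d o = s o o := rfl
  have hterm : ∀ i, (lam i)⁻¹ * (d i / lam o) ^ 2 / 2 - 216 * M ^ 4 * (lam i)⁻¹ ≤
      2 * (s o i ^ 2 * (lam i)⁻¹) * (lam o)⁻¹ / lam o - (lam i)⁻¹ * (d i / lam o) ^ 2 := by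
    intro i
    have hE := hdiff i
    have hE2 : (s o i / lam o - d i / lam o) ^ 2 ≤ 36 * M ^ 4 := by
      rw [← sub_div, div_pow, div_le_iff₀ (by positivity), ← sq_abs]
      calc |s o i - d i| ^ 2 ≤ (6 * M ^ 2 * lam o) ^ 2 := by gcongr
        _ = _ := by ring
    -- `d² / 2 - 6 (s - d)² ≤ 2 s² - d²`, and `216 = 6 * 36`
    have h1 : (d i / lam o) ^ 2 / 2 - 216 * M ^ 4 ≤
        2 * (s o i / lam o) ^ 2 - (d i / lam o) ^ 2 := by
      nlinarith [sq_nonneg (4 * (s o i / lam o - d i / lam o) + d i / lam o)]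
    have h2 := mul_le_mul_of_nonneg_left h1 (inv_pos.2 (h.pos i)).le
    have h3 : 2 * (s o i ^ 2 * (lam i)⁻¹) * (lam o)⁻¹ / lam o =
        (lam i)⁻¹ * (2 * (s o i / lam o) ^ 2) := by
      field_simp
    rw [h3]
    linarith
  have hsum := Finset.sum_le_sum fun i (_ : i ∈ Finset.univ.erase o) => hterm i
  rw [Finset.sum_sub_distrib, Finset.sum_sub_distrib, ← Finset.mul_sum,
    ← Finset.sum_div _ _ (lam o)] at hsum
  have hT : ∑ i ∈ Finset.univ.erase o, (lam i)⁻¹ ≤ ∑ i, (lam i)⁻¹ :=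
    Finset.sum_le_sum_of_subset_of_nonneg (Finset.erase_subset _ _)
      fun i _ _ => (inv_pos.2 (h.pos i)).le
  have hT' := mul_le_mul_of_nonneg_left hT (by positivity : 0 ≤ 216 * M ^ 4)
  have e1 : s o o ^ 2 * (lam o)⁻¹ * (lam o)⁻¹ / lam o = (lam o)⁻¹ * (d o / lam o) ^ 2 := by
    rw [hdo]; field_simp
  rw [add_div, e1] at hS'
  linarith

/-- The maximum principle for `ψ + log w(e_o, e_o) + a |Du|² / 2`: the inequality that every such
local maximum satisfies. The squares kept on the left are those left over in `third_order_terms`,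
rewritten by the first order condition. -/
theorem max_inequality (h : EigenPoint A b u M x e lam o) {ψ : Eu n → ℝ} (hψ : ContDiffAt ℝ 2 ψ x)
    {a : ℝ} (ha : 0 ≤ a)
    (hmax : IsLocalMax
      (fun y => ψ y + (Real.log (augHess A u y (e o) (e o)) + a * (‖∇ u y‖ ^ 2 / 2))) x) :
    linOp A b u x e lam ψ +
      ∑ i ∈ Finset.univ.erase o,
        (lam i)⁻¹ * (fderiv ℝ ψ x (e i) + a * hess u x (e i) (∇ u x)) ^ 2 / 2 +
      a / 2 * ∑ i, lam i ≤
      232 * (n + 1) * M ^ 4 * (1 + ∑ i, (lam i)⁻¹ + lam o) +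
        a * (2 * M ^ 3 * (1 + ∑ i, (lam i)⁻¹)) := by
  have hM := h.one_le_M
  have hl := h.one_le
  have hM0 : 0 < M := by linarith
  have hl0 : 0 < lam o := by linarith
  have hu3 : ContDiffAt ℝ 3 u x := h.u4.of_le (by norm_num)
  set w : Eu n → ℝ := fun y => augHess A u y (e o) (e o) with hw
  have hw2 : ContDiffAt ℝ 2 w x :=
    (h.contDiffAt_augHess.clm_apply contDiffAt_const).clm_apply contDiffAt_const
  have hwx : w x = lam o := by
    simp only [hw]; rw [h.diag]; simp
  have hlog : ContDiffAt ℝ 2 (fun y => Real.log (w y)) x := hw2.log (by rw [hwx]; exact hl0.ne')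
  have hG2 := (fderiv_half_sq_grad hu3 (0 : Eu n)).1
  have haG : ContDiffAt ℝ 2 (fun y => a * (‖∇ u y‖ ^ 2 / 2)) x := contDiffAt_const.mul hG2
  set v : Eu n → ℝ := fun y => ψ y + (Real.log (w y) + a * (‖∇ u y‖ ^ 2 / 2)) with hv
  have hv2 : ContDiffAt ℝ 2 v x := hψ.add (hlog.add haG)
  obtain ⟨m1, m2⟩ := isLocalMax_fderiv hv2 hmax
  have hop : linOp A b u x e lam v ≤ 0 := by
    have hgrad : ∇ v x = 0 := by rw [gradient_eq_sharp, m1, map_zero]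
    have hz : driftForm A b (jet u x) e lam 0 = 0 := by
      have := driftForm_smul (A := A) (b := b) (e := e) (lam := lam) (jet u x) 0 0
      simpa using this
    rw [linOp, hgrad, hz, sub_zero]
    refine Finset.sum_nonpos fun i _ => ?_
    exact mul_nonpos_of_nonneg_of_nonpos (inv_pos.2 (h.pos i)).le (m2 _)
  rw [hv, linOp_add hψ (hlog.add haG), linOp_add hlog haG, linOp_const_mul hG2,
    linOp_log hw2 (by rw [hwx]; exact hl0.ne'), hwx] at hop
  have hfw : ∀ i, fderiv ℝ w x (e i) = fderiv ℝ (augHess A u) x (e i) (e o) (e o) := fun i =>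
    fderiv_bil_apply (h.contDiffAt_augHess.differentiableAt (by norm_num)) _ _ _
  -- the first order condition at the maximum
  have hfirst : ∀ i, fderiv ℝ (augHess A u) x (e i) (e o) (e o) / lam o =
      -(fderiv ℝ ψ x (e i) + a * hess u x (e i) (∇ u x)) := by
    intro i
    have hd : fderiv ℝ v x (e i) = fderiv ℝ ψ x (e i) +
        (fderiv ℝ w x (e i) / w x + a * hess u x (e i) (∇ u x)) := by
      rw [hv, fderiv_fun_add (hψ.differentiableAt (by norm_num))
        ((hlog.add haG).differentiableAt (by norm_num)),
        fderiv_fun_add (hlog.differentiableAt (by norm_num)) (haG.differentiableAt (by norm_num)),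
        fderiv_const_mul (hG2.differentiableAt (by norm_num))]
      simp only [add_apply, smul_apply, smul_eq_mul]
      rw [(fderiv_log hw2 (by rw [hwx]; exact hl0.ne') _).1, (fderiv_half_sq_grad hu3 _).2.1]
    rw [m1, hwx, hfw] at hd
    simp only [zero_apply] at hd
    linarith
  have t1 := h.third_order_terms
  have t2 := h.linOp_augHess
  have t3 := mul_le_mul_of_nonneg_left h.linOp_half_sq_grad ha
  simp only [hfw] at hop
  have t2' := div_le_div_of_nonneg_right t2 hl0.le
  rw [sub_div] at t2'
  have e1 : 16 * (n + 1) * M ^ 3 * lam o * (1 + ∑ i, (lam i)⁻¹ + lam o) / lam o =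
      16 * (n + 1) * M ^ 3 * (1 + ∑ i, (lam i)⁻¹ + lam o) := by field_simp
  rw [e1] at t2'
  have hT0 := h.sum_inv_nonneg
  have hfin : 16 * (n + 1) * M ^ 3 * (1 + ∑ i, (lam i)⁻¹ + lam o) +
      216 * M ^ 4 * ∑ i, (lam i)⁻¹ ≤ 232 * (n + 1) * M ^ 4 * (1 + ∑ i, (lam i)⁻¹ + lam o) := by
    have hn0 : (0 : ℝ) ≤ n := Nat.cast_nonneg n
    have p1 : M ^ 3 ≤ M ^ 4 := pow_le_pow_right₀ hM (by norm_num)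
    have p2 : (n + 1) * M ^ 3 * (1 + ∑ i, (lam i)⁻¹ + lam o) ≤
        (n + 1) * M ^ 4 * (1 + ∑ i, (lam i)⁻¹ + lam o) := by gcongr
    have p3 : M ^ 4 * ∑ i, (lam i)⁻¹ ≤ (n + 1) * M ^ 4 * (1 + ∑ i, (lam i)⁻¹ + lam o) := by
      have : 1 * M ^ 4 * ∑ i, (lam i)⁻¹ ≤ (n + 1) * M ^ 4 * (1 + ∑ i, (lam i)⁻¹ + lam o) := by
        gcongr <;> linarith
      linarith
    linarith
  have e2 : ∑ i ∈ Finset.univ.erase o,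
        (lam i)⁻¹ * (fderiv ℝ (augHess A u) x (e i) (e o) (e o) / lam o) ^ 2 / 2 =
      ∑ i ∈ Finset.univ.erase o,
        (lam i)⁻¹ * (fderiv ℝ ψ x (e i) + a * hess u x (e i) (∇ u x)) ^ 2 / 2 :=
    Finset.sum_congr rfl fun i _ => by rw [hfirst]; ring
  rw [e2] at t1
  linarith

end EigenPoint

/-! ### Bounds at maximum points -/

namespace EigenPoint

variable {A : Eu n × ℝ × Eu n → Bil n} {b : Eu n × ℝ × Eu n → ℝ} {u : Eu n → ℝ} {M : ℝ} {x : Eu n}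
  {e : OrthonormalBasis (Fin n) ℝ (Eu n)} {lam : Fin n → ℝ} {o : Fin n}

theorem lam_le_sum (h : EigenPoint A b u M x e lam o) : lam o ≤ ∑ i, lam i :=
  Finset.single_le_sum (fun i _ => (h.pos i).le) (Finset.mem_univ o)

/-- A barrier `φ` controls the trace of the inverse of `w`. -/
theorem linOp_barrier (h : EigenPoint A b u M x e lam o) {φ : Eu n → ℝ} {k : ℝ}
    (hk : ‖∇ φ x‖ ≤ k)
    (hφ : ∀ ξ : Eu n, ‖ξ‖ = 1 → 1 ≤ hess φ x ξ ξ - fderiv ℝ A (jet u x) (0, 0, ∇ φ x) ξ ξ) :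
    ∑ i, (lam i)⁻¹ - M * k ≤ linOp A b u x e lam φ := by
  have hM0 : 0 ≤ M := by linarith [h.one_le_M]
  have h1 : ∑ i, (lam i)⁻¹ ≤ ∑ i, ((lam i)⁻¹ * hess φ x (e i) (e i) -
      (lam i)⁻¹ * fderiv ℝ A (jet u x) (0, 0, ∇ φ x) (e i) (e i)) := by
    refine Finset.sum_le_sum fun i _ => ?_
    have := mul_le_mul_of_nonneg_left (hφ (e i) (by simp)) (inv_pos.2 (h.pos i)).le
    linarith
  have h2 := le_of_abs_le (h.bound.abs_b1 (0, 0, ∇ φ x))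
  rw [norm_zero_zero] at h2
  have h3 : M * ‖∇ φ x‖ ≤ M * k := by gcongr
  rw [Finset.sum_sub_distrib] at h1
  rw [linOp, driftForm]
  linarith

/-- The operator applied to the logarithm of a cut-off function `η`. -/
theorem linOp_log_cutoff (h : EigenPoint A b u M x e lam o) {η : Eu n → ℝ} {D : ℝ}
    (hη : ContDiffAt ℝ 2 η x) (hη0 : 0 < η x)
    (hLη : -(D * (1 + η x * ∑ i, (lam i)⁻¹ + ∑ i, (lam i)⁻¹ * |fderiv ℝ η x (e i)|)) ≤
        linOp A b u x e lam η) :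
    -(D / η x) - (D + D ^ 2) * ∑ i, (lam i)⁻¹ -
        2 * ∑ i, (lam i)⁻¹ * (fderiv ℝ η x (e i) / η x) ^ 2 ≤
      linOp A b u x e lam (fun y => Real.log (η y)) := by
  rw [linOp_log hη hη0.ne']
  set T := ∑ i, (lam i)⁻¹ with hT
  have e1 : ∑ i, (lam i)⁻¹ * |fderiv ℝ η x (e i)| =
      η x * ∑ i, (lam i)⁻¹ * |fderiv ℝ η x (e i) / η x| := by
    rw [Finset.mul_sum]
    refine Finset.sum_congr rfl fun i _ => ?_
    rw [abs_div, abs_of_pos hη0]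
    field_simp
  have e2 : D * ∑ i, (lam i)⁻¹ * |fderiv ℝ η x (e i) / η x| ≤
      D ^ 2 * T + ∑ i, (lam i)⁻¹ * (fderiv ℝ η x (e i) / η x) ^ 2 := by
    rw [Finset.mul_sum, hT, Finset.mul_sum, ← Finset.sum_add_distrib]
    refine Finset.sum_le_sum fun i _ => ?_
    generalize fderiv ℝ η x (e i) / η x = p
    have e3 : D * |p| ≤ D ^ 2 + p ^ 2 := by
      rw [← sq_abs p]
      nlinarith [sq_nonneg (D - |p|), sq_nonneg D, sq_nonneg |p|]
    have := mul_le_mul_of_nonneg_left e3 (inv_pos.2 (h.pos i)).le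
    linarith
  rw [e1] at hLη
  have e4 := div_le_div_of_nonneg_right hLη hη0.le
  have e5 : -(D * (1 + η x * T + η x * ∑ i, (lam i)⁻¹ * |fderiv ℝ η x (e i) / η x|)) / η x =
      -(D / η x) - D * T - D * ∑ i, (lam i)⁻¹ * |fderiv ℝ η x (e i) / η x| := by
    field_simp; ring
  rw [e5] at e4
  linarith

end EigenPoint

/-- The bound for the largest eigenvalue at an interior maximum, in the presence of a barrier. -/
theorem exists_bound_at_max_of_barrier (n : ℕ) {M : ℝ} (hM : 1 ≤ M) (k : ℝ) :
    ∃ a β L : ℝ, 0 ≤ a ∧ 0 ≤ β ∧ ∀ (A : Eu n × ℝ × Eu n → Bil n) (b : Eu n × ℝ × Eu n → ℝ)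
      (u : Eu n → ℝ) (x : Eu n) (e : OrthonormalBasis (Fin n) ℝ (Eu n)) (lam : Fin n → ℝ)
      (o : Fin n) (φ : Eu n → ℝ),
      EigenPoint A b u M x e lam o → ContDiffAt ℝ 2 φ x → ‖∇ φ x‖ ≤ k →
      (∀ ξ : Eu n, ‖ξ‖ = 1 → 1 ≤ hess φ x ξ ξ - fderiv ℝ A (jet u x) (0, 0, ∇ φ x) ξ ξ) →
      IsLocalMax (fun y => β * φ y +
        (Real.log (augHess A u y (e o) (e o)) + a * (‖∇ u y‖ ^ 2 / 2))) x →
      lam o ≤ L := by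
  have hM0 : 0 < M := by linarith
  set C : ℝ := 232 * (n + 1) * M ^ 4 with hC
  have hC0 : 0 ≤ C := by positivity
  -- `a` makes the trace of `w` outweigh `C * lam o`, and `β` then makes the barrier outweigh all
  -- multiples of the trace of the inverse
  set a : ℝ := 2 * C + 2 with ha
  have ha0 : 0 ≤ a := by positivity
  set β : ℝ := C + 2 * a * M ^ 3 with hβ
  have hβ0 : 0 ≤ β := by positivity
  refine ⟨a, β, β * (1 + M * k), ha0, hβ0, fun A b u x e lam o φ h hφ hgrad hbar hmax => ?_⟩
  have h1 := h.max_inequality (contDiffAt_const.mul hφ) ha0 hmax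
  rw [linOp_const_mul hφ] at h1
  have h2 := mul_le_mul_of_nonneg_left (h.linOp_barrier hgrad hbar) hβ0
  have h3 := mul_le_mul_of_nonneg_left h.lam_le_sum (by positivity : 0 ≤ a / 2)
  have h4 : 0 ≤ ∑ i ∈ Finset.univ.erase o, (lam i)⁻¹ *
      (fderiv ℝ (fun y => β * φ y) x (e i) + a * hess u x (e i) (∇ u x)) ^ 2 / 2 :=
    Finset.sum_nonneg fun i _ =>
      div_nonneg (mul_nonneg (inv_pos.2 (h.pos i)).le (sq_nonneg _)) (by norm_num)
  have h5 : a / 2 * lam o = C * lam o + lam o := by rw [ha]; ring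
  have h6 : β * ∑ i, (lam i)⁻¹ = C * ∑ i, (lam i)⁻¹ + 2 * a * M ^ 3 * ∑ i, (lam i)⁻¹ := by
    rw [hβ]; ring
  rw [← hC] at h1
  have h7 : β * (1 + M * k) = C + 2 * a * M ^ 3 + β * (M * k) := by rw [hβ]; ring
  linarith

/-- The part of a leftover square that is used against the cut-off function: here `τ p` comes from
`τ log η`, while `c₁` and `a c₂` come from the barrier and from `a |Du|² / 2`. Only the fraction `θ`
of the square is used, so small that the resulting term of first order in the eigenvalue `l` is at
most `l / 2`. -/
theorem leftover_square {θ τ a M l p c₁ c₂ : ℝ} (hM : 1 ≤ M) (ha : 1 ≤ a)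
    (hθ : θ = 1 / (4 * a ^ 2 * M ^ 2)) (hτ : θ * τ = 8) (hl : 0 < l) (h₁ : |c₁| ≤ 1)
    (h₂ : |c₂| ≤ M * l + M ^ 2) :
    2 * τ * (l⁻¹ * p ^ 2) - ((1 + M ^ 2) * l⁻¹ + l / 2) ≤
      l⁻¹ * (τ * p + c₁ + a * c₂) ^ 2 / 2 := by
  have hM0 : 0 < M := by linarith
  have ha0 : 0 < a := by linarith
  have hθ0 : 0 < θ := by rw [hθ]; positivity
  have hθ1 : θ ≤ 1 := by
    rw [hθ, div_le_one (by positivity)]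
    nlinarith [one_le_pow₀ hM (n := 2), one_le_pow₀ ha (n := 2)]
  have f4 : c₁ ^ 2 ≤ 1 := by rw [← sq_abs]; exact pow_le_one₀ (abs_nonneg _) h₁
  have f5 : c₂ ^ 2 ≤ 2 * M ^ 2 * l ^ 2 + 2 * M ^ 4 := by
    rw [← sq_abs]
    calc |c₂| ^ 2 ≤ (M * l + M ^ 2) ^ 2 := by gcongr
      _ ≤ _ := by nlinarith [sq_nonneg (M * l - M ^ 2)]
  have f6 : θ * ((τ * p) ^ 2 / 2 - (c₁ + a * c₂) ^ 2) ≤ (τ * p + c₁ + a * c₂) ^ 2 := by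
    have g1 : (τ * p) ^ 2 / 2 - (c₁ + a * c₂) ^ 2 ≤ (τ * p + c₁ + a * c₂) ^ 2 := by
      nlinarith [sq_nonneg (τ * p + 2 * (c₁ + a * c₂))]
    have g2 := mul_le_mul_of_nonneg_left g1 hθ0.le
    have g3 := mul_le_mul_of_nonneg_right hθ1 (sq_nonneg (τ * p + c₁ + a * c₂))
    linarith
  have f7 : (c₁ + a * c₂) ^ 2 ≤ 2 + a ^ 2 * (4 * M ^ 2 * l ^ 2 + 4 * M ^ 4) := by
    have g1 := mul_le_mul_of_nonneg_left f5 (sq_nonneg a)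
    have g2 : (c₁ + a * c₂) ^ 2 ≤ 2 * c₁ ^ 2 + 2 * (a ^ 2 * c₂ ^ 2) := by
      have := sq_nonneg (c₁ - a * c₂)
      nlinarith
    linarith
  have f8 : θ * (a ^ 2 * (4 * M ^ 2 * l ^ 2 + 4 * M ^ 4)) = l ^ 2 + M ^ 2 := by
    rw [hθ]; field_simp
  have f9 := mul_le_mul_of_nonneg_left f7 hθ0.le
  have f10 : θ * ((τ * p) ^ 2 / 2) = 4 * τ * p ^ 2 := by
    have : θ * ((τ * p) ^ 2 / 2) = (θ * τ) * τ * p ^ 2 / 2 := by ring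
    rw [this, hτ]; ring
  have f11 : 4 * τ * p ^ 2 - (2 + l ^ 2 + M ^ 2) ≤ (τ * p + c₁ + a * c₂) ^ 2 := by
    linarith
  have f12 := mul_le_mul_of_nonneg_left f11 (inv_pos.2 hl).le
  have f13 : l⁻¹ * (4 * τ * p ^ 2 - (2 + l ^ 2 + M ^ 2)) =
      4 * τ * (l⁻¹ * p ^ 2) - ((2 + M ^ 2) * l⁻¹ + l) := by
    field_simp; ring
  have f14 : 0 ≤ M ^ 2 * l⁻¹ := by positivity
  linarith

/-- The algebra that concludes `exists_bound_at_max_of_cutoff`. -/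
theorem mul_le_of_le_div_add {l t D τ c : ℝ} (hl : 0 < l) (ht : 0 < t) (htD : t ≤ D) (hD : 1 ≤ D)
    (hτ : 0 < τ) (hc : 0 ≤ c) (h : l ≤ τ * (D / t) + 2 * τ * (D ^ 2 / (l * t ^ 2)) + c) :
    t * l ≤ 1 + (2 * τ * D ^ 2 + c) * (D + 2) := by
  have hD0 : 0 < D := by linarith
  set s := t * l with hs
  have hs0 : 0 < s := by positivity
  by_cases hs1 : s ≤ 1
  · have : 0 < (2 * τ * D ^ 2 + c) * (D + 2) := by positivity
    linarith
  have hs1' : 1 < s := not_le.1 hs1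
  have h13 := mul_le_mul_of_nonneg_left h ht.le
  have h14 : t * (τ * (D / t) + 2 * τ * (D ^ 2 / (l * t ^ 2)) + c) =
      τ * D + 2 * τ * D ^ 2 / s + t * c := by
    rw [hs]; field_simp
  have h15 : 2 * τ * D ^ 2 / s ≤ 2 * τ * D ^ 2 := div_le_self (by positivity) hs1'.le
  have h16 : t * c ≤ D * c := by gcongr
  have h19 : τ * D * 1 ≤ τ * D * (2 * D) := by gcongr; linarith
  have h20 : 0 < 2 * τ * D ^ 2 * D := by positivity
  rw [h14] at h13
  linarith

/-- Pogorelov's estimate at a maximum point: `η` is the cut-off function, `φ` a barrier with small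
gradient. Half of the third order terms, of which the fraction `θ` is used, compensates the negative
squares of the logarithmic derivatives of `η` in all directions but the top one, where the factor
`1 / lam o` is favourable. -/
theorem exists_bound_at_max_of_cutoff (n : ℕ) {M : ℝ} (hM : 1 ≤ M) {D : ℝ} (hD : 1 ≤ D) :
    ∃ a τ β k L : ℝ, 0 ≤ a ∧ 1 ≤ τ ∧ 0 ≤ β ∧ 0 < k ∧
      ∀ (A : Eu n × ℝ × Eu n → Bil n) (b : Eu n × ℝ × Eu n → ℝ)
      (u : Eu n → ℝ) (x : Eu n) (e : OrthonormalBasis (Fin n) ℝ (Eu n)) (lam : Fin n → ℝ)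
      (o : Fin n) (φ η : Eu n → ℝ),
      EigenPoint A b u M x e lam o → ContDiffAt ℝ 2 φ x → ‖∇ φ x‖ ≤ k →
      (∀ ξ : Eu n, ‖ξ‖ = 1 → 1 ≤ hess φ x ξ ξ - fderiv ℝ A (jet u x) (0, 0, ∇ φ x) ξ ξ) →
      ContDiffAt ℝ 2 η x → 0 < η x → η x ≤ D → ‖∇ η x‖ ≤ D →
      -(D * (1 + η x * ∑ i, (lam i)⁻¹ + ∑ i, (lam i)⁻¹ * |fderiv ℝ η x (e i)|)) ≤
        linOp A b u x e lam η →
      IsLocalMax (fun y => (τ * Real.log (η y) + β * φ y) +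
        (Real.log (augHess A u y (e o) (e o)) + a * (‖∇ u y‖ ^ 2 / 2))) x →
      η x * lam o ≤ L := by
  have hM0 : 0 < M := by linarith
  have hD0 : 0 < D := by linarith
  set C : ℝ := 232 * (n + 1) * M ^ 4 with hC
  have hC0 : 0 ≤ C := by positivity
  set a : ℝ := 2 * C + 3 with ha
  have ha0 : 1 ≤ a := by linarith
  have ha0' : 0 < a := by linarith
  set θ : ℝ := 1 / (4 * a ^ 2 * M ^ 2) with hθ
  have hθ0 : 0 < θ := by positivity
  have hθ1 : θ ≤ 1 := by
    rw [hθ, div_le_one (by positivity)]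
    nlinarith [one_le_pow₀ hM (n := 2), one_le_pow₀ ha0 (n := 2)]
  set τ : ℝ := 8 / θ with hτ
  have hτθ : θ * τ = 8 := by rw [hτ]; field_simp
  have hτ1 : 1 ≤ τ := by rw [hτ, le_div_iff₀ hθ0]; linarith
  set β : ℝ := τ * (D + D ^ 2) + M ^ 2 + C + 2 * a * M ^ 3 + 1 with hβ
  have hβ0 : 0 < β := by positivity
  -- the gradient of the barrier is so small that `β D φ` is bounded by one
  set k : ℝ := 1 / β with hk
  have hk0 : 0 < k := by positivity
  have hβk : β * k = 1 := by rw [hk]; field_simp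
  set L : ℝ := 2 * τ * D ^ 2 + C + 2 * a * M ^ 3 + M with hL
  have hL0 : 0 < L := by positivity
  refine ⟨a, τ, β, k, 1 + L * (D + 2), ha0'.le, hτ1, hβ0.le, hk0,
    fun A b u x e lam o φ η h hφ hgrad hbar hη hη0 hηD hηg hLη hmax => ?_⟩
  have hlog : ContDiffAt ℝ 2 (fun y => Real.log (η y)) x := hη.log hη0.ne'
  have hτlog : ContDiffAt ℝ 2 (fun y => τ * Real.log (η y)) x := contDiffAt_const.mul hlog
  have hβφ : ContDiffAt ℝ 2 (fun y => β * φ y) x := contDiffAt_const.mul hφ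
  have h1 := h.max_inequality (hτlog.add hβφ) ha0'.le hmax
  rw [linOp_add hτlog hβφ, linOp_const_mul hφ, linOp_const_mul hlog, ← hC] at h1
  have h2 := mul_le_mul_of_nonneg_left (h.linOp_barrier hgrad hbar) hβ0.le
  have hl0 : 0 < lam o := h.pos o
  set T := ∑ i, (lam i)⁻¹ with hT
  have hT0 : 0 ≤ T := h.sum_inv_nonneg
  set p : Fin n → ℝ := fun i => fderiv ℝ η x (e i) / η x with hp
  set Q : Fin n → ℝ := fun i => (lam i)⁻¹ * p i ^ 2 with hQ
  have h3 : -(D / η x) - (D + D ^ 2) * T - 2 * ∑ i, Q i ≤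
      linOp A b u x e lam fun y => Real.log (η y) := h.linOp_log_cutoff hη hη0 hLη
  -- the squares that are left from the third order terms
  have h4 : 2 * τ * ∑ i ∈ Finset.univ.erase o, Q i - (1 + M ^ 2) * T - (∑ i, lam i) / 2 ≤
      ∑ i ∈ Finset.univ.erase o, (lam i)⁻¹ *
        (fderiv ℝ (fun y => τ * Real.log (η y) + β * φ y) x (e i) +
          a * hess u x (e i) (∇ u x)) ^ 2 / 2 := by
    have e1 : ∀ i, 2 * τ * Q i - ((1 + M ^ 2) * (lam i)⁻¹ + lam i / 2) ≤ (lam i)⁻¹ *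
        (fderiv ℝ (fun y => τ * Real.log (η y) + β * φ y) x (e i) +
          a * hess u x (e i) (∇ u x)) ^ 2 / 2 := by
      intro i
      have hli := h.pos i
      have f1 : fderiv ℝ (fun y => τ * Real.log (η y) + β * φ y) x (e i) =
          τ * p i + β * fderiv ℝ φ x (e i) := by
        rw [fderiv_fun_add (hτlog.differentiableAt (by norm_num))
          (hβφ.differentiableAt (by norm_num)),
          fderiv_const_mul (hlog.differentiableAt (by norm_num)),
          fderiv_const_mul (hφ.differentiableAt (by norm_num))]
        simp only [add_apply, smul_apply, smul_eq_mul]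
        rw [(fderiv_log hη hη0.ne' _).1]
      rw [f1]
      have f2 : |β * fderiv ℝ φ x (e i)| ≤ 1 := by
        rw [abs_mul, abs_of_pos hβ0, ← inner_grad]
        have := abs_real_inner_le_norm (∇ φ x) (e i)
        have hn : ‖(e i : Eu n)‖ = 1 := by simp
        rw [hn, mul_one] at this
        calc _ ≤ β * k := by gcongr; exact this.trans hgrad
          _ = 1 := hβk
      have f3 : |hess u x (e i) (∇ u x)| ≤ M * lam i + M ^ 2 := by
        have hn : ‖(e i : Eu n)‖ = 1 := by simp
        have hw := h.norm_augHess_eigen i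
        rw [EigenPoint.hess_eq A]
        have g1 : ‖(augHess A u x + A (jet u x)) (e i)‖ ≤ lam i + M := by
          refine (norm_add_le _ _).trans (add_le_add hw ?_)
          refine ((A (jet u x)).le_opNorm _).trans ?_
          rw [hn, mul_one]; exact h.bound.A0
        refine (((augHess A u x + A (jet u x)) (e i)).le_opNorm _).trans ?_
        calc _ ≤ (lam i + M) * M := by gcongr; exact h.bound.grad
          _ = _ := by ring
      exact leftover_square hM ha0 hθ hτθ hli f2 f3
    have e2 := Finset.sum_le_sum fun i (_ : i ∈ Finset.univ.erase o) => e1 i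
    rw [Finset.sum_sub_distrib, ← Finset.mul_sum] at e2
    have e3 : ∑ i ∈ Finset.univ.erase o, ((1 + M ^ 2) * (lam i)⁻¹ + lam i / 2) ≤
        ∑ i, ((1 + M ^ 2) * (lam i)⁻¹ + lam i / 2) :=
      Finset.sum_le_sum_of_subset_of_nonneg (Finset.erase_subset _ _) fun i _ _ => by
        have := h.pos i
        positivity
    rw [Finset.sum_add_distrib (s := Finset.univ), ← Finset.mul_sum, ← Finset.sum_div] at e3
    linarith
  have h5 : ∑ i, Q i = Q o + ∑ i ∈ Finset.univ.erase o, Q i :=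
    (Finset.add_sum_erase _ _ (Finset.mem_univ o)).symm
  have h6 : Q o ≤ D ^ 2 / (lam o * η x ^ 2) := by
    have e1 : |fderiv ℝ η x (e o)| ≤ D := by
      rw [← inner_grad]
      refine (abs_real_inner_le_norm _ _).trans ?_
      simpa using hηg
    have e2 : fderiv ℝ η x (e o) ^ 2 ≤ D ^ 2 := by rw [← sq_abs]; gcongr
    have e3 : Q o = fderiv ℝ η x (e o) ^ 2 / (lam o * η x ^ 2) := by
      simp only [hQ, hp]; field_simp
    rw [e3]; gcongr
  have hτ0 : 0 < τ := by linarith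
  have h3' := mul_le_mul_of_nonneg_left h3 hτ0.le
  have h6' := mul_le_mul_of_nonneg_left h6 (by positivity : 0 ≤ 2 * τ)
  have h7 := h.lam_le_sum
  have h8 : (C + 1) * lam o ≤ (C + 1) * ∑ i, lam i := by gcongr
  have h9 : a / 2 * ∑ i, lam i = (C + 1) * ∑ i, lam i + (∑ i, lam i) / 2 := by rw [ha]; ring
  have h10 : β * T = τ * (D + D ^ 2) * T + M ^ 2 * T + C * T + 2 * a * M ^ 3 * T + T := by
    rw [hβ]; ring
  have h11 : β * (T - M * k) = β * T - M := by
    have : β * (T - M * k) = β * T - (β * k) * M := by ring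
    rw [this, hβk, one_mul]
  have h12 : lam o ≤
      τ * (D / η x) + 2 * τ * (D ^ 2 / (lam o * η x ^ 2)) + C + 2 * a * M ^ 3 + M := by
    rw [h11] at h2
    rw [h5] at h3'
    linarith
  have h13 := mul_le_of_le_div_add (c := C + 2 * a * M ^ 3 + M) hl0 hη0 hηD hD hτ0
    (by positivity) (by linarith)
  have h14 : 2 * τ * D ^ 2 + (C + 2 * a * M ^ 3 + M) = L := by rw [hL]; ring
  rwa [h14] at h13

/-! ### Maximum principles -/

/-- A continuous function on a relatively compact set lies below `m` or attains its maximum, if it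
lies below `m` near the points of the closure that are not in the set. -/
theorem lt_or_exists_max {X : Type*} [TopologicalSpace X] {T : Set X} {f : X → ℝ}
    (hc : IsCompact (closure T)) (hf : ContinuousOn f T) (m : ℝ)
    (hbd : ∀ p ∈ closure T \ T, ∀ᶠ q in 𝓝[T] p, f q < m) :
    (∀ p ∈ T, f p < m) ∨ ∃ p ∈ T, ∀ q ∈ T, f q ≤ f p := by
  by_cases hne : ∀ p ∈ T, f p < m
  · exact Or.inl hne
  push Not at hne
  obtain ⟨p₀, hp₀, hp₀m⟩ := hne
  right
  set K : Set X := {p | p ∈ T ∧ m ≤ f p} with hK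
  have hKT : K ⊆ T := fun p hp => hp.1
  have hKc : IsClosed K := by
    rw [← closure_subset_iff_isClosed]
    intro p hp
    have hpT : p ∈ closure T := closure_mono hKT hp
    have : (𝓝[K] p).NeBot := mem_closure_iff_nhdsWithin_neBot.1 hp
    by_cases hT : p ∈ T
    · refine ⟨hT, ?_⟩
      have h1 : Filter.Tendsto f (𝓝[K] p) (𝓝 (f p)) := (hf p hT).mono_left (nhdsWithin_mono p hKT)
      exact ge_of_tendsto h1 (Filter.eventually_of_mem self_mem_nhdsWithin fun q hq => hq.2)
    · have h1 := (hbd p ⟨hpT, hT⟩).filter_mono (nhdsWithin_mono p hKT)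
      have h2 : ∀ᶠ q in 𝓝[K] p, m ≤ f q :=
        Filter.eventually_of_mem self_mem_nhdsWithin fun q hq => hq.2
      obtain ⟨q, h3, h4⟩ := (h1.and h2).exists
      linarith
  have hKcomp : IsCompact K := hc.of_isClosed_subset hKc (hKT.trans subset_closure)
  obtain ⟨p, hp, hmax⟩ := hKcomp.exists_isMaxOn ⟨p₀, hp₀, hp₀m⟩ (hf.mono hKT)
  refine ⟨p, hp.1, fun q hq => ?_⟩
  by_cases hq' : m ≤ f q
  · exact hmax ⟨hq, hq'⟩
  · linarith [hp.2]

/-- `u` is an elliptic solution of `log det [D²u - A(·,u,Du)] = b(·,u,Du)` in `N`, with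
coefficients that are regular and bounded by `M` along the jets of `u`. -/
structure SolutionOn (A : Eu n × ℝ × Eu n → Bil n) (b : Eu n × ℝ × Eu n → ℝ) (M : ℝ)
    (N : Set (Eu n)) (u : Eu n → ℝ) : Prop where
  isOpen : IsOpen N
  u4 : ∀ x ∈ N, ContDiffAt ℝ 4 u x
  A2 : ∀ x ∈ N, ContDiffAt ℝ 2 A (jet u x)
  b2 : ∀ x ∈ N, ContDiffAt ℝ 2 b (jet u x)
  symm : ∀ x ∈ N, ∀ᶠ q in 𝓝 (jet u x), ∀ ξ η, A q ξ η = A q η ξ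
  eqn : ∀ x ∈ N, Real.log (toMat (augHess A u x)).det = b (jet u x)
  pos : ∀ x ∈ N, ∀ ξ : Eu n, ξ ≠ 0 → 0 < augHess A u x ξ ξ
  regular : ∀ x ∈ N, ∀ ξ η : Eu n, inner ℝ ξ η = 0 →
    0 ≤ fderiv ℝ (fderiv ℝ A) (jet u x) (0, 0, η) (0, 0, η) ξ ξ
  bound : ∀ x ∈ N, CoeffBound A b M (jet u x)

namespace SolutionOn

variable {A : Eu n × ℝ × Eu n → Bil n} {b : Eu n × ℝ × Eu n → ℝ} {u : Eu n → ℝ} {M : ℝ}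
  {N : Set (Eu n)}

theorem mono (h : SolutionOn A b M N u) {N' : Set (Eu n)} (hN : IsOpen N') (hs : N' ⊆ N) :
    SolutionOn A b M N' u where
  isOpen := hN
  u4 x hx := h.u4 x (hs hx)
  A2 x hx := h.A2 x (hs hx)
  b2 x hx := h.b2 x (hs hx)
  symm x hx := h.symm x (hs hx)
  eqn x hx := h.eqn x (hs hx)
  pos x hx := h.pos x (hs hx)
  regular x hx := h.regular x (hs hx)
  bound x hx := h.bound x (hs hx)

theorem jet2 (h : SolutionOn A b M N u) {x : Eu n} (hx : x ∈ N) : ContDiffAt ℝ 2 (jet u) x :=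
  (contDiffAt_jet (k := 3) (m := 4) (h.u4 x hx) (by norm_num)).of_le (by norm_num)

theorem contDiffAt_augHess (h : SolutionOn A b M N u) {x : Eu n} (hx : x ∈ N) :
    ContDiffAt ℝ 2 (augHess A u) x :=
  (contDiffAt_hess (h.u4 x hx)).sub ((h.A2 x hx).comp x (h.jet2 hx))

theorem continuousOn_testFunction (h : SolutionOn A b M N u) {ψ : Eu n → ℝ} {a : ℝ}
    (hψ : ContinuousOn ψ N) :
    ContinuousOn (fun p : Eu n × Eu n => ψ p.1 + (Real.log (augHess A u p.1 p.2 p.2) +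
      a * (‖∇ u p.1‖ ^ 2 / 2))) (N ×ˢ Metric.sphere 0 1) := by
  have hfst : MapsTo Prod.fst (N ×ˢ Metric.sphere (0 : Eu n) 1) N := fun p hp => hp.1
  have hW : ContinuousOn (augHess A u) N := fun x hx =>
    (h.contDiffAt_augHess hx).continuousAt.continuousWithinAt
  have hG : ContinuousOn (fun x => ∇ u x) N := fun x hx =>
    (h.jet2 hx).continuousAt.snd.snd.continuousWithinAt
  have hW' : ContinuousOn (fun p : Eu n × Eu n => augHess A u p.1 p.2 p.2)
      (N ×ˢ Metric.sphere 0 1) :=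
    ((hW.comp continuousOn_fst hfst).clm_apply continuousOn_snd).clm_apply continuousOn_snd
  refine (hψ.comp continuousOn_fst hfst).add ((hW'.log fun p hp => ?_).add ?_)
  · have : p.2 ≠ 0 := by
      have := hp.2
      rintro h0
      rw [h0] at this
      simp at this
    exact (h.pos p.1 hp.1 p.2 this).ne'
  · exact continuousOn_const.mul (((hG.comp continuousOn_fst hfst).norm.pow 2).div_const 2)

/-- Either the test function `ψ + log w(ξ, ξ) + a |Du|² / 2` lies below its boundary bound, or it
has an interior maximum. At the maximum point `ξ` may be taken to be the top vector of an eigenbasis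
of `w`; the alternative `lam o < 1` needs no estimate. -/
theorem testFunction_max (h : SolutionOn A b M N u) (hM : 1 ≤ M) (hN : Bornology.IsBounded N)
    {ψ : Eu n → ℝ} {a m : ℝ} (hψ : ContinuousOn ψ N)
    (hbd : ∀ x ∈ closure N \ N, ∀ᶠ y in 𝓝[N] x, ∀ ξ : Eu n, ‖ξ‖ = 1 →
      ψ y + (Real.log (augHess A u y ξ ξ) + a * (‖∇ u y‖ ^ 2 / 2)) < m) :
    (∀ y ∈ N, ∀ ξ : Eu n, ‖ξ‖ = 1 →
      ψ y + (Real.log (augHess A u y ξ ξ) + a * (‖∇ u y‖ ^ 2 / 2)) < m) ∨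
    ∃ x ∈ N, ∃ (e : OrthonormalBasis (Fin n) ℝ (Eu n)) (lam : Fin n → ℝ) (o : Fin n),
      0 < lam o ∧ (1 ≤ lam o → EigenPoint A b u M x e lam o) ∧
      IsLocalMax (fun y => ψ y + (Real.log (augHess A u y (e o) (e o)) +
        a * (‖∇ u y‖ ^ 2 / 2))) x ∧
      ∀ y ∈ N, ∀ ξ : Eu n, ‖ξ‖ = 1 →
        ψ y + (Real.log (augHess A u y ξ ξ) + a * (‖∇ u y‖ ^ 2 / 2)) ≤
          ψ x + (Real.log (lam o) + a * (‖∇ u x‖ ^ 2 / 2)) := by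
  set f : Eu n × Eu n → ℝ := fun p => ψ p.1 + (Real.log (augHess A u p.1 p.2 p.2) +
      a * (‖∇ u p.1‖ ^ 2 / 2)) with hf
  have hcl : closure (N ×ˢ Metric.sphere (0 : Eu n) 1) = closure N ×ˢ Metric.sphere 0 1 := by
    rw [closure_prod_eq, Metric.isClosed_sphere.closure_eq]
  have hcomp : IsCompact (closure (N ×ˢ Metric.sphere (0 : Eu n) 1)) := by
    rw [hcl]
    exact (Metric.isCompact_of_isClosed_isBounded isClosed_closure hN.closure).prod
      (isCompact_sphere _ _)
  rcases lt_or_exists_max hcomp (h.continuousOn_testFunction hψ) m (fun p hp => by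
    rw [hcl] at hp
    have hp1 : p.1 ∈ closure N \ N := ⟨hp.1.1, fun hN' => hp.2 ⟨hN', hp.1.2⟩⟩
    have h1 : Filter.Tendsto Prod.fst (𝓝[N ×ˢ Metric.sphere (0 : Eu n) 1] p) (𝓝[N] p.1) :=
      tendsto_nhdsWithin_iff.2 ⟨continuous_fst.continuousAt.tendsto.mono_left nhdsWithin_le_nhds,
        Filter.eventually_of_mem self_mem_nhdsWithin fun q hq => hq.1⟩
    filter_upwards [h1.eventually (hbd p.1 hp1), self_mem_nhdsWithin] with q hq hqT
    exact hq q.2 (by simpa using hqT.2)) with hlt | ⟨p, hp, hmax⟩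
  · exact Or.inl fun y hy ξ hξ => hlt (y, ξ) ⟨hy, by simpa using hξ⟩
  right
  obtain ⟨x, ξ₀⟩ := p
  have hx : x ∈ N := hp.1
  have hξ₀ : ‖ξ₀‖ = 1 := by simpa using hp.2
  have hsymm : ∀ ξ η, augHess A u x ξ η = augHess A u x η ξ := by
    intro ξ η
    simp only [augHess, sub_apply]
    rw [hess_symm ((h.u4 x hx).of_le (by norm_num)), (h.symm x hx).self_of_nhds]
  obtain ⟨e, lam, hdiag⟩ := exists_eigenbasis (augHess A u x) hsymm
  have hee : ∀ i, augHess A u x (e i) (e i) = lam i := fun i => by rw [hdiag]; simp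
  have hne : ∀ i, (e i : Eu n) ≠ 0 := fun i => e.orthonormal.ne_zero i
  have hpos : ∀ i, 0 < lam i := fun i => by rw [← hee i]; exact h.pos x hx _ (hne i)
  have hnonempty : Nonempty (Fin n) := by
    rw [← not_isEmpty_iff]
    intro hempty
    have : ξ₀ = 0 := by ext i; exact hempty.elim i
    rw [this] at hξ₀
    simp at hξ₀
  obtain ⟨o, ho⟩ := Finite.exists_max lam
  have hξle : augHess A u x ξ₀ ξ₀ ≤ lam o := by
    have h1 : augHess A u x ξ₀ ξ₀ = ∑ i, lam i * inner ℝ (e i) ξ₀ ^ 2 := by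
      conv_lhs => enter [1]; rw [← e.sum_repr' ξ₀]
      simp only [map_sum, map_smul, sum_apply, smul_apply, smul_eq_mul, hdiag]
      exact Finset.sum_congr rfl fun i _ => by ring
    have h2 := e.sum_sq_norm_inner_right ξ₀
    simp only [Real.norm_eq_abs, sq_abs, hξ₀] at h2
    rw [h1]
    calc _ ≤ ∑ i, lam o * inner ℝ (e i) ξ₀ ^ 2 :=
          Finset.sum_le_sum fun i _ => mul_le_mul_of_nonneg_right (ho i) (sq_nonneg _)
      _ = lam o := by rw [← Finset.mul_sum, h2]; norm_num
  have htop : ∀ y ∈ N, ∀ ξ : Eu n, ‖ξ‖ = 1 → f (y, ξ) ≤ f (x, e o) := by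
    intro y hy ξ hξ
    refine (hmax (y, ξ) ⟨hy, by simpa using hξ⟩).trans ?_
    simp only [hf, hee]
    have hξ0 : ξ₀ ≠ 0 := by rintro rfl; simp at hξ₀
    have := Real.log_le_log (h.pos x hx ξ₀ hξ0) hξle
    linarith
  refine ⟨x, hx, e, lam, o, hpos o, fun hone => ?_, ?_, fun y hy ξ hξ => ?_⟩
  · exact ⟨h.u4 x hx, h.A2 x hx, h.b2 x hx, h.symm x hx,
      Filter.eventually_of_mem (h.isOpen.mem_nhds hx) h.eqn, hdiag, hpos, ho, hone,
      h.regular x hx, hM, h.bound x hx⟩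
  · filter_upwards [h.isOpen.mem_nhds hx] with y hy
    exact htop y hy (e o) (by simp)
  · have := htop y hy ξ hξ
    simpa only [hf, hee] using this

theorem half_sq_grad_le (h : SolutionOn A b M N u) {x : Eu n} (hx : x ∈ N) :
    ‖∇ u x‖ ^ 2 / 2 ≤ M ^ 2 := by
  have : ‖∇ u x‖ ^ 2 ≤ M ^ 2 := by
    gcongr
    exact (h.bound x hx).grad
  nlinarith [sq_nonneg ‖∇ u x‖]

theorem augHess_le (h : SolutionOn A b M N u) {x : Eu n} (hx : x ∈ N) {S : ℝ}
    (hS : ‖hess u x‖ ≤ S) {ξ : Eu n} (hξ : ‖ξ‖ = 1) : augHess A u x ξ ξ ≤ S + M := by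
  refine (le_of_abs_le (abs_bil_le _ _ _ hξ hξ)).trans ?_
  exact (norm_sub_le _ _).trans (add_le_add hS (h.bound x hx).A0)

end SolutionOn

/-- Second derivative bound in terms of boundary values, in the presence of a barrier. -/
theorem exists_bound_of_barrier (n : ℕ) {M : ℝ} (hM : 1 ≤ M) (k : ℝ) :
    ∃ C : ℝ, 0 < C ∧ ∀ (A : Eu n × ℝ × Eu n → Bil n) (b : Eu n × ℝ × Eu n → ℝ) (N : Set (Eu n))
      (u φ : Eu n → ℝ) (S : ℝ), SolutionOn A b M N u → Bornology.IsBounded N → 0 ≤ S →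
      (∀ x ∈ N, ContDiffAt ℝ 2 φ x ∧ |φ x| ≤ k ∧ ‖∇ φ x‖ ≤ k ∧ ∀ ξ : Eu n, ‖ξ‖ = 1 →
        1 ≤ hess φ x ξ ξ - fderiv ℝ A (jet u x) (0, 0, ∇ φ x) ξ ξ) →
      (∀ x ∈ closure N \ N, ∀ᶠ y in 𝓝[N] x, ‖hess u y‖ ≤ S) →
      ∀ x ∈ N, ∀ ξ : Eu n, ‖ξ‖ = 1 → augHess A u x ξ ξ ≤ C * (1 + S) := by
  obtain ⟨a, β, L, ha, hβ, H⟩ := exists_bound_at_max_of_barrier n hM k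
  set E := Real.exp (2 * (β * k) + a * M ^ 2 + 1) with hE
  refine ⟨E * (M + 1 + max 1 L), by positivity, fun A b N u φ S h hN hS hφ hbd x hx ξ hξ => ?_⟩
  have hβφ : ∀ y ∈ N, |β * φ y| ≤ β * k := fun y hy => by
    rw [abs_mul, abs_of_nonneg hβ]
    exact mul_le_mul_of_nonneg_left (hφ y hy).2.1 hβ
  have hag : ∀ y ∈ N, a * (‖∇ u y‖ ^ 2 / 2) ≤ a * M ^ 2 := fun y hy =>
    mul_le_mul_of_nonneg_left (h.half_sq_grad_le hy) ha
  have hag0 : 0 ≤ a * (‖∇ u x‖ ^ 2 / 2) := by positivity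
  have hξ0 : ξ ≠ 0 := by rintro rfl; simp at hξ
  have hwpos := h.pos x hx ξ hξ0
  have hφx := neg_le_of_abs_le (hβφ x hx)
  have key : ∀ t : ℝ, 0 < t → t ≤ (M + 1 + max 1 L) * (1 + S) →
      Real.log (augHess A u x ξ ξ) ≤ 2 * (β * k) + a * M ^ 2 + 1 + Real.log t →
      augHess A u x ξ ξ ≤ E * (M + 1 + max 1 L) * (1 + S) := by
    intro t ht htle hle
    have h1 := Real.exp_le_exp.2 hle
    rw [Real.exp_log hwpos, Real.exp_add, Real.exp_log ht] at h1
    calc _ ≤ E * t := h1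
      _ ≤ E * ((M + 1 + max 1 L) * (1 + S)) := by gcongr
      _ = _ := by ring
  have hmax1 : 1 ≤ max 1 L := le_max_left _ _
  rcases h.testFunction_max (ψ := fun y => β * φ y) (a := a)
    (m := β * k + Real.log (S + M) + a * M ^ 2 + 1) hM hN
    (fun y hy => (contDiffAt_const.mul (hφ y hy).1).continuousAt.continuousWithinAt)
    (fun p hp => by
      filter_upwards [hbd p hp, self_mem_nhdsWithin] with y hy hyN ζ hζ
      have hζ0 : ζ ≠ 0 := by rintro rfl; simp at hζ
      have h1 := Real.log_le_log (h.pos y hyN ζ hζ0) (h.augHess_le hyN hy hζ)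
      have h2 := hag y hyN
      have h3 := le_of_abs_le (hβφ y hyN)
      linarith) with hlt | ⟨p, hp, e, lam, o, hlam, hE', hmax, htop⟩
  · have h1 := hlt x hx ξ hξ
    refine key (S + M) (by linarith) ?_ (by linarith)
    nlinarith
  · have h1 := htop x hx ξ hξ
    have h2 := hag p hp
    have h3 := le_of_abs_le (hβφ p hp)
    have h4 : lam o ≤ max 1 L := by
      by_cases hone : 1 ≤ lam o
      · exact (H A b u p e lam o φ (hE' hone) (hφ p hp).1 (hφ p hp).2.2.1 (hφ p hp).2.2.2
          hmax).trans (le_max_right _ _)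
      · exact (not_le.1 hone).le.trans (le_max_left _ _)
    refine key (lam o) hlam (h4.trans ?_) (by linarith)
    nlinarith

/-- Pogorelov's interior estimate for a solution in `N` with a cut-off function `η` vanishing on the
boundary of `N`. The constant `C` does not depend on the bound `S`, which only serves to show that
the test function attains its maximum. -/
theorem exists_bound_of_cutoff (n : ℕ) {M : ℝ} (hM : 1 ≤ M) {D : ℝ} (hD : 1 ≤ D) :
    ∃ k τ C : ℝ, 0 < k ∧ 1 ≤ τ ∧
      ∀ (A : Eu n × ℝ × Eu n → Bil n) (b : Eu n × ℝ × Eu n → ℝ) (N : Set (Eu n))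
      (u φ η : Eu n → ℝ) (S : ℝ), SolutionOn A b M N u → Bornology.IsBounded N →
      (∀ x ∈ N, ContDiffAt ℝ 2 φ x ∧ |φ x| ≤ 1 ∧ ‖∇ φ x‖ ≤ k ∧ ∀ ξ : Eu n, ‖ξ‖ = 1 →
        1 ≤ hess φ x ξ ξ - fderiv ℝ A (jet u x) (0, 0, ∇ φ x) ξ ξ) →
      (∀ x ∈ N, ContDiffAt ℝ 2 η x ∧ 0 < η x ∧ η x ≤ D ∧ ‖∇ η x‖ ≤ D ∧
        ∀ (e : OrthonormalBasis (Fin n) ℝ (Eu n)) (lam : Fin n → ℝ) (o : Fin n),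
        EigenPoint A b u M x e lam o →
        -(D * (1 + η x * ∑ i, (lam i)⁻¹ + ∑ i, (lam i)⁻¹ * |fderiv ℝ η x (e i)|)) ≤
          linOp A b u x e lam η) →
      (∀ x ∈ N, ‖hess u x‖ ≤ S) →
      (∀ x ∈ closure N \ N, Filter.Tendsto η (𝓝[N] x) (𝓝 0)) →
      ∀ x ∈ N, ∀ ξ : Eu n, ‖ξ‖ = 1 → τ * Real.log (η x) + Real.log (augHess A u x ξ ξ) ≤ C := by
  obtain ⟨a, τ, β, k, L, ha, hτ, hβ, hk, H⟩ := exists_bound_at_max_of_cutoff n hM hD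
  have hlogD : 0 ≤ Real.log D := Real.log_nonneg hD
  have hmaxD : 1 ≤ max L D := hD.trans (le_max_right _ _)
  have hlogL : 0 ≤ Real.log (max L D) := Real.log_nonneg hmaxD
  refine ⟨k, τ, 2 * β + a * M ^ 2 + (τ - 1) * Real.log D + Real.log (max L D), hk, hτ,
    fun A b N u φ η S h hN hφ hη hS hbd x hx ξ hξ => ?_⟩
  have hβφ : ∀ y ∈ N, |β * φ y| ≤ β := fun y hy => by
    rw [abs_mul, abs_of_nonneg hβ]
    simpa using mul_le_mul_of_nonneg_left (hφ y hy).2.1 hβ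
  have hag : ∀ y ∈ N, a * (‖∇ u y‖ ^ 2 / 2) ≤ a * M ^ 2 := fun y hy =>
    mul_le_mul_of_nonneg_left (h.half_sq_grad_le hy) ha
  have hag0 : 0 ≤ a * (‖∇ u x‖ ^ 2 / 2) := by positivity
  have haM : 0 ≤ a * M ^ 2 := by positivity
  have hφx := neg_le_of_abs_le (hβφ x hx)
  have hτD : 0 ≤ (τ - 1) * Real.log D := mul_nonneg (by linarith) hlogD
  rcases h.testFunction_max (ψ := fun y => τ * Real.log (η y) + β * φ y) (a := a)
    (m := 0) hM hN
    (fun y hy => (((continuousAt_const.mul ((hη y hy).1.continuousAt.log (hη y hy).2.1.ne')).add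
      (contDiffAt_const.mul (hφ y hy).1).continuousAt)).continuousWithinAt)
    -- at the boundary of `N` the test function tends to `-∞`
    (fun p hp => by
      have h0 : Filter.Tendsto η (𝓝[N] p) (𝓝[>] 0) :=
        tendsto_nhdsWithin_iff.2 ⟨hbd p hp,
          Filter.eventually_of_mem self_mem_nhdsWithin fun y hy => (hη y hy).2.1⟩
      have h1 : Filter.Tendsto (fun y => τ * Real.log (η y)) (𝓝[N] p) Filter.atBot :=
        (Real.tendsto_log_nhdsGT_zero.comp h0).const_mul_atBot (by linarith)
      filter_upwards [h1.eventually_lt_atBot (-(β + Real.log (S + M) + a * M ^ 2)),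
        self_mem_nhdsWithin] with y hy hyN ζ hζ
      have hζ0 : ζ ≠ 0 := by rintro rfl; simp at hζ
      have h1 := Real.log_le_log (h.pos y hyN ζ hζ0) (h.augHess_le hyN (hS y hyN) hζ)
      have h2 := hag y hyN
      have h3 := le_of_abs_le (hβφ y hyN)
      linarith) with hlt | ⟨p, hp, e, lam, o, hlam, hE', hmax, htop⟩
  · have h1 := hlt x hx ξ hξ
    linarith
  · have h1 := htop x hx ξ hξ
    have h2 := hag p hp
    have h3 := le_of_abs_le (hβφ p hp)
    obtain ⟨hη2, hη0, hηD, hηg, hηL⟩ := hη p hp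
    have h4 : η p * lam o ≤ max L D := by
      by_cases hone : 1 ≤ lam o
      · exact (H A b u p e lam o φ η (hE' hone) (hφ p hp).1 (hφ p hp).2.2.1 (hφ p hp).2.2.2
          hη2 hη0 hηD hηg (hηL e lam o (hE' hone)) hmax).trans (le_max_left _ _)
      · have : η p * lam o ≤ η p * 1 := by gcongr; exact (not_le.1 hone).le
        exact (by linarith : η p * lam o ≤ D).trans (le_max_right _ _)
    have h5 := Real.log_le_log (mul_pos hη0 hlam) h4
    rw [Real.log_mul hη0.ne' hlam.ne'] at h5
    have h6 := mul_le_mul_of_nonneg_left (Real.log_le_log hη0 hηD) (by linarith : 0 ≤ τ - 1)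
    linarith

/-! ### Coefficients on compact sets and cut-off functions -/

/-- The coefficients `A` and `b` are smooth, `A` is symmetric and regular, and both are bounded by
`M`, with two derivatives, at the points of `K`. -/
structure RegularOn (A : Eu n × ℝ × Eu n → Bil n) (b : Eu n × ℝ × Eu n → ℝ) (M : ℝ)
    (K : Set (Eu n × ℝ × Eu n)) : Prop where
  A2 : ∀ q ∈ K, ContDiffAt ℝ 2 A q
  b2 : ∀ q ∈ K, ContDiffAt ℝ 2 b q
  symm : ∀ q ∈ K, ∀ᶠ q' in 𝓝 q, ∀ ξ η, A q' ξ η = A q' η ξ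
  regular : ∀ q ∈ K, ∀ ξ η : Eu n, inner ℝ ξ η = 0 →
    0 ≤ fderiv ℝ (fderiv ℝ A) q (0, 0, η) (0, 0, η) ξ ξ
  bound : ∀ q ∈ K, CoeffBound A b M q

theorem hasFDerivAt_fibre (x : Eu n) (z : ℝ) (p : Eu n) :
    HasFDerivAt (fun p : Eu n => ((x, z, p) : Eu n × ℝ × Eu n))
      ((ContinuousLinearMap.inr ℝ (Eu n) (ℝ × Eu n)).comp (ContinuousLinearMap.inr ℝ ℝ (Eu n)))
      p :=
  (hasFDerivAt_const (𝕜 := ℝ) x p).prodMk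
    ((hasFDerivAt_const (𝕜 := ℝ) z p).prodMk (hasFDerivAt_id (𝕜 := ℝ) p))

theorem contDiff_fibre (x : Eu n) (z : ℝ) :
    ContDiff ℝ 2 (fun p : Eu n => ((x, z, p) : Eu n × ℝ × Eu n)) :=
  contDiff_const.prodMk (contDiff_const.prodMk contDiff_id)

/-- The first and second derivatives in `p` alone are those of `A` in the directions `(0, 0, v)`. -/
theorem fderiv_fibre {A : Eu n × ℝ × Eu n → Bil n} {x : Eu n} {z : ℝ} {p : Eu n}
    (hA : ContDiffAt ℝ 2 A (x, z, p)) (ξ v : Eu n) :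
    fderiv ℝ (fun p => A (x, z, p) ξ ξ) p v = fderiv ℝ A (x, z, p) (0, 0, v) ξ ξ ∧
    hess (fun p => A (x, z, p) ξ ξ) p v v =
      fderiv ℝ (fderiv ℝ A) (x, z, p) (0, 0, v) (0, 0, v) ξ ξ := by
  have hA' : ContDiffAt ℝ 2 (fun p => A (x, z, p)) p :=
    ContDiffAt.comp (g := A) p hA (contDiff_fibre x z).contDiffAt
  have hd : fderiv ℝ (fun p : Eu n => ((x, z, p) : Eu n × ℝ × Eu n)) = fun _ =>
      (ContinuousLinearMap.inr ℝ (Eu n) (ℝ × Eu n)).comp (ContinuousLinearMap.inr ℝ ℝ (Eu n)) := by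
    funext p
    exact (hasFDerivAt_fibre x z p).fderiv
  constructor
  · rw [fderiv_bil_apply (H := fun p => A (x, z, p)) (hA'.differentiableAt (by norm_num))]
    have : fderiv ℝ (fun p => A (x, z, p)) p = (fderiv ℝ A (x, z, p)).comp
        (fderiv ℝ (fun p : Eu n => ((x, z, p) : Eu n × ℝ × Eu n)) p) :=
      fderiv_comp (g := A) p (hA.differentiableAt (by norm_num))
        (hasFDerivAt_fibre x z p).differentiableAt
    rw [this, hd]
    rfl
  · unfold hess
    rw [fderiv_fderiv_bil_apply (H := fun p => A (x, z, p)) hA',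
      fderiv_fderiv_comp (f := fun p : Eu n => ((x, z, p) : Eu n × ℝ × Eu n)) hA
        (contDiff_fibre x z).contDiffAt, hd]
    simp

theorem exists_regularOn {Y : Eu n × ℝ × Eu n → Eu n} {Z : Eu n × ℝ × Eu n → ℝ}
    {Γ : Set (Eu n × Eu n × ℝ)} {g : Eu n × Eu n × ℝ → ℝ} (hg : IsGenerating Γ g Y Z)
    {B : Eu n × ℝ × Eu n → ℝ} (hAB : IsRegularData (jetDom Γ g) (genA g Y Z) B)
    {K : Set (Eu n × ℝ × Eu n)} (hK : IsCompact K) (hKU : K ⊆ jetDom Γ g) :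
    ∃ M : ℝ, 1 ≤ M ∧ RegularOn (genA g Y Z) (fun q => Real.log (B q)) M K := by
  set U := jetDom Γ g with hU
  set A := genA g Y Z with hA
  set b : Eu n × ℝ × Eu n → ℝ := fun q => Real.log (B q) with hb
  have hUo : IsOpen U := hg.jet_open
  have hA2 : ContDiffOn ℝ 2 A U := hAB.smoothA
  have hb2 : ContDiffOn ℝ 2 b U := hAB.smoothB.log fun q hq => (hAB.posB q hq).ne'
  have hA2' : ∀ q ∈ U, ContDiffAt ℝ 2 A q := fun q hq => hA2.contDiffAt (hUo.mem_nhds hq)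
  have hb2' : ∀ q ∈ U, ContDiffAt ℝ 2 b q := fun q hq => hb2.contDiffAt (hUo.mem_nhds hq)
  have hbound : ∀ {V : Type} [NormedAddCommGroup V] (f : Eu n × ℝ × Eu n → V),
      (∀ q ∈ U, ContinuousAt f q) → ∃ C, ∀ q ∈ K, ‖f q‖ ≤ C := fun f hf =>
    hK.exists_bound_of_continuousOn fun q hq => (hf q (hKU hq)).continuousWithinAt
  obtain ⟨M1, h1⟩ := hbound (fun q => q.2.1) fun q _ => by fun_prop
  obtain ⟨M2, h2⟩ := hbound (fun q => q.2.2) fun q _ => by fun_prop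
  obtain ⟨M3, h3⟩ := hbound A fun q hq => (hA2' q hq).continuousAt
  obtain ⟨M4, h4⟩ := hbound (fderiv ℝ A) fun q hq =>
    (hA2' q hq).differentiableAt_fderiv.continuousAt
  obtain ⟨M5, h5⟩ := hbound (fderiv ℝ (fderiv ℝ A)) fun q hq =>
    (((hA2' q hq).fderiv_right (m := 1) (by norm_num)).fderiv_right (m := 0)
      (by norm_num)).continuousAt
  obtain ⟨M6, h6⟩ := hbound (fderiv ℝ b) fun q hq =>
    (hb2' q hq).differentiableAt_fderiv.continuousAt
  obtain ⟨M7, h7⟩ := hbound (fderiv ℝ (fderiv ℝ b)) fun q hq =>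
    (((hb2' q hq).fderiv_right (m := 1) (by norm_num)).fderiv_right (m := 0)
      (by norm_num)).continuousAt
  have hsymm : ∀ q ∈ U, ∀ ξ η, A q ξ η = A q η ξ := by
    intro q hq ξ η
    have hmem := (hg.solves q hq).1
    have hg2 : ContDiffAt ℝ 2 (fun x => g (x, Y q, Z q)) q.1 :=
      ContDiffAt.comp (g := g) q.1 (hg.smooth.contDiffAt (hg.dom.1.mem_nhds hmem))
        (contDiffAt_id.prodMk (contDiffAt_const.prodMk contDiffAt_const))
    exact hess_symm hg2 ξ η
  set M := 1 + |M1| + |M2| + |M3| + |M4| + |M5| + |M6| + |M7| with hM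
  have hp1 := abs_nonneg M1
  have hp2 := abs_nonneg M2
  have hp3 := abs_nonneg M3
  have hp4 := abs_nonneg M4
  have hp5 := abs_nonneg M5
  have hp6 := abs_nonneg M6
  have hp7 := abs_nonneg M7
  refine ⟨M, by linarith, fun q hq => hA2' q (hKU hq), fun q hq => hb2' q (hKU hq),
    fun q hq => Filter.eventually_of_mem (hUo.mem_nhds (hKU hq)) hsymm, fun q hq ξ η h0 => ?_,
    fun q hq => ⟨?_, ?_, ?_, ?_, ?_, ?_, ?_⟩⟩
  · have := hAB.regular q (hKU hq) ξ η h0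
    rwa [(fderiv_fibre (hA2' q (hKU hq)) ξ η).2] at this
  · linarith [h1 q hq, le_abs_self M1, Real.norm_eq_abs q.2.1]
  · linarith [h2 q hq, le_abs_self M2]
  · linarith [h3 q hq, le_abs_self M3]
  · linarith [h4 q hq, le_abs_self M4]
  · linarith [h5 q hq, le_abs_self M5]
  · linarith [h6 q hq, le_abs_self M6]
  · linarith [h7 q hq, le_abs_self M7]

theorem RegularOn.solutionOn {A : Eu n × ℝ × Eu n → Bil n} {B : Eu n × ℝ × Eu n → ℝ} {M : ℝ}
    {K : Set (Eu n × ℝ × Eu n)} (h : RegularOn A (fun q => Real.log (B q)) M K)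
    {Ω : Set (Eu n)} {u : Eu n → ℝ} (hΩ : IsOpen Ω) (hu : ContDiffOn ℝ 4 u Ω)
    (hJ : MapsTo (jet u) Ω K) (hs : IsEllipticSolution A B Ω u) :
    SolutionOn A (fun q => Real.log (B q)) M Ω u where
  isOpen := hΩ
  u4 x hx := hu.contDiffAt (hΩ.mem_nhds hx)
  A2 x hx := h.A2 _ (hJ hx)
  b2 x hx := h.b2 _ (hJ hx)
  symm x hx := h.symm _ (hJ hx)
  eqn x hx := by rw [(hs x hx).2]
  pos x hx := (hs x hx).1
  regular x hx := h.regular _ (hJ hx)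
  bound x hx := h.bound _ (hJ hx)

/-- Taylor's formula with a lower bound for the remainder. -/
theorem taylor_lower {f f' f'' : ℝ → ℝ} {c : ℝ} (hc : 0 ≤ c)
    (h1 : ∀ t ∈ Icc (0 : ℝ) 1, HasDerivAt f (f' t) t)
    (h2 : ∀ t ∈ Icc (0 : ℝ) 1, HasDerivAt f' (f'' t) t)
    (h3 : ∀ t ∈ Icc (0 : ℝ) 1, -c ≤ f'' t) : f 0 + f' 0 - c ≤ f 1 := by
  obtain ⟨s, hs, hs'⟩ := exists_hasDerivAt_eq_slope f f' (by norm_num : (0 : ℝ) < 1)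
    (fun t ht => (h1 t ht).continuousAt.continuousWithinAt)
    (fun t ht => h1 t (Ioo_subset_Icc_self ht))
  have hsub : Icc 0 s ⊆ Icc (0 : ℝ) 1 := Icc_subset_Icc_right hs.2.le
  obtain ⟨r, hr, hr'⟩ := exists_hasDerivAt_eq_slope f' f'' hs.1
    (fun t ht => (h2 t (hsub ht)).continuousAt.continuousWithinAt)
    (fun t ht => h2 t (hsub (Ioo_subset_Icc_self ht)))
  have h4 := h3 r (hsub (Ioo_subset_Icc_self hr))
  rw [eq_div_iff (by linarith [hs.1])] at hr'
  have h5 : -c * s ≤ f'' r * (s - 0) := by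
    rw [sub_zero]; exact mul_le_mul_of_nonneg_right h4 hs.1.le
  have h6 : c * s ≤ c * 1 := mul_le_mul_of_nonneg_left hs.2.le hc
  rw [sub_zero, div_one] at hs'
  linarith

section Cutoff

variable {A : Eu n × ℝ × Eu n → Bil n} {b : Eu n × ℝ × Eu n → ℝ} {M : ℝ}
  {K : Set (Eu n × ℝ × Eu n)}

theorem line_bil {q v : Eu n × ℝ × Eu n} {t : ℝ} (hA : ContDiffAt ℝ 2 A (q + t • v)) (ξ : Eu n) :
    HasDerivAt (fun s : ℝ => A (q + s • v) ξ ξ) (fderiv ℝ A (q + t • v) v ξ ξ) t ∧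
    HasDerivAt (fun s : ℝ => fderiv ℝ A (q + s • v) v ξ ξ)
      (fderiv ℝ (fderiv ℝ A) (q + t • v) v v ξ ξ) t := by
  have hl : HasDerivAt (fun s : ℝ => q + s • v) v t := by
    simpa using ((hasDerivAt_id t).smul_const v).const_add q
  constructor
  · have h1 := (hA.differentiableAt (by norm_num)).hasFDerivAt.comp_hasDerivAt t hl
    have := (h1.clm_apply (hasDerivAt_const t ξ)).clm_apply (hasDerivAt_const t ξ)
    simpa using this
  · have h1 := (hasFDerivAt_fderiv_apply hA v).comp_hasDerivAt t hl
    have := (h1.clm_apply (hasDerivAt_const t ξ)).clm_apply (hasDerivAt_const t ξ)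
    simpa using this

/-- Regularity bounds the second derivatives of `A_{ξξ}` in `p` from below in every direction `v`,
up to the component of `v` along `ξ`. -/
theorem RegularOn.second_lower (h : RegularOn A b M K) {q : Eu n × ℝ × Eu n} (hq : q ∈ K)
    {ξ v : Eu n} (hξ : ‖ξ‖ = 1) :
    -(3 * M * ‖v‖ * |inner ℝ ξ v|) ≤ fderiv ℝ (fderiv ℝ A) q (0, 0, v) (0, 0, v) ξ ξ := by
  have hM : 0 ≤ M := (norm_nonneg _).trans (h.bound q hq).A0
  set c : ℝ := inner ℝ ξ v with hc
  have hcv : |c| ≤ ‖v‖ := by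
    have := abs_real_inner_le_norm ξ v
    rwa [hξ, one_mul] at this
  set v' := v - c • ξ with hv'
  have horth : inner ℝ ξ v' = 0 := by
    rw [hv', inner_sub_right, inner_smul_right, real_inner_self_eq_norm_sq, hξ]
    simp [hc]
  have hnorm : ‖v'‖ ≤ ‖v‖ := by
    have h1 : ‖v‖ ^ 2 = ‖v'‖ ^ 2 + c ^ 2 := by
      have h2 : v = v' + c • ξ := by rw [hv']; abel
      have h3 : inner ℝ v' (c • ξ) = 0 := by
        rw [inner_smul_right, real_inner_comm, horth, mul_zero]
      rw [h2, norm_add_sq_real, h3, norm_smul, hξ]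
      simp
    exact abs_le_of_sq_le_sq' (by nlinarith [sq_nonneg c]) (norm_nonneg _) |>.2
  have hsplit : ((0, 0, v) : Eu n × ℝ × Eu n) = (0, 0, v') + c • (0, 0, ξ) := by
    rw [hv']; simp
  have h1 := h.regular q hq ξ v' horth
  have h2 := (h.bound q hq).abs_A2 (0, 0, v') (0, 0, ξ) hξ hξ
  have h3 := (h.bound q hq).abs_A2 (0, 0, ξ) (0, 0, v') hξ hξ
  have h4 := (h.bound q hq).abs_A2 (0, 0, ξ) (0, 0, ξ) hξ hξ
  rw [hsplit]
  simp only [map_add, map_smul, add_apply, smul_apply, smul_eq_mul]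
  simp only [norm_zero_zero, hξ, mul_one] at h2 h3 h4
  generalize fderiv ℝ (fderiv ℝ A) q (0, 0, v') (0, 0, v') ξ ξ = y1 at *
  generalize fderiv ℝ (fderiv ℝ A) q (0, 0, v') (0, 0, ξ) ξ ξ = y2 at *
  generalize fderiv ℝ (fderiv ℝ A) q (0, 0, ξ) (0, 0, v') ξ ξ = y3 at *
  generalize fderiv ℝ (fderiv ℝ A) q (0, 0, ξ) (0, 0, ξ) ξ ξ = y4 at *
  have k1 : |y2| ≤ M * ‖v‖ := h2.trans (by gcongr)
  have k2 : |y3| ≤ M * ‖v‖ := h3.trans (by gcongr)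
  have k4 : -(|c| * (M * ‖v‖)) ≤ c * y2 := by
    refine neg_le_of_abs_le ?_
    rw [abs_mul]; gcongr
  have k5 : -(|c| * (M * ‖v‖)) ≤ c * y3 := by
    refine neg_le_of_abs_le ?_
    rw [abs_mul]; gcongr
  have k6 : -(|c| * (M * ‖v‖)) ≤ c * (c * y4) := by
    refine neg_le_of_abs_le ?_
    rw [abs_mul, abs_mul]
    have : |c| * |y4| ≤ ‖v‖ * M := by gcongr
    calc |c| * (|c| * |y4|) ≤ |c| * (‖v‖ * M) := by gcongr
      _ = _ := by ring
  linarith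

/-- The operator applied to `η = f - u`, where `D²f = A(·, f, Df)`. The regularity condition enters
through the Taylor expansion of `A` in `p`. -/
theorem linOp_cutoff {u : Eu n → ℝ} {x : Eu n} {e : OrthonormalBasis (Fin n) ℝ (Eu n)}
    {lam : Fin n → ℝ} {o : Fin n} (h : EigenPoint A b u M x e lam o) (hK : RegularOn A b M K)
    {f : Eu n → ℝ} (hf : ContDiffAt ℝ 2 f x) (hfA : hess f x = A (jet f x)) (hfu : u x ≤ f x)
    (hp : ∀ t ∈ Icc (0 : ℝ) 1, (x, u x, ∇ u x + t • (∇ f x - ∇ u x)) ∈ K)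
    (hz : ∀ t ∈ Icc (0 : ℝ) 1, (x, u x + t * (f x - u x), ∇ f x) ∈ K) :
    -((8 * M ^ 2 + n) * (1 + (f x - u x) * ∑ i, (lam i)⁻¹ +
        ∑ i, (lam i)⁻¹ * |fderiv ℝ (fun y => f y - u y) x (e i)|)) ≤
      linOp A b u x e lam (fun y => f y - u y) := by
  have hM := h.one_le_M
  have hM0 : 0 < M := by linarith
  have hn : ∀ i, ‖(e i : Eu n)‖ = 1 := fun i => by simp
  have hu2 : ContDiffAt ℝ 2 u x := h.u4.of_le (by norm_num)
  set η : Eu n → ℝ := fun y => f y - u y with hη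
  have hη' : η = fun y => f y + (-1) * u y := by funext y; simp [hη]; ring
  have hu2' : ContDiffAt ℝ 2 (fun y => (-1) * u y) x := contDiffAt_const.mul hu2
  set v := ∇ f x - ∇ u x with hv
  have hgrad : ∇ η x = v := by
    simp only [gradient_eq_sharp, hv, hη]
    rw [fderiv_fun_sub (hf.differentiableAt (by norm_num)) (hu2.differentiableAt (by norm_num)),
      map_sub]
  have hhess : ∀ i, hess η x (e i) (e i) =
      A (jet f x) (e i) (e i) - A (jet u x) (e i) (e i) - lam i := by
    intro i
    have e1 : hess η x = hess f x - hess u x := by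
      unfold hess
      rw [hη', fderiv_fderiv_add hf hu2', fderiv_fderiv_const_mul hu2]
      simp [sub_eq_add_neg]
    rw [e1, hfA, EigenPoint.hess_eq A u x]
    simp only [sub_apply, add_apply]
    rw [h.diag]
    simp
    ring
  have hηi : ∀ i, fderiv ℝ η x (e i) = inner ℝ (e i) v := fun i => by
    rw [← inner_grad, hgrad, real_inner_comm]
  have hfgrad : ‖∇ f x‖ ≤ M := (hK.bound _ (hz 0 (by simp))).grad
  have hugrad : ‖∇ u x‖ ≤ M := h.bound.grad
  have hvn : ‖v‖ ≤ 2 * M := (norm_sub_le _ _).trans (by linarith)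
  set s := f x - u x with hs
  have hs0 : 0 ≤ s := by rw [hs]; linarith
  -- in each eigendirection, `A` changes first by the variation of `p` at fixed value of `u`, where
  -- regularity applies, and then by that of the value, at the cost of `M s`
  have key : ∀ i, -(M * s) - 6 * M ^ 2 * |inner ℝ (e i) v| ≤
      A (jet f x) (e i) (e i) - A (jet u x) (e i) (e i) -
        fderiv ℝ A (jet u x) (0, 0, v) (e i) (e i) := by
    intro i
    have hpq : ∀ t : ℝ, jet u x + t • ((0, 0, v) : Eu n × ℝ × Eu n) =
        (x, u x, ∇ u x + t • v) := fun t => by simp [jet]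
    have hzq : ∀ t : ℝ, ((x, u x, ∇ f x) : Eu n × ℝ × Eu n) +
        t • ((0, s, 0) : Eu n × ℝ × Eu n) = (x, u x + t * s, ∇ f x) := fun t => by simp
    have t1 := taylor_lower (f := fun t : ℝ => A (jet u x + t • (0, 0, v)) (e i) (e i))
      (f' := fun t : ℝ => fderiv ℝ A (jet u x + t • (0, 0, v)) (0, 0, v) (e i) (e i))
      (f'' := fun t : ℝ =>
        fderiv ℝ (fderiv ℝ A) (jet u x + t • (0, 0, v)) (0, 0, v) (0, 0, v) (e i) (e i))
      (c := 6 * M ^ 2 * |inner ℝ (e i) v|) (by positivity)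
      (fun t ht => (line_bil (by rw [hpq]; exact hK.A2 _ (hp t ht)) _).1)
      (fun t ht => (line_bil (by rw [hpq]; exact hK.A2 _ (hp t ht)) _).2)
      (fun t ht => by
        have h1 := hK.second_lower (v := v) (hp t ht) (hn i)
        rw [hpq]
        have h2 : 3 * M * ‖v‖ * |inner ℝ (e i) v| ≤ 3 * M * (2 * M) * |inner ℝ (e i) v| := by
          gcongr
        linarith)
    obtain ⟨r, hr, hr'⟩ := exists_hasDerivAt_eq_slope
      (fun t : ℝ => A (((x, u x, ∇ f x) : Eu n × ℝ × Eu n) + t • (0, s, 0)) (e i) (e i))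
      (fun t : ℝ => fderiv ℝ A ((x, u x, ∇ f x) + t • (0, s, 0)) (0, s, 0) (e i) (e i))
      (by norm_num : (0 : ℝ) < 1)
      (fun t ht =>
        ((line_bil (by rw [hzq]; exact hK.A2 _ (hz t ht)) _).1).continuousAt.continuousWithinAt)
      (fun t ht => (line_bil (by rw [hzq]; exact hK.A2 _ (hz t (Ioo_subset_Icc_self ht))) _).1)
    have h5 := (hK.bound _ (hz r (Ioo_subset_Icc_self hr))).abs_A1 (0, s, 0) (hn i) (hn i)
    rw [norm_zero_mid, abs_of_nonneg hs0, ← hzq, hr'] at h5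
    have h6 := neg_le_of_abs_le h5
    have e1 : ((x, u x, ∇ f x) : Eu n × ℝ × Eu n) + (1 : ℝ) • (0, s, 0) = jet f x := by
      simp [jet, hs]
    have e2 : ((x, u x, ∇ f x) : Eu n × ℝ × Eu n) + (0 : ℝ) • (0, s, 0) =
        jet u x + (1 : ℝ) • (0, 0, v) := by
      simp [jet, hv]
    rw [e1, e2] at h6
    simp only [zero_smul, add_zero] at t1
    simp only [sub_zero, div_one] at h6
    linarith
  have hsum : -(M * s * ∑ i, (lam i)⁻¹) - 6 * M ^ 2 * ∑ i, (lam i)⁻¹ * |inner ℝ (e i) v| - n ≤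
      ∑ i, ((lam i)⁻¹ * hess η x (e i) (e i) -
        (lam i)⁻¹ * fderiv ℝ A (jet u x) (0, 0, v) (e i) (e i)) := by
    have e1 : -(M * s * ∑ i, (lam i)⁻¹) - 6 * M ^ 2 * ∑ i, (lam i)⁻¹ * |inner ℝ (e i) v| - n =
        ∑ i, (-(M * s * (lam i)⁻¹) - 6 * M ^ 2 * ((lam i)⁻¹ * |inner ℝ (e i) v|) - 1) := by
      simp only [Finset.sum_sub_distrib, Finset.sum_neg_distrib, ← Finset.mul_sum]
      simp
    rw [e1]
    refine Finset.sum_le_sum fun i _ => ?_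
    have h1 := mul_le_mul_of_nonneg_left (key i) (inv_pos.2 (h.pos i)).le
    have h2 : (lam i)⁻¹ * lam i = 1 := inv_mul_cancel₀ (h.pos i).ne'
    rw [hhess]
    linarith
  rw [Finset.sum_sub_distrib] at hsum
  have hb := le_of_abs_le (h.bound.abs_b1 (0, 0, v))
  rw [norm_zero_zero] at hb
  have hb' : M * ‖v‖ ≤ M * (2 * M) := by gcongr
  rw [linOp, driftForm, hgrad]
  simp only [hηi]
  have hT0 := h.sum_inv_nonneg
  have hI0 : 0 ≤ ∑ i, (lam i)⁻¹ * |inner ℝ (e i) v| :=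
    Finset.sum_nonneg fun i _ => mul_nonneg (inv_pos.2 (h.pos i)).le (abs_nonneg _)
  have hn0 : (0 : ℝ) ≤ n := Nat.cast_nonneg n
  have g1 : M * (s * ∑ i, (lam i)⁻¹) ≤ (8 * M ^ 2 + n) * (s * ∑ i, (lam i)⁻¹) := by
    have : M ≤ 8 * M ^ 2 + n := by nlinarith
    have := mul_nonneg hs0 hT0
    gcongr
  have g2 : 6 * M ^ 2 * ∑ i, (lam i)⁻¹ * |inner ℝ (e i) v| ≤
      (8 * M ^ 2 + n) * ∑ i, (lam i)⁻¹ * |inner ℝ (e i) v| := by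
    have : 6 * M ^ 2 ≤ 8 * M ^ 2 + n := by nlinarith
    gcongr
  have g3 : 0 ≤ M ^ 2 := sq_nonneg M
  linarith

end Cutoff

/-! ### Supporting functions and sections -/

section Generating

variable {Γ : Set (Eu n × Eu n × ℝ)} {g : Eu n × Eu n × ℝ → ℝ}
  {Y : Eu n × ℝ × Eu n → Eu n} {Z : Eu n × ℝ × Eu n → ℝ}

theorem IsGenerating.contDiffAt (hg : IsGenerating Γ g Y Z) {q : Eu n × Eu n × ℝ} (hq : q ∈ Γ) :
    ContDiffAt ℝ 2 g q := hg.smooth.contDiffAt (hg.dom.1.mem_nhds hq)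

theorem IsGenerating.contDiffAt_slice (hg : IsGenerating Γ g Y Z) {x y : Eu n} {z : ℝ}
    (hq : (x, y, z) ∈ Γ) : ContDiffAt ℝ 2 (fun x => g (x, y, z)) x :=
  ContDiffAt.comp (g := g) x (hg.contDiffAt hq)
    (contDiffAt_id.prodMk (contDiffAt_const.prodMk contDiffAt_const))

theorem IsGenerating.continuousOn_jetMap (hg : IsGenerating Γ g Y Z) :
    ContinuousOn (jetMap g) Γ := by
  intro q hq
  refine ContinuousAt.continuousWithinAt ?_
  have hev : (fun q : Eu n × Eu n × ℝ => ∇ (fun x => g (x, q.2.1, q.2.2)) q.1) =ᶠ[𝓝 q]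
      fun q => sharp ((fderiv ℝ g q).comp (ContinuousLinearMap.inl ℝ (Eu n) (Eu n × ℝ))) := by
    filter_upwards [hg.dom.1.mem_nhds hq] with p hp
    rw [gradient_eq_sharp]
    congr 1
    have h1 : HasFDerivAt (fun x : Eu n => ((x, p.2.1, p.2.2) : Eu n × Eu n × ℝ))
        (ContinuousLinearMap.inl ℝ (Eu n) (Eu n × ℝ)) p.1 :=
      (hasFDerivAt_id (𝕜 := ℝ) p.1).prodMk (hasFDerivAt_const (𝕜 := ℝ) (p.2.1, p.2.2) p.1)
    exact (HasFDerivAt.comp (g := g) p.1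
      ((hg.contDiffAt hp).differentiableAt (by norm_num)).hasFDerivAt h1).fderiv
  have hc : ContinuousAt (fun q : Eu n × Eu n × ℝ => ∇ (fun x => g (x, q.2.1, q.2.2)) q.1) q := by
    refine ContinuousAt.congr ?_ hev.symm
    exact sharp.continuous.continuousAt.comp
      ((hg.contDiffAt hq).differentiableAt_fderiv.continuousAt.clm_comp continuousAt_const)
  exact continuousAt_fst.prodMk ((hg.contDiffAt hq).continuousAt.prodMk hc)

/-- The supporting functions `g(·, y, z)` solve `D²f = A(·, f, Df)`. -/
theorem IsGenerating.genA_jetMap (hg : IsGenerating Γ g Y Z) {x y : Eu n} {z : ℝ}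
    (hq : (x, y, z) ∈ Γ) :
    hess (fun x => g (x, y, z)) x = genA g Y Z (jet (fun x => g (x, y, z)) x) := by
  have hj : jet (fun x => g (x, y, z)) x = jetMap g (x, y, z) := rfl
  have hmem : jetMap g (x, y, z) ∈ jetDom Γ g := mem_image_of_mem _ hq
  obtain ⟨h1, h2⟩ := hg.solves _ hmem
  have h3 := hg.unique h1 hq h2
  have hY : Y (jetMap g (x, y, z)) = y := congrArg (fun q => q.2.1) h3
  have hZ : Z (jetMap g (x, y, z)) = z := congrArg (fun q => q.2.2) h3
  rw [hj, genA, hY, hZ]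
  rfl

/-- Uniform control of the supporting functions near a compact set `K₀` of jets. The `g`-affine
function at `q ∈ K₀`, lowered by `s ≤ δ`, exists in the ball of radius `δ` and lies above its
touching value by `c s`; the jets that occur when it is compared with a function whose jets are in
`K₀` stay in a compact set `K`. -/
theorem exists_uniform_support (hg : IsGenerating Γ g Y Z)
    (hconv : ∀ (x : Eu n) (z : ℝ), Convex ℝ {p : Eu n | (x, z, p) ∈ jetDom Γ g})
    {K₀ : Set (Eu n × ℝ × Eu n)} (hK₀ : IsCompact K₀) (hK₀U : K₀ ⊆ jetDom Γ g) :
    ∃ (K : Set (Eu n × ℝ × Eu n)) (δ c : ℝ), IsCompact K ∧ K ⊆ jetDom Γ g ∧ K₀ ⊆ K ∧ 0 < δ ∧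
      0 < c ∧ ∀ q ∈ K₀, ∀ s ∈ Icc 0 δ,
        q.2.1 + c * s ≤ g (q.1, Y q, Z q - s) ∧
        ∀ x, dist x q.1 ≤ δ → (x, Y q, Z q - s) ∈ Γ ∧ ∀ z, dist z q.2.1 ≤ δ →
          ∀ t ∈ Icc (0 : ℝ) 1,
            (x, z + t * (g (x, Y q, Z q - s) - z), ∇ (fun x => g (x, Y q, Z q - s)) x) ∈ K ∧
            ∀ p, (x, z, p) ∈ K₀ →
              (x, z, p + t • (∇ (fun x => g (x, Y q, Z q - s)) x - p)) ∈ K := by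
  have hUo := hg.jet_open
  obtain ⟨r₂, hr₂, hr₂U⟩ := hK₀.exists_cthickening_subset_open hUo hK₀U
  set K₂ := Metric.cthickening r₂ K₀ with hK₂
  have hK₂c : IsCompact K₂ := hK₀.cthickening
  -- the segments in `p` between jets in `K₀` and jets in `K₂` over the same `(x, z)`
  set P : Set ((Eu n × ℝ × Eu n) × (Eu n × ℝ × Eu n)) :=
    (K₀ ×ˢ K₂) ∩ {w | w.1.1 = w.2.1 ∧ w.1.2.1 = w.2.2.1} with hP
  have hPc : IsCompact P := by
    refine (hK₀.prod hK₂c).inter_right ?_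
    exact (isClosed_eq (by fun_prop) (by fun_prop)).inter
      (isClosed_eq (by fun_prop) (by fun_prop))
  set F : ((Eu n × ℝ × Eu n) × (Eu n × ℝ × Eu n)) × ℝ → Eu n × ℝ × Eu n :=
    fun w => (w.1.1.1, w.1.1.2.1, w.1.1.2.2 + w.2 • (w.1.2.2.2 - w.1.1.2.2)) with hF
  set K₃ := F '' (P ×ˢ Icc (0 : ℝ) 1) with hK₃
  have hK₃c : IsCompact K₃ := (hPc.prod isCompact_Icc).image (by fun_prop)
  have hK₀K₂ : K₀ ⊆ K₂ := Metric.self_subset_cthickening _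
  have hK₃U : K₃ ⊆ jetDom Γ g := by
    rintro _ ⟨⟨⟨⟨x, z, p⟩, ⟨x', z', p'⟩⟩, t⟩, ⟨⟨⟨h1, h2⟩, h3, h4⟩, ht⟩, rfl⟩
    simp only at h1 h2 h3 h4 ht
    subst h3 h4
    exact (hconv x z).add_smul_sub_mem (hK₀U h1) (hr₂U h2) ht
  -- the compact neighbourhood in `Γ`
  set Ψ : Eu n × ℝ × Eu n → Eu n × Eu n × ℝ := fun q => (q.1, Y q, Z q) with hΨ
  have hΨc : ContinuousOn Ψ K₀ := continuousOn_fst.prodMk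
    ((hg.smoothY.continuousOn.mono hK₀U).prodMk (hg.smoothZ.continuousOn.mono hK₀U))
  have hG₀c : IsCompact (Ψ '' K₀) := hK₀.image_of_continuousOn hΨc
  have hG₀Γ : Ψ '' K₀ ⊆ Γ := by
    rintro _ ⟨q, hq, rfl⟩
    exact (hg.solves q (hK₀U hq)).1
  obtain ⟨r₁, hr₁, hr₁Γ⟩ := hG₀c.exists_cthickening_subset_open hg.dom.1 hG₀Γ
  set G := Metric.cthickening r₁ (Ψ '' K₀) with hG
  have hGc : IsCompact G := hG₀c.cthickening
  have hunif := hGc.uniformContinuousOn_of_continuous (hg.continuousOn_jetMap.mono hr₁Γ)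
  obtain ⟨δ', hδ', hunif⟩ := Metric.uniformContinuousOn_iff.1 hunif r₂ hr₂
  -- `g_z` is bounded away from zero on `G`, so that lowering `z` by `s` raises `g` by `c s`
  obtain ⟨c, hc, hgz⟩ : ∃ c : ℝ, 0 < c ∧
      ∀ q ∈ G, deriv (fun t => g (q.1, q.2.1, t)) q.2.2 ≤ -c := by
    have hder : ∀ q ∈ Γ, deriv (fun t => g (q.1, q.2.1, t)) q.2.2 = fderiv ℝ g q (0, 0, 1) := by
      intro q hq
      have h1 : HasDerivAt (fun t : ℝ => ((q.1, q.2.1, t) : Eu n × Eu n × ℝ)) (0, 0, 1) q.2.2 :=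
        (hasDerivAt_const q.2.2 q.1).prodMk ((hasDerivAt_const q.2.2 q.2.1).prodMk
          (hasDerivAt_id q.2.2))
      exact (HasFDerivAt.comp_hasDerivAt (l := g) q.2.2
        ((hg.contDiffAt hq).differentiableAt (by norm_num)).hasFDerivAt h1).deriv
    rcases G.eq_empty_or_nonempty with hne | hne
    · exact ⟨1, one_pos, by rw [hne]; simp⟩
    · have hcont : ContinuousOn (fun q => fderiv ℝ g q (0, 0, 1)) G := fun q hq =>
        ((hg.contDiffAt (hr₁Γ hq)).differentiableAt_fderiv.continuousAt.clm_apply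
          continuousAt_const).continuousWithinAt
      obtain ⟨q₀, hq₀, hmax⟩ := hGc.exists_isMaxOn hne hcont
      refine ⟨-fderiv ℝ g q₀ (0, 0, 1), ?_, fun q hq => ?_⟩
      · rw [← hder _ (hr₁Γ hq₀)]
        linarith [hg.neg q₀ (hr₁Γ hq₀)]
      · rw [hder _ (hr₁Γ hq), neg_neg]
        exact hmax hq
  set δ := min (min (r₁) (δ' / 2)) r₂ with hδ
  have hδ0 : 0 < δ := by positivity
  have hδ1 : δ ≤ r₁ := (min_le_left _ _).trans (min_le_left _ _)
  have hδ2 : δ < δ' := lt_of_le_of_lt ((min_le_left _ _).trans (min_le_right _ _)) (by linarith)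
  have hδ3 : δ ≤ r₂ := min_le_right _ _
  refine ⟨K₂ ∪ K₃, δ, c, hK₂c.union hK₃c, union_subset hr₂U hK₃U,
    hK₀K₂.trans subset_union_left, hδ0, hc, fun q hq s hs => ?_⟩
  have hdist : ∀ x, dist x q.1 ≤ δ → ∀ r ∈ Icc 0 s,
      dist ((x, Y q, Z q - r) : Eu n × Eu n × ℝ) (Ψ q) ≤ δ := by
    intro x hx r hr
    simp only [hΨ, Prod.dist_eq, dist_self]
    refine max_le hx (max_le hδ0.le ?_)
    rw [Real.dist_eq]
    simp only [sub_sub_cancel_left, abs_neg, abs_of_nonneg hr.1]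
    exact hr.2.trans hs.2
  have hmemG : ∀ x, dist x q.1 ≤ δ → ∀ r ∈ Icc 0 s, (x, Y q, Z q - r) ∈ G := by
    intro x hx r hr
    exact Metric.mem_cthickening_of_dist_le _ _ _ _ (mem_image_of_mem _ hq)
      ((hdist x hx r hr).trans hδ1)
  have hΨG : Ψ q ∈ G := Metric.self_subset_cthickening _ (mem_image_of_mem _ hq)
  have hsol := (hg.solves q (hK₀U hq)).2
  have hs' : s ∈ Icc 0 s := ⟨hs.1, le_rfl⟩
  refine ⟨?_, fun x hx => ⟨hr₁Γ (hmemG x hx s hs'), fun z hz t ht => ?_⟩⟩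
  · have h0 : g (q.1, Y q, Z q) = q.2.1 := congrArg (fun w => w.2.1) hsol
    have hd : ∀ r ∈ Icc 0 s, HasDerivAt (fun r => g (q.1, Y q, Z q - r))
        (-deriv (fun t => g (q.1, Y q, t)) (Z q - r)) r := by
      intro r hr
      have hmem := hr₁Γ (hmemG q.1 (by simp [hδ0.le]) r hr)
      have h1 : DifferentiableAt ℝ (fun t : ℝ => g (q.1, Y q, t)) (Z q - r) := by
        have := (hg.contDiffAt hmem).differentiableAt (by norm_num)
        exact DifferentiableAt.comp (g := g) (Z q - r) this (by fun_prop)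
      have h2 : HasDerivAt (fun r : ℝ => Z q - r) (-1) r := by
        simpa using (hasDerivAt_id r).const_sub (Z q)
      have h3 := h1.hasDerivAt.comp r h2
      rw [mul_neg_one] at h3
      exact h3
    rcases hs.1.eq_or_lt with h00 | hspos
    · rw [← h00]; simp [h0]
    · obtain ⟨r, hr, hr'⟩ := exists_hasDerivAt_eq_slope (fun r => g (q.1, Y q, Z q - r)) _ hspos
        (fun r hr => (hd r hr).continuousAt.continuousWithinAt)
        (fun r hr => hd r (Ioo_subset_Icc_self hr))
      have h3 := hgz _ (hmemG q.1 (by simp [hδ0.le]) r (Ioo_subset_Icc_self hr))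
      simp only at h3
      rw [sub_zero, sub_zero, h0, eq_div_iff hspos.ne'] at hr'
      nlinarith
  · set f : Eu n → ℝ := fun x => g (x, Y q, Z q - s) with hf
    have hjd : dist (jetMap g (x, Y q, Z q - s)) q < r₂ := by
      have := hunif _ (hmemG x hx s hs') _ hΨG (lt_of_le_of_lt (hdist x hx s hs') hδ2)
      rwa [show jetMap g (Ψ q) = q from hsol] at this
    have hjd' : max (dist x q.1) (max (dist (f x) q.2.1) (dist (∇ f x) q.2.2)) < r₂ := hjd
    rw [max_lt_iff, max_lt_iff] at hjd'
    obtain ⟨d1, d2, d3⟩ := hjd'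
    have hK₂mem : ∀ z', dist z' q.2.1 ≤ r₂ → ((x, z', ∇ f x) : Eu n × ℝ × Eu n) ∈ K₂ := by
      intro z' hz'
      refine Metric.mem_cthickening_of_dist_le _ _ _ _ hq ?_
      rw [Prod.dist_eq, Prod.dist_eq]
      exact max_le d1.le (max_le hz' d3.le)
    refine ⟨Or.inl (hK₂mem _ ?_), fun p hp => Or.inr ?_⟩
    · have hball := (convex_closedBall q.2.1 r₂).add_smul_sub_mem
        (Metric.mem_closedBall.2 (hz.trans hδ3)) (Metric.mem_closedBall.2 d2.le) ht
      simpa using hball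
    · exact ⟨(((x, z, p), (x, z, ∇ f x)), t), ⟨⟨⟨hp, hK₂mem z (hz.trans hδ3)⟩, rfl, rfl⟩, ht⟩, rfl⟩

end Generating

/-! ### The interior estimate on sections -/

theorem not_mem_of_mem_closure_connectedComponentIn {X : Type*} [TopologicalSpace X] {G : Set X}
    {x₀ x : X} (h₀ : x₀ ∈ G) (hx : x ∈ closure (connectedComponentIn G x₀))
    (hx' : x ∉ connectedComponentIn G x₀) : x ∉ G := by
  intro hxG
  have h1 : IsPreconnected (insert x (connectedComponentIn G x₀)) :=
    isPreconnected_connectedComponentIn.subset_closure (subset_insert _ _)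
      (insert_subset hx subset_closure)
  exact hx' (h1.subset_connectedComponentIn (mem_insert_of_mem _ (mem_connectedComponentIn h₀))
    (insert_subset hxG (connectedComponentIn_subset _ _)) (mem_insert _ _))

theorem IsGenerating.isOpen_gSection {Γ : Set (Eu n × Eu n × ℝ)} {g : Eu n × Eu n × ℝ → ℝ}
    {Y : Eu n × ℝ × Eu n → Eu n} {Z : Eu n × ℝ × Eu n → ℝ} (hg : IsGenerating Γ g Y Z)
    {Ω : Set (Eu n)} (hΩ : IsOpen Ω) {u : Eu n → ℝ} (hu : ContinuousOn u Ω) (y : Eu n) (z h : ℝ) :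
    IsOpen (gSection Γ g Ω u y z h) := by
  rw [isOpen_iff_mem_nhds]
  rintro x ⟨hx, hxΓ, hlt⟩
  have hΓ : ∀ᶠ x' in 𝓝 x, (x', y, z - h) ∈ Γ :=
    (by fun_prop : ContinuousAt (fun x' : Eu n => (x', y, z - h)) x).eventually
      (hg.dom.1.mem_nhds hxΓ)
  filter_upwards [hΩ.mem_nhds hx, hΓ, (hu.continuousAt (hΩ.mem_nhds hx)).eventually_lt
    (hg.contDiffAt_slice hxΓ).continuousAt hlt] with x' h1 h2 h3
  exact ⟨h1, h2, h3⟩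

theorem hasFDerivAt_sq_dist (x₀ x : Eu n) :
    HasFDerivAt (fun y => ‖y - x₀‖ ^ 2) ((2 : ℝ) • innerSL ℝ (x - x₀)) x := by
  have h := (hasStrictFDerivAt_norm_sq (x - x₀)).hasFDerivAt.comp x
    ((hasFDerivAt_id (𝕜 := ℝ) x).sub_const x₀)
  refine h.congr_fderiv ?_
  ext v
  simp [two_smul, ← inner_sub_left]

theorem gradient_sq_dist (x₀ x : Eu n) : ∇ (fun y => ‖y - x₀‖ ^ 2) x = (2 : ℝ) • (x - x₀) := by
  refine ext_inner_right ℝ fun v => ?_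
  rw [inner_grad, (hasFDerivAt_sq_dist x₀ x).fderiv, smul_apply, innerSL_apply_apply,
    real_inner_smul_left, smul_eq_mul]

theorem hess_sq_dist (x₀ x ξ : Eu n) : hess (fun y => ‖y - x₀‖ ^ 2) x ξ ξ = 2 * ‖ξ‖ ^ 2 := by
  have h1 : fderiv ℝ (fun y => ‖y - x₀‖ ^ 2) =
      fun y => (2 : ℝ) • innerSL ℝ (y - x₀) := by
    funext y
    exact (hasFDerivAt_sq_dist x₀ y).fderiv
  have h2 : HasFDerivAt (fun y : Eu n => (2 : ℝ) • innerSL ℝ (y - x₀)) ((2 : ℝ) • innerSL ℝ) x :=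
    ((innerSL ℝ).hasFDerivAt.comp x ((hasFDerivAt_id (𝕜 := ℝ) x).sub_const x₀)).const_smul (2 : ℝ)
  rw [hess, h1, h2.fderiv]
  simp only [smul_apply, smul_eq_mul]
  rw [innerSL_apply_apply, real_inner_self_eq_norm_sq]

/-- The interior second derivative bound. Where a section of height bounded below is contained in a
ball on which `|y - x₀|²` is a barrier, the Pogorelov estimate applies on the section, with the
height over `u` of the supporting function as cut-off. -/
theorem exists_interior_bound {Γ : Set (Eu n × Eu n × ℝ)} {g : Eu n × Eu n × ℝ → ℝ}
    {Y : Eu n × ℝ × Eu n → Eu n} {Z : Eu n × ℝ × Eu n → ℝ} (hg : IsGenerating Γ g Y Z)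
    {B : Eu n × ℝ × Eu n → ℝ} (hAB : IsRegularData (jetDom Γ g) (genA g Y Z) B)
    {K₀ : Set (Eu n × ℝ × Eu n)} (hK₀ : IsCompact K₀) (hK₀U : K₀ ⊆ jetDom Γ g)
    {R₀ : ℝ} (hR₀ : 0 < R₀) {ω₀ : ℝ → ℝ} (hω₀ : ∀ R ∈ Ioo 0 R₀, 0 < ω₀ R) :
    ∃ C : ℝ, ∀ (Ω : Set (Eu n)) (u : Eu n → ℝ) (x₀ : Eu n), IsOpen Ω →
      Metric.ball x₀ R₀ ⊆ Ω → ContDiffOn ℝ 4 u Ω → MapsTo (jet u) Ω K₀ →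
      IsEllipticSolution (genA g Y Z) B Ω u →
      (∀ R ∈ Ioo 0 R₀, ENNReal.ofReal (ω₀ R) ≤ modulus Γ g Y Z Ω u x₀ R) →
      ∀ ξ : Eu n, ‖ξ‖ = 1 → augHess (genA g Y Z) u x₀ ξ ξ ≤ C := by
  obtain ⟨K, δ, c, hKc, hKU, hK₀K, hδ, hc, hsup⟩ :=
    exists_uniform_support hg hAB.convex hK₀ hK₀U
  obtain ⟨M, hM, hreg⟩ := exists_regularOn hg hAB hKc hKU
  have hM0 : 0 < M := by linarith
  set D : ℝ := 8 * M ^ 2 + n with hD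
  have hn0 : (0 : ℝ) ≤ n := n.cast_nonneg
  have hDM : 2 * M ≤ D := by nlinarith
  have hD1 : 1 ≤ D := by linarith
  obtain ⟨k, τ, C, hk, hτ, hcut⟩ := exists_bound_of_cutoff n hM hD1
  -- in a ball of radius `R` the supporting functions are controlled, and `|y - x₀|²` is a barrier
  -- whose gradient is at most `k`
  set R : ℝ := min (R₀ / 2) (min (δ / M) (min (k / 2) (1 / (2 * M)))) with hRdef
  have hR : 0 < R := by positivity
  have hRR₀ : R < R₀ := lt_of_le_of_lt (min_le_left _ _) (by linarith)
  have hRδ' : M * R ≤ δ := by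
    have : R ≤ δ / M := (min_le_right _ _).trans (min_le_left _ _)
    rwa [le_div_iff₀ hM0, mul_comm] at this
  have hRδ : R ≤ δ := by nlinarith
  have hRk : 2 * R ≤ k := by
    have : R ≤ k / 2 := (min_le_right _ _).trans ((min_le_right _ _).trans (min_le_left _ _))
    linarith
  have hRM : M * (2 * R) ≤ 1 := by
    have : R ≤ 1 / (2 * M) :=
      (min_le_right _ _).trans ((min_le_right _ _).trans (min_le_right _ _))
    rw [le_div_iff₀ (by positivity)] at this
    linarith
  have hR1 : R ≤ 1 := by nlinarith
  have hRmem : R ∈ Ioo 0 R₀ := ⟨hR, hRR₀⟩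
  have hω := hω₀ R hRmem
  set h : ℝ := min (ω₀ R / 2) δ with hh
  have hh0 : 0 < h := by positivity
  -- at `x₀` the cut-off function is at least `c * h`
  refine ⟨Real.exp (C - τ * Real.log (c * h)), fun Ω u x₀ hΩ hball hu hJ hs hmod ξ hξ => ?_⟩
  have hx₀ : x₀ ∈ Ω := hball (Metric.mem_ball_self hR₀)
  have hsolΩ := hreg.solutionOn hΩ hu (fun x hx => hK₀K (hJ hx)) hs
  have hcball : Metric.closedBall x₀ R ⊆ Ω := (Metric.closedBall_subset_ball hRR₀).trans hball
  set y₀ := Y (jet u x₀) with hy₀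
  set z₀ := Z (jet u x₀) with hz₀
  set f : Eu n → ℝ := fun x => g (x, y₀, z₀ - h) with hf
  set η : Eu n → ℝ := fun y => f y - u y with hη
  have hsec : sectionAt Γ g Y Z Ω u x₀ h ⊆ Metric.ball x₀ R := by
    have h1 : ENNReal.ofReal (ω₀ R / 2) < modulus Γ g Y Z Ω u x₀ R :=
      lt_of_lt_of_le ((ENNReal.ofReal_lt_ofReal_iff hω).2 (by linarith)) (hmod R hRmem)
    simp only [modulus, lt_iSup_iff] at h1
    obtain ⟨h₀, ⟨h2, -, h3⟩, h4⟩ := h1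
    rw [ENNReal.ofReal_lt_ofReal_iff h2] at h4
    exact h3 h ⟨hh0, (min_le_left _ _).trans h4.le⟩
  set G := gSection Γ g Ω u y₀ z₀ h with hG
  set N := sectionAt Γ g Y Z Ω u x₀ h with hN
  have hNG : N ⊆ G := connectedComponentIn_subset _ _
  have hNΩ : N ⊆ Ω := fun x hx => (hNG hx).1
  have hNo : IsOpen N := (hg.isOpen_gSection hΩ hu.continuousOn _ _ _).connectedComponentIn
  have hclN : closure N ⊆ Metric.closedBall x₀ R :=
    (closure_mono hsec).trans Metric.closure_ball_subset_closedBall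
  obtain ⟨hheight, hnear⟩ := hsup (jet u x₀) (hJ hx₀) h ⟨hh0.le, min_le_right _ _⟩
  have hη₀ : c * h ≤ η x₀ := by
    change u x₀ + c * h ≤ f x₀ at hheight
    simp only [hη]
    linarith
  have hu2 : ∀ x ∈ Ω, ContDiffAt ℝ 2 u x := fun x hx => (hsolΩ.u4 x hx).of_le (by norm_num)
  -- on the ball, the touching function exists and its height varies little
  have hmemΓ : ∀ x ∈ Metric.closedBall x₀ R, (x, y₀, z₀ - h) ∈ Γ := fun x hx =>
    (hnear x ((Metric.mem_closedBall.1 hx).trans hRδ)).1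
  have hf2 : ∀ x ∈ Metric.closedBall x₀ R, ContDiffAt ℝ 2 f x := fun x hx =>
    hg.contDiffAt_slice (hmemΓ x hx)
  have hosc : ∀ x ∈ Metric.closedBall x₀ R, dist (u x) (u x₀) ≤ δ := by
    intro x hx
    have h1 := (convex_closedBall x₀ R).norm_image_sub_le_of_norm_fderiv_le (𝕜 := ℝ) (f := u)
      (C := M) (fun y hy => (hu2 y (hcball hy)).differentiableAt (by norm_num))
      (fun y hy => by
        rw [← norm_sharp, ← gradient_eq_sharp]
        exact (hsolΩ.bound y (hcball hy)).grad) (Metric.mem_closedBall_self hR.le) hx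
    rw [dist_eq_norm]
    refine h1.trans (le_trans ?_ hRδ')
    gcongr
    rw [← dist_eq_norm]
    exact hx
  have hjets : ∀ x ∈ Metric.closedBall x₀ R, ∀ t ∈ Icc (0 : ℝ) 1,
      (x, u x + t * (f x - u x), ∇ f x) ∈ K ∧ (x, u x, ∇ u x + t • (∇ f x - ∇ u x)) ∈ K :=
    fun x hx t ht =>
      have h1 := (hnear x ((Metric.mem_closedBall.1 hx).trans hRδ)).2 (u x) (hosc x hx) t ht
      ⟨h1.1, h1.2 _ (hJ (hcball hx))⟩
  have hx₀G : x₀ ∈ G := by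
    refine ⟨hx₀, hmemΓ x₀ (Metric.mem_closedBall_self hR.le), ?_⟩
    have : 0 < η x₀ := lt_of_lt_of_le (by positivity) hη₀
    simpa [hη] using this
  have hx₀N : x₀ ∈ N := mem_connectedComponentIn hx₀G
  have hsol := hsolΩ.mono hNo hNΩ
  obtain ⟨S, hS⟩ := (isCompact_closedBall x₀ R).exists_bound_of_continuousOn (f := hess u)
    fun x hx => (contDiffAt_hess (hsolΩ.u4 x (hcball hx))).continuousAt.continuousWithinAt
  have hNball : N ⊆ Metric.closedBall x₀ R := subset_closure.trans hclN
  have key := hcut (genA g Y Z) (fun q => Real.log (B q)) N u (fun y => ‖y - x₀‖ ^ 2) η S hsol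
    (Metric.isBounded_ball.subset hsec) (fun x hx => ?_) (fun x hx => ?_)
    (fun x hx => hS x (hNball hx)) (fun x hx => ?_) x₀ hx₀N ξ hξ
  · have hw : 0 < augHess (genA g Y Z) u x₀ ξ ξ :=
      hsolΩ.pos x₀ hx₀ ξ (by rintro rfl; simp at hξ)
    rw [← Real.log_le_iff_le_exp hw]
    have h1 : Real.log (c * h) ≤ Real.log (η x₀) := Real.log_le_log (by positivity) hη₀
    have h2 : τ * Real.log (c * h) ≤ τ * Real.log (η x₀) := by gcongr
    linarith
  · have hxR : ‖x - x₀‖ ≤ R := by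
      rw [← dist_eq_norm]
      exact hNball hx
    have hgr : ‖∇ (fun y => ‖y - x₀‖ ^ 2) x‖ ≤ 2 * R := by
      rw [gradient_sq_dist, norm_smul, Real.norm_eq_abs, abs_two]
      gcongr
    refine ⟨(contDiffAt_id.sub contDiffAt_const).norm_sq ℝ, ?_, hgr.trans hRk, fun ζ hζ => ?_⟩
    · rw [abs_of_nonneg (by positivity)]
      have : ‖x - x₀‖ ≤ 1 := hxR.trans hR1
      exact pow_le_one₀ (norm_nonneg _) this
    · have h1 := (hsol.bound x hx).abs_A1 (0, 0, ∇ (fun y => ‖y - x₀‖ ^ 2) x) hζ hζ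
      rw [norm_zero_zero] at h1
      have h2 := (le_abs_self _).trans h1
      rw [hess_sq_dist, hζ]
      have h3 : M * ‖∇ (fun y => ‖y - x₀‖ ^ 2) x‖ ≤ M * (2 * R) := by gcongr
      linarith
  · have hxb := hNball hx
    have hfu : u x < f x := (hNG hx).2.2
    have h1 := hreg.bound _ (hjets x hxb 1 (by simp)).1
    have h2 := hsol.bound x hx
    have h3 : |f x| ≤ M := by simpa using h1.val
    have h4 : |u x| ≤ M := h2.val
    have h5 : ‖∇ f x‖ ≤ M := h1.grad
    have h6 : ‖∇ u x‖ ≤ M := h2.grad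
    refine ⟨(hf2 x hxb).sub (hu2 x (hNΩ hx)), by simpa [hη] using hfu, ?_, ?_, ?_⟩
    · have := le_abs_self (f x)
      have := neg_abs_le (u x)
      simp only [hη]
      linarith
    · have h7 : ∇ η x = ∇ f x - ∇ u x := by
        simp only [gradient_eq_sharp, hη]
        rw [fderiv_fun_sub ((hf2 x hxb).differentiableAt (by norm_num))
          ((hu2 x (hNΩ hx)).differentiableAt (by norm_num)), map_sub]
      rw [h7]
      exact (norm_sub_le _ _).trans (by linarith)
    · intro e lam o hE
      exact linOp_cutoff hE hreg (hf2 x hxb) (hg.genA_jetMap (hmemΓ x hxb)) hfu.le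
        (fun t ht => (hjets x hxb t ht).2) (fun t ht => (hjets x hxb t ht).1)
  · have hxb := hclN hx.1
    have hηc : ContinuousAt η x :=
      ((hf2 x hxb).sub (hu2 x (hcball hxb))).continuousAt
    have ht : Filter.Tendsto η (𝓝[N] x) (𝓝 (η x)) := hηc.tendsto.mono_left nhdsWithin_le_nhds
    have : (𝓝[N] x).NeBot := mem_closure_iff_nhdsWithin_neBot.1 hx.1
    have h1 : 0 ≤ η x := ge_of_tendsto ht
      (Filter.eventually_of_mem self_mem_nhdsWithin fun y hy => by
        have := (hNG hy).2.2
        simp only [hη, hf]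
        linarith)
    have h2 : η x ≤ 0 := by
      by_contra hpos
      refine not_mem_of_mem_closure_connectedComponentIn hx₀G hx.1 hx.2
        ⟨hcball hxb, hmemΓ x hxb, ?_⟩
      simp only [hη, hf] at hpos
      linarith
    rwa [le_antisymm h2 h1] at ht

/-! ### Boundary values and the global estimate -/

theorem ball_bdryDist_subset {Ω Ω' : Set (Eu n)} (hΩ : IsOpen Ω) (hs : Ω' ⊆ Ω) {x : Eu n}
    (hx : x ∈ Ω') : Metric.ball x (bdryDist Ω' Ω) ⊆ Ω := by
  have h1 : bdryDist Ω' Ω ≤ Metric.infDist x (frontier Ω) :=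
    csInf_le ⟨0, by rintro _ ⟨y, -, rfl⟩; exact Metric.infDist_nonneg⟩ (mem_image_of_mem _ hx)
  rcases le_or_gt (bdryDist Ω' Ω) 0 with h0 | h0
  · rw [Metric.ball_eq_empty.2 h0]
    exact empty_subset _
  refine (convex_ball x _).isPreconnected.subset_left_of_subset_union hΩ
    isClosed_closure.isOpen_compl (disjoint_compl_right.mono_left subset_closure)
    (fun y hy => ?_) ⟨x, Metric.mem_ball_self h0, hs hx⟩
  by_contra hcon
  rw [mem_union, not_or, mem_compl_iff, not_not] at hcon
  have hyf : y ∈ frontier Ω := by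
    rw [hΩ.frontier_eq]
    exact ⟨hcon.2, hcon.1⟩
  exact Metric.notMem_of_dist_lt_infDist
    (lt_of_lt_of_le (by rw [dist_comm]; exact hy) h1) hyf

theorem bdryDist_pos (hn : 0 < n) {Ω Ω' : Set (Eu n)} (hΩ : IsOpen Ω) (hb : Bornology.IsBounded Ω)
    (hne : Ω'.Nonempty) (hs : CompactlyIn Ω' Ω) : 0 < bdryDist Ω' Ω := by
  have : Nontrivial (Eu n) := by
    have : Nonempty (Fin n) := ⟨⟨0, hn⟩⟩
    infer_instance
  have hf : (frontier Ω).Nonempty := by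
    rw [nonempty_frontier_iff]
    refine ⟨hne.mono (subset_closure.trans hs.2), ?_⟩
    rintro rfl
    exact NormedSpace.unbounded_univ ℝ (Eu n) hb
  obtain ⟨x, hx, hmin⟩ := hs.1.exists_isMinOn hne.closure
    (Metric.continuous_infDist_pt (frontier Ω)).continuousOn
  have hx0 : 0 < Metric.infDist x (frontier Ω) := by
    rw [← isClosed_frontier.notMem_iff_infDist_pos hf, hΩ.frontier_eq]
    exact fun h => h.2 (hs.2 hx)
  refine lt_of_lt_of_le hx0 (le_csInf (hne.image _) ?_)
  rintro _ ⟨y, hy, rfl⟩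
  exact hmin (subset_closure hy)

/-- A nonnegative symmetric form is bounded by the supremum of its values on unit vectors. -/
theorem norm_le_of_unit_le {w : Bil n} {c : ℝ} (hc : 0 ≤ c) (hsymm : ∀ ξ η, w ξ η = w η ξ)
    (hpos : ∀ ξ, 0 ≤ w ξ ξ) (hw : ∀ ξ : Eu n, ‖ξ‖ = 1 → w ξ ξ ≤ c) : ‖w‖ ≤ c := by
  have h1 : ∀ ξ : Eu n, w ξ ξ ≤ c * ‖ξ‖ ^ 2 := by
    intro ξ
    rcases eq_or_ne ξ 0 with rfl | hξ
    · simp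
    · have h2 := hw (‖ξ‖⁻¹ • ξ) (norm_smul_inv_norm hξ)
      have h3 : 0 < ‖ξ‖ := norm_pos_iff.2 hξ
      simp only [map_smul, smul_apply, smul_eq_mul] at h2
      rw [← mul_assoc, ← mul_inv, inv_mul_le_iff₀ (by positivity)] at h2
      linarith [sq ‖ξ‖]
  refine ContinuousLinearMap.opNorm_le_of_unit_norm hc fun ξ hξ =>
    ContinuousLinearMap.opNorm_le_of_unit_norm hc fun η hη => ?_
  have h2 : w (ξ + η) (ξ + η) - w (ξ - η) (ξ - η) = 4 * w ξ η := by
    simp only [map_add, map_sub, add_apply, sub_apply]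
    rw [hsymm η ξ]
    ring
  have h3 := h1 (ξ + η)
  have h4 := h1 (ξ - η)
  have h5 := hpos (ξ + η)
  have h6 := hpos (ξ - η)
  have h7 : ‖ξ + η‖ ≤ 2 := (norm_add_le _ _).trans (by linarith)
  have h8 : ‖ξ - η‖ ≤ 2 := (norm_sub_le _ _).trans (by linarith)
  have h9 : c * ‖ξ + η‖ ^ 2 ≤ c * 2 ^ 2 := by gcongr
  have h10 : c * ‖ξ - η‖ ^ 2 ≤ c * 2 ^ 2 := by gcongr
  rw [Real.norm_eq_abs, abs_le]
  constructor <;> linarith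

/-- For `u ∈ C²(Ω̄)` the Hessian attains its boundary values. -/
theorem IsCkClosure.tendsto_hess {Ω : Set (Eu n)} {u : Eu n → ℝ} (hu : IsCkClosure 2 u Ω)
    {p : Eu n} (hp : p ∈ closure Ω) :
    Filter.Tendsto (hess u) (𝓝[Ω] p) (𝓝 (hessExt Ω u p)) := by
  obtain ⟨F, hF, hFu⟩ := hu.2 2 le_rfl
  refine tendsto_extendFrom ⟨((continuousMultilinearCurryFin1 ℝ (Eu n) ℝ).toContinuousLinearEquiv :
    _ →L[ℝ] _).comp (continuousMultilinearCurryLeftEquiv ℝ (fun _ : Fin 2 => Eu n) ℝ (F p)), ?_⟩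
  have h1 : Filter.Tendsto F (𝓝[Ω] p) (𝓝 (F p)) :=
    (hF p hp).mono_left (nhdsWithin_mono p subset_closure)
  have h2 := ((continuousMultilinearCurryLeftEquiv ℝ (fun _ : Fin 2 => Eu n) ℝ).continuous.tendsto
    (F p)).comp h1
  have h3 := ((ContinuousLinearMap.compL ℝ (Eu n)
    (ContinuousMultilinearMap ℝ (fun _ : Fin 1 => Eu n) ℝ) (Eu n →L[ℝ] ℝ)
    ((continuousMultilinearCurryFin1 ℝ (Eu n) ℝ).toContinuousLinearEquiv :
      _ →L[ℝ] _)).continuous.tendsto _).comp h2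
  refine h3.congr' (Filter.eventually_of_mem self_mem_nhdsWithin fun x hx => ?_)
  ext ξ η
  simp only [Function.comp_apply, hFu hx]
  -- currying evaluates at `(ξ, η)`, in this form
  change iteratedFDeriv ℝ 2 u x (Fin.cons ξ (Fin.snoc 0 η)) = _
  rw [iteratedFDeriv_two_apply]
  rfl

/-- The theorem in real numbers. The interior bound holds on `closure Ω'`, so the boundary values of
`D²u` on `Ω \ closure Ω'` are bounded by it and by those on the boundary of `Ω`; the barrier then gives
the bound in between. -/
theorem global_bound {Γ : Set (Eu n × Eu n × ℝ)} {g : Eu n × Eu n × ℝ → ℝ}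
    {Y : Eu n × ℝ × Eu n → Eu n} {Z : Eu n × ℝ × Eu n → ℝ} (hg : IsGenerating Γ g Y Z)
    {B : Eu n × ℝ × Eu n → ℝ} (hAB : IsRegularData (jetDom Γ g) (genA g Y Z) B)
    {U₀ : Set (Eu n × ℝ × Eu n)} (hU₀ : CompactlyIn U₀ (jetDom Γ g))
    {R₀ : ℝ} (hR₀ : 0 < R₀) {ω₀ : ℝ → ℝ} (hω₀ : ∀ R ∈ Ioo 0 R₀, 0 < ω₀ R) (k : ℝ) :
    ∃ C : ℝ, 0 < C ∧ ∀ (Ω Ω' : Set (Eu n)) (u φ : Eu n → ℝ) (S : ℝ), IsOpen Ω →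
      Bornology.IsBounded Ω → closure Ω' ⊆ Ω → bdryDist Ω' Ω = R₀ → ContDiffOn ℝ 4 u Ω →
      IsCkClosure 2 u Ω → MapsTo (jet u) Ω U₀ → IsEllipticSolution (genA g Y Z) B Ω u →
      (∀ R ∈ Ioo 0 R₀, ENNReal.ofReal (ω₀ R) ≤ modulusOn Γ g Y Z Ω' Ω u R) →
      IsABarrier (genA g Y Z) u (Ω \ closure Ω') φ →
      (∀ x ∈ Ω \ closure Ω', |φ x| ≤ k ∧ ‖∇ φ x‖ ≤ k) →
      0 ≤ S → (∀ p ∈ frontier Ω, ‖hessExt Ω u p‖ ≤ S) →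
      ∀ x ∈ Ω, ‖hess u x‖ ≤ C * (1 + S) := by
  obtain ⟨M, hM, hreg⟩ := exists_regularOn hg hAB hU₀.1 hU₀.2
  obtain ⟨C₁, hC₁⟩ := exists_interior_bound hg hAB hU₀.1 hU₀.2 hR₀ hω₀
  obtain ⟨C₂, hC₂, hbar⟩ := exists_bound_of_barrier n hM k
  set H : ℝ := max C₁ 0 + M with hH
  have hH0 : 0 < H := by positivity
  refine ⟨C₂ * (2 + H) + M + H, by positivity, fun Ω Ω' u φ S hΩ hb hs hd hu hu2 hJ hsol hmod hφ hφk
    hS hbd => ?_⟩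
  have hJ' : MapsTo (jet u) Ω (closure U₀) := fun x hx => subset_closure (hJ hx)
  have hso := hreg.solutionOn hΩ hu hJ' hsol
  have hcont : ∀ x ∈ Ω, ContinuousAt (hess u) x := fun x hx =>
    (contDiffAt_hess (hso.u4 x hx)).continuousAt
  -- upper bounds for the positive form `w` bound the Hessian
  have hnorm : ∀ x ∈ Ω, ∀ c : ℝ, 0 ≤ c →
      (∀ ξ : Eu n, ‖ξ‖ = 1 → augHess (genA g Y Z) u x ξ ξ ≤ c) → ‖hess u x‖ ≤ c + M := by
    intro x hx c hc hw
    have h1 : ‖augHess (genA g Y Z) u x‖ ≤ c := by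
      refine norm_le_of_unit_le hc (fun ξ η => ?_) (fun ξ => ?_) hw
      · simp only [augHess, sub_apply]
        rw [hess_symm ((hso.u4 x hx).of_le (by norm_num)), (hso.symm x hx).self_of_nhds]
      · rcases eq_or_ne ξ 0 with rfl | hξ
        · simp
        · exact (hso.pos x hx ξ hξ).le
    rw [EigenPoint.hess_eq (genA g Y Z)]
    exact (norm_add_le _ _).trans (add_le_add h1 (hso.bound x hx).A0)
  have hΩ'H : ∀ x ∈ Ω', ‖hess u x‖ ≤ H := fun x hx =>
    hnorm x (hs (subset_closure hx)) _ (le_max_right _ _) fun ξ hξ =>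
      (hC₁ Ω u x hΩ (hd ▸ ball_bdryDist_subset hΩ (subset_closure.trans hs) hx) hu hJ' hsol
        (fun R hR => (hmod R hR).trans (iInf₂_le x hx)) ξ hξ).trans (le_max_left _ _)
  have hclH : ∀ x ∈ closure Ω', ‖hess u x‖ ≤ H := by
    intro x hx
    have : (𝓝[Ω'] x).NeBot := mem_closure_iff_nhdsWithin_neBot.1 hx
    exact le_of_tendsto ((hcont x (hs hx)).norm.tendsto.mono_left nhdsWithin_le_nhds)
      (Filter.eventually_of_mem self_mem_nhdsWithin hΩ'H)
  have hNo : IsOpen (Ω \ closure Ω') := hΩ.sdiff isClosed_closure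
  have hN : ∀ x ∈ Ω \ closure Ω', ∀ ξ : Eu n, ‖ξ‖ = 1 →
      augHess (genA g Y Z) u x ξ ξ ≤ C₂ * (1 + (H + S + 1)) := by
    refine hbar _ _ _ u φ _ (hso.mono hNo sdiff_subset) (hb.subset sdiff_subset) (by positivity)
      (fun x hx => ⟨hφ.1.1.contDiffAt (hNo.mem_nhds hx), (hφk x hx).1, (hφk x hx).2,
        fun ξ hξ => ?_⟩) (fun p hp => ?_)
    · have h1 := hφ.2 x hx ξ
      rwa [(fderiv_fibre (hso.A2 x hx.1) ξ _).1, hξ, one_pow] at h1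
    · by_cases hpΩ : p ∈ Ω
      · have hpcl : p ∈ closure Ω' := by
          by_contra hcon
          exact hp.2 ⟨hpΩ, hcon⟩
        have h1 : ‖hess u p‖ < H + S + 1 := by linarith [hclH p hpcl]
        exact ((hcont p hpΩ).norm.eventually_lt_const h1).filter_mono nhdsWithin_le_nhds
          |>.mono fun _ h => h.le
      · have hpcl : p ∈ closure Ω := closure_mono sdiff_subset hp.1
        have h1 : ‖hessExt Ω u p‖ < H + S + 1 := by
          have := hbd p (by rw [hΩ.frontier_eq]; exact ⟨hpcl, hpΩ⟩)
          linarith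
        exact ((hu2.tendsto_hess hpcl).norm.eventually_lt_const h1).filter_mono
          (nhdsWithin_mono p sdiff_subset) |>.mono fun _ h => h.le
  intro x hx
  by_cases hxcl : x ∈ closure Ω'
  · refine (hclH x hxcl).trans ?_
    have : 0 ≤ C₂ * (2 + H) + M := by positivity
    nlinarith
  · refine (hnorm x hx _ (by positivity) (hN x ⟨hx, hxcl⟩)).trans ?_
    have h1 : 0 ≤ C₂ * ((1 + H) * S) := by positivity
    have h2 : 0 ≤ H * (1 + S) := by positivity
    have h3 : 0 ≤ M * S := by positivity
    nlinarith

theorem enorm_le_c1Norm {φ : Eu n → ℝ} {N : Set (Eu n)} {k : ℝ≥0} (h : c1Norm φ N ≤ k) :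
    ∀ x ∈ N, |φ x| ≤ k ∧ ‖∇ φ x‖ ≤ k := by
  intro x hx
  have h1 : ‖φ x‖ₑ ≤ k := ((le_iSup₂ (f := fun x (_ : x ∈ N) => ‖φ x‖ₑ) x hx).trans
    le_self_add).trans h
  have h2 : ‖∇ φ x‖ₑ ≤ k := ((le_iSup₂ (f := fun x (_ : x ∈ N) => ‖∇ φ x‖ₑ) x hx).trans
    le_add_self).trans h
  rw [enorm_le_coe] at h1 h2
  exact ⟨by exact_mod_cast h1, by exact_mod_cast h2⟩

theorem nnnorm_hess_dim_zero (u : Eu 0 → ℝ) (x : Eu 0) : ‖hess u x‖₊ = 0 := by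
  rw [Subsingleton.elim (hess u x) 0, nnnorm_zero]

end GJE

end

theorem corollary2p1 (n : ℕ)
    (Γ : Set (GJE.Eu n × GJE.Eu n × ℝ)) (g : GJE.Eu n × GJE.Eu n × ℝ → ℝ)
    (Y : GJE.Eu n × ℝ × GJE.Eu n → GJE.Eu n) (Z : GJE.Eu n × ℝ × GJE.Eu n → ℝ)
    (hg : GJE.IsGenerating Γ g Y Z)
    (B : GJE.Eu n × ℝ × GJE.Eu n → ℝ)
    (hAB : GJE.IsRegularData (GJE.jetDom Γ g) (GJE.genA g Y Z) B)
    (U₀ : Set (GJE.Eu n × ℝ × GJE.Eu n)) (hU₀ : GJE.CompactlyIn U₀ (GJE.jetDom Γ g))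
    (R₀ : ℝ) (ω₀ : ℝ → ℝ) (hω₀ : ∀ R ∈ Ioo 0 R₀, 0 < ω₀ R) (K : ℝ≥0) :
    ∃ C : ℝ≥0, ∀ (Ω Ω' : Set (GJE.Eu n)) (u φ : GJE.Eu n → ℝ),
      GJE.IsDom Ω → Bornology.IsBounded Ω →
      GJE.IsDom Ω' → GJE.CompactlyIn Ω' Ω → GJE.bdryDist Ω' Ω = R₀ →
      ContDiffOn ℝ 4 u Ω → GJE.IsCkClosure 2 u Ω →
      MapsTo (GJE.jet u) Ω U₀ →
      GJE.IsEllipticSolution (GJE.genA g Y Z) B Ω u →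
      (∀ R ∈ Ioo 0 R₀, ENNReal.ofReal (ω₀ R) ≤ GJE.modulusOn Γ g Y Z Ω' Ω u R) →
      GJE.IsABarrier (GJE.genA g Y Z) u (Ω \ closure Ω') φ →
      GJE.c1Norm φ (Ω \ closure Ω') ≤ K →
      (⨆ x ∈ Ω, ‖GJE.hess u x‖ₑ) ≤
        C * (1 + ⨆ x ∈ frontier Ω, ‖GJE.hessExt Ω u x‖ₑ) := by
  rcases n.eq_zero_or_pos with rfl | hn
  -- in dimension zero the Hessian vanishes
  · refine ⟨0, fun Ω Ω' u φ _ _ _ _ _ _ _ _ _ _ _ _ => iSup₂_le fun x _ => ?_⟩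
    exact (enorm_le_coe.2 (GJE.nnnorm_hess_dim_zero u x).le).trans zero_le
  rcases le_or_gt R₀ 0 with hR₀ | hR₀
  -- the distance of `Ω'` to `∂Ω` is positive
  · refine ⟨0, fun Ω Ω' u φ hΩ hb hΩ' hs hd _ _ _ _ _ _ _ => ?_⟩
    have := GJE.bdryDist_pos hn hΩ.1 hb hΩ'.2.nonempty hs
    linarith
  obtain ⟨C, hC, h⟩ := GJE.global_bound hg hAB hU₀ hR₀ hω₀ K
  lift C to ℝ≥0 using hC.le
  refine ⟨C, fun Ω Ω' u φ hΩ hb hΩ' hs hd hu hu2 hJ hsol hmod hφ hφK => ?_⟩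
  have hbd : ∀ p ∈ frontier Ω, ‖GJE.hessExt Ω u p‖ₑ ≤ ⨆ x ∈ frontier Ω, ‖GJE.hessExt Ω u x‖ₑ :=
    fun p hp => le_iSup₂ (f := fun x (_ : x ∈ frontier Ω) => ‖GJE.hessExt Ω u x‖ₑ) p hp
  generalize (⨆ x ∈ frontier Ω, ‖GJE.hessExt Ω u x‖ₑ) = σ at hbd ⊢
  rcases eq_or_ne σ ⊤ with rfl | htop
  · have hC0 : (C : ℝ≥0∞) ≠ 0 := by
      rw [Ne, ENNReal.coe_eq_zero, ← NNReal.coe_eq_zero]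
      exact hC.ne'
    rw [add_top, ENNReal.mul_top hC0]
    exact le_top
  · lift σ to ℝ≥0 using htop
    refine iSup₂_le fun x hx => ?_
    have h1 := h Ω Ω' u φ σ hΩ.1 hb hs.2 hd hu hu2 hJ hsol hmod hφ (GJE.enorm_le_c1Norm hφK) σ.2
      (fun p hp => by exact_mod_cast enorm_le_coe.1 (hbd p hp)) x hx
    have h2 : ‖GJE.hess u x‖ₑ ≤ ((C * (1 + σ) : ℝ≥0) : ℝ≥0∞) := by
      rw [enorm_le_coe, ← NNReal.coe_le_coe]
      simpa using h1
    simpa using h2
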